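/- Let $\Gamma$ be a finite group and let $\gamma_0,\dots,\gamma_r$ be its irreducible complex characters, $\gamma_0$ being the trivial one. *Groups.* For $n\ge 0$ let $\widetilde S_n$ be the group generated by $z,t_1,\dots,t_{n-1}$ subject to $z^2=1$, $t_i^2=z$, $(t_it_{i+1})^3=z$, $t_it_j=zt_jt_i$ for $i>j+1$, $zt_i=t_iz$, and let $\widetilde\Gamma_n=\Gamma^n\rtimes\widetilde S_n$, where $\widetilde S_n$ permutes the factors through $\widetilde S_n\to S_n$. The parity $d:\widetilde\Gamma_n\to\mathbb Z/2$ is trivial on $\Gamma^n$ and on $z$, and $d(t_i)=1$. Let $R^-(\widetilde\Gamma_n)$ be the complex vector space of spin super class functions, i.e. of class functions $f:\widetilde\Gamma_n\to\mathbb C$ with $f(zx)=-f(x)$ that vanish on odd elements, and let $R^-_\Gamma=\bigoplus_{n\ge 0}R^-(\widetilde\Gamma_n)$. *Products.* Let $\widetilde\Gamma_n\hat\times\widetilde\Gamma_m\subset\widetilde\Gamma_{n+m}$ be the subgroup generated by the copy of $\widetilde\Gamma_n$ on the first $n$ letters and the copy of $\widetilde\Gamma_m$ on the last $m$ letters. For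 spin super class functions $f,g$ let $f\hat\otimes g$ be the function on it whose value at the product of $x$ in the first copy and $y$ in the second is $f(x)g(y)$. $\mathrm{Ind}$ and $\mathrm{Res}$ are induction and restriction between the subgroup and $\widetilde\Gamma_{n+m}$. For $\xi=\gamma_0$ the bilinear form is the standard one, $\langle f,g\rangle=|\widetilde\Gamma_n|^{-1}\sum_{x}f(x)g(x^{-1})$. For $f\in R^-(\widetilde\Gamma_n)$, pairing with $f$ in the first factor sends $f'\hat\otimes g$ to $\langle f,f'\rangle g$. *Basic spin characters.* Let $V$ be a $\Gamma$-module with character $\gamma$ and let $L_n=(\mathbb C^{1|1})^{\otimes\lfloor n/2\rfloor}$ be the basic spin supermodule of $\widetilde S_n$, where $z=-1$ and $t_j=\sqrt{\tfrac{j+1}{2j}}\,e_j-\sqrt{\tfrac{j-1}{2j}}\,e_{j-1}$ for the standard Clifford generators, $e_ie_j+e_je_i=-2\delta_{ij}$. Let $\chi_n(\gamma)\in R^-(\widetilde\Gamma_n)$ be the character of $V^{\otimes n}\otimes L_n$, where $\Gamma^n$ acts on $V^{\otimes n}$ factorwise and $\widetilde S_n$ acts by permuting the factors of $V^{\otimes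 n}$ and on $L_n$. Put $\chi_n(-\gamma)=\sum_{m=0}^n(-1)^m\,\mathrm{Ind}\big(\chi_{n-m}(0)\hat\otimes\chi_m(\gamma)\big)$, where $\chi_k(0)$ is the character obtained from the zero module. *Vertex operators.* Let $\bar n\in\{0,1\}$ be the residue of $n$ modulo $2$. For $n\ge0$ and $\beta=\pm\gamma_i$ define operators on $R^-_\Gamma$ by $$H_{-n}(\beta)f=\mathrm{Ind}\big(2^{\bar n/2}\chi_n(\beta)\hat\otimes f\big),\qquad H_n(\beta)f=\big\langle 2^{\bar n/2}\chi_n(\beta),\mathrm{Res}\,f\big\rangle,$$ the second being $0$ on $R^-(\widetilde\Gamma_m)$ for $m<n$ (so $H_0(\beta)=1$). Put $$H_+(\beta,z)=\sum_{n\ge0}H_{-n}(\beta)z^n,\qquad H_-(\beta,z)=\sum_{n\ge0}H_n(\beta)z^{-n},$$ and define $X^\pm_n(\gamma_i)$, $n\in\mathbb Z$, by $$H_+(\pm\gamma_i,z)\,H_-(\pm\gamma_i,-z)=\sum_{n\in\mathbb Z}X^{\pm}_n(\gamma_i)z^{-n}.$$ **Theorem.** The operators $X^\pm_n(\gamma_i)$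 ($n\in\mathbb Z$, $0\le i\le r$) on $R^-_\Gamma$ generate a generalized Clifford algebra: for all $n,n'\in\mathbb Z$, $$[X^+_n(\gamma_i),X^+_{n'}(\gamma_j)]=[X^-_n(\gamma_i),X^-_{n'}(\gamma_j)]=[X^+_n(\gamma_i),X^-_{n'}(\gamma_j)]=0\qquad(i\ne j),$$ $$\{X^+_n(\gamma_i),X^+_{n'}(\gamma_i)\}=\{X^-_n(\gamma_i),X^-_{n'}(\gamma_i)\}=2(-1)^n\delta_{n,-n'},$$ $$\{X^+_n(\gamma_i),X^-_{n'}(\gamma_i)\}=2\,\delta_{n,-n'},$$ where $[A,B]=AB-BA$ and $\{A,B\}=AB+BA$. -/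

import Mathlib

namespace SpinVertex

/-! ## The spin group -/

/-- Relators of the spin group on `n` letters. The generator `none` is the central involution `z`;
`some a` (`a : Fin (n - 1)`, counted from `0`) lifts the transposition of the letters
`a` and `a + 1`. -/
def spinRels (n : ℕ) : Set (FreeGroup (Option (Fin (n - 1)))) :=
  {r | r = FreeGroup.of none ^ 2 ∨
    (∃ i, r = FreeGroup.of (some i) ^ 2 * (FreeGroup.of none)⁻¹) ∨
    (∃ i j : Fin (n - 1), j.1 = i.1 + 1 ∧
      r = (FreeGroup.of (some i) * FreeGroup.of (some j)) ^ 3 * (FreeGroup.of none)⁻¹) ∨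
    (∃ i j : Fin (n - 1), j.1 + 1 < i.1 ∧
      r = FreeGroup.of (some i) * FreeGroup.of (some j) *
        (FreeGroup.of none * FreeGroup.of (some j) * FreeGroup.of (some i))⁻¹) ∨
    (∃ i, r = FreeGroup.of none * FreeGroup.of (some i) *
        (FreeGroup.of (some i) * FreeGroup.of none)⁻¹)}

/-- The spin group on `n` letters, a double cover of the symmetric group. -/
abbrev SpinSym (n : ℕ) : Type := PresentedGroup (spinRels n)

namespace SpinSym

/-- The central involution `z`. -/
def z (n : ℕ) : SpinSym n := PresentedGroup.of none

/-- The generators `t` of the spin group. -/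
def t {n : ℕ} (a : Fin (n - 1)) : SpinSym n := PresentedGroup.of (some a)

end SpinSym

/-- Elements of a group that satisfy the defining relations of the spin group. -/
structure IsSpinSystem {G : Type*} [Group G] (n : ℕ) (z : G) (t : Fin (n - 1) → G) : Prop where
  z_sq : z ^ 2 = 1
  t_sq : ∀ i, t i ^ 2 = z
  braid : ∀ i j, j.1 = i.1 + 1 → (t i * t j) ^ 3 = z
  comm : ∀ i j, j.1 + 1 < i.1 → t i * t j = z * t j * t i
  central : ∀ i, z * t i = t i * z

/-- The homomorphism out of the spin group with prescribed values on the generators. -/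
def SpinSym.lift {G : Type*} [Group G] {n : ℕ} {z : G} {t : Fin (n - 1) → G}
    (h : IsSpinSystem n z t) : SpinSym n →* G :=
  PresentedGroup.toGroup (f := fun o => o.elim z t) (by
    rintro r (rfl | ⟨i, rfl⟩ | ⟨i, j, hij, rfl⟩ | ⟨i, j, hij, rfl⟩ | ⟨i, rfl⟩)
    · simpa using h.z_sq
    · simpa [mul_inv_eq_one] using h.t_sq i
    · simpa [mul_inv_eq_one] using h.braid i j hij
    · simpa only [map_mul, map_inv, FreeGroup.lift_apply_of, Option.elim, mul_inv_eq_one]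
        using h.comm i j hij
    · simpa only [map_mul, map_inv, FreeGroup.lift_apply_of, Option.elim, mul_inv_eq_one]
        using h.central i)

@[simp] theorem SpinSym.lift_z {G : Type*} [Group G] {n : ℕ} {z : G} {t : Fin (n - 1) → G}
    (h : IsSpinSystem n z t) : SpinSym.lift h (SpinSym.z n) = z :=
  PresentedGroup.toGroup.of _

@[simp] theorem SpinSym.lift_t {G : Type*} [Group G] {n : ℕ} {z : G} {t : Fin (n - 1) → G}
    (h : IsSpinSystem n z t) (a : Fin (n - 1)) : SpinSym.lift h (SpinSym.t a) = t a :=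
  PresentedGroup.toGroup.of _

theorem SpinSym.isSpinSystem (n : ℕ) : IsSpinSystem n (SpinSym.z n) (SpinSym.t (n := n)) where
  z_sq := PresentedGroup.one_of_mem (rels := spinRels n) (Or.inl rfl)
  t_sq i := PresentedGroup.mk_eq_mk_of_mul_inv_mem (rels := spinRels n)
    (x := FreeGroup.of (some i) ^ 2) (y := FreeGroup.of none) (Or.inr (Or.inl ⟨i, rfl⟩))
  braid i j hij := PresentedGroup.mk_eq_mk_of_mul_inv_mem (rels := spinRels n)
    (x := (FreeGroup.of (some i) * FreeGroup.of (some j)) ^ 3) (y := FreeGroup.of none)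
    (Or.inr (Or.inr (Or.inl ⟨i, j, hij, rfl⟩)))
  comm i j hij := PresentedGroup.mk_eq_mk_of_mul_inv_mem (rels := spinRels n)
    (x := FreeGroup.of (some i) * FreeGroup.of (some j))
    (y := FreeGroup.of none * FreeGroup.of (some j) * FreeGroup.of (some i))
    (Or.inr (Or.inr (Or.inr (Or.inl ⟨i, j, hij, rfl⟩))))
  central i := PresentedGroup.mk_eq_mk_of_mul_inv_mem (rels := spinRels n)
    (x := FreeGroup.of none * FreeGroup.of (some i))
    (y := FreeGroup.of (some i) * FreeGroup.of none)
    (Or.inr (Or.inr (Or.inr (Or.inr ⟨i, rfl⟩))))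

/-- Two homomorphisms that agree on the generators are equal. -/
theorem SpinSym.hom_ext {G : Type*} [Group G] {n : ℕ} {f g : SpinSym n →* G}
    (hz : f (SpinSym.z n) = g (SpinSym.z n)) (ht : ∀ a, f (SpinSym.t a) = g (SpinSym.t a)) :
    f = g :=
  PresentedGroup.ext (fun x => by cases x with
    | none => exact hz
    | some a => exact ht a)

/-- A subgroup that contains the generators is everything. -/
theorem SpinSym.generated {n : ℕ} (H : Subgroup (SpinSym n)) (hz : SpinSym.z n ∈ H)
    (ht : ∀ a, SpinSym.t a ∈ H) (x : SpinSym n) : x ∈ H :=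
  PresentedGroup.generated_by _ H (fun x => by cases x with
    | none => exact hz
    | some a => exact ht a) x

theorem SpinSym.z_mul_z (n : ℕ) : SpinSym.z n * SpinSym.z n = 1 := by
  have := (SpinSym.isSpinSystem n).z_sq
  rwa [sq] at this

theorem SpinSym.z_comm {n : ℕ} (x : SpinSym n) : SpinSym.z n * x = x * SpinSym.z n := by
  have : x ∈ Subgroup.centralizer {SpinSym.z n} :=
    SpinSym.generated _ (by simp [Subgroup.mem_centralizer_iff])
      (fun a => by simpa [Subgroup.mem_centralizer_iff] using
        (SpinSym.isSpinSystem n).central a) x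
  simpa [Subgroup.mem_centralizer_iff] using this

/-- The transposition of the letters `a` and `a + 1`. -/
def adjSwap {n : ℕ} (a : Fin (n - 1)) : Equiv.Perm (Fin n) :=
  Equiv.swap ⟨a.1, by omega⟩ ⟨a.1 + 1, by omega⟩

theorem adjSwap_isSpinSystem (n : ℕ) :
    IsSpinSystem n (1 : Equiv.Perm (Fin n)) (adjSwap (n := n)) where
  z_sq := by simp
  t_sq i := by simp [adjSwap, sq]
  braid i j hij := by
    obtain ⟨j, hj⟩ := j
    simp only at hij
    subst hij
    have h1 : (⟨i.1, by omega⟩ : Fin n) ≠ ⟨i.1 + 1, by omega⟩ := by simp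
    have h2 : (⟨i.1 + 1, by omega⟩ : Fin n) ≠ ⟨i.1 + 1 + 1, by omega⟩ := by simp
    have h3 : (⟨i.1, by omega⟩ : Fin n) ≠ ⟨i.1 + 1 + 1, by omega⟩ := by
      simp only [ne_eq, Fin.mk.injEq]; omega
    have h := Equiv.Perm.isThreeCycle_swap_mul_swap_same h1.symm h2 h3
    have h' := h.orderOf
    have := pow_orderOf_eq_one (Equiv.swap (⟨i.1 + 1, by omega⟩ : Fin n) ⟨i.1, by omega⟩ *
      Equiv.swap (⟨i.1 + 1, by omega⟩ : Fin n) ⟨i.1 + 1 + 1, by omega⟩)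
    rw [h', Equiv.swap_comm (⟨i.1 + 1, by omega⟩ : Fin n) ⟨i.1, by omega⟩] at this
    exact this
  comm i j hij := by
    have : (adjSwap i).Disjoint (adjSwap j) := by
      unfold adjSwap
      rw [Equiv.Perm.disjoint_iff_disjoint_support, Equiv.Perm.support_swap (by simp),
        Equiv.Perm.support_swap (by simp)]
      simp; omega
    simpa using this.commute.eq
  central i := by simp

/-- The covering homomorphism onto the symmetric group. -/
def SpinSym.toPerm (n : ℕ) : SpinSym n →* Equiv.Perm (Fin n) :=
  SpinSym.lift (adjSwap_isSpinSystem n)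

/-- The parity homomorphism: `z` is even, every generator `t` is odd. -/
def SpinSym.parity (n : ℕ) : SpinSym n →* Multiplicative (ZMod 2) :=
  SpinSym.lift (z := 1) (t := fun _ => Multiplicative.ofAdd 1)
    ⟨by decide, fun _ => by decide, fun _ _ _ => by decide, fun _ _ _ => by decide,
      fun _ => by decide⟩

/-! ### Finiteness of the spin group -/

/-- Words `s m * s (m - 1) * ⋯` with `j` letters. -/
def descWord {Q : Type*} [Group Q] (s : ℕ → Q) (m : ℕ) : ℕ → Q
  | 0 => 1
  | j + 1 => descWord s m j * s (m - j)

theorem descWord_comm {Q : Type*} [Group Q] (s : ℕ → Q) (m N : ℕ) (hm : m < N)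
    (hc : ∀ i j, i + 1 < j → j < N → s i * s j = s j * s i) (i : ℕ) :
    ∀ j, j + i + 1 ≤ m + 1 → i + j < m + 1 →
      (j = 0 ∨ i + 1 < m + 1 - j) → descWord s m j * s i = s i * descWord s m j := by
  intro j
  induction j with
  | zero => intros; simp [descWord]
  | succ j ih =>
    intro h1 h2 h3
    have h4 : i + 1 < m - j := by omega
    have := ih (by omega) (by omega) (Or.inr (by omega))
    rw [descWord, mul_assoc, ← hc i (m - j) h4 (by omega), ← mul_assoc, this, mul_assoc]

theorem descWord_shift {Q : Type*} [Group Q] (s : ℕ → Q) (m N : ℕ) (hm : m < N)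
    (hc : ∀ i j, i + 1 < j → j < N → s i * s j = s j * s i)
    (hb : ∀ i, i + 1 < N → s (i + 1) * s i * s (i + 1) = s i * s (i + 1) * s i)
    (i : ℕ) (hi : i + 1 ≤ m) :
    ∀ j, j ≤ m + 1 → m + 1 - j ≤ i →
      descWord s m j * s (i + 1) = s i * descWord s m j := by
  intro j
  induction j with
  | zero => intros; omega
  | succ j ih =>
    intro h1 h2
    by_cases h3 : m - j = i
    · obtain ⟨j, rfl⟩ : ∃ j', j = j' + 1 := ⟨j - 1, by omega⟩
      have h4 : m - j = i + 1 := by omega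
      have hcm := descWord_comm s m N hm hc i j (by omega) (by omega) (by omega)
      rw [descWord, descWord, h3, h4]
      calc descWord s m j * s (i + 1) * s i * s (i + 1)
          = descWord s m j * (s (i + 1) * s i * s (i + 1)) := by group
        _ = descWord s m j * s i * s (i + 1) * s i := by rw [hb i (by omega)]; group
        _ = s i * (descWord s m j * s (i + 1) * s i) := by rw [hcm]; group
    · have := ih (by omega) (by omega)
      rw [descWord, mul_assoc, hc (m - j) (i + 1) (by omega) (by omega), ← mul_assoc, this,
        mul_assoc]

/-- The elements built from the first `m` Coxeter generators of type `A`. -/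
theorem exists_finset_coxeter {Q : Type*} [Group Q] [DecidableEq Q] (s : ℕ → Q) (N : ℕ)
    (h2 : ∀ i, i < N → s i * s i = 1)
    (hc : ∀ i j, i + 1 < j → j < N → s i * s j = s j * s i)
    (hb : ∀ i, i + 1 < N → s (i + 1) * s i * s (i + 1) = s i * s (i + 1) * s i) :
    ∀ m, m ≤ N → ∃ A : Finset Q, 1 ∈ A ∧ (∀ a ∈ A, ∀ i, i < m → a * s i ∈ A) ∧
      A.card ≤ (m + 1).factorial := by
  intro m
  induction m with
  | zero => exact fun _ => ⟨{1}, by simp, by simp, by simp⟩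
  | succ m ih =>
    intro hm
    obtain ⟨A, h1, hA, hcard⟩ := ih (by omega)
    refine ⟨(A ×ˢ Finset.range (m + 2)).image (fun p => p.1 * descWord s m p.2), ?_, ?_, ?_⟩
    · exact Finset.mem_image.2 ⟨(1, 0), by simp [h1], by simp [descWord]⟩
    · intro x hx i hi
      obtain ⟨⟨a, j⟩, hp, rfl⟩ := Finset.mem_image.1 hx
      obtain ⟨ha, hj⟩ := Finset.mem_product.1 hp
      have hj : j < m + 2 := Finset.mem_range.1 hj
      have key : ∀ b ∈ A, ∀ j' < m + 2, ∀ y, y = b * descWord s m j' →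
          y ∈ (A ×ˢ Finset.range (m + 2)).image (fun p => p.1 * descWord s m p.2) := by
        intro b hb j' hj' y hy
        exact Finset.mem_image.2
          ⟨(b, j'), Finset.mem_product.2 ⟨hb, Finset.mem_range.2 hj'⟩, hy.symm⟩
      simp only
      by_cases c1 : i = m - j ∧ j ≤ m
      · refine key a ha (j + 1) (by omega) _ ?_
        rw [descWord, c1.1, mul_assoc]
      by_cases c2 : 1 ≤ j ∧ i = m + 1 - j
      · obtain ⟨j, rfl⟩ : ∃ j', j = j' + 1 := ⟨j - 1, by omega⟩
        refine key a ha j (by omega) _ ?_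
        have : i = m - j := by omega
        rw [descWord, this, mul_assoc, mul_assoc, h2 _ (by omega), mul_one]
      by_cases c3 : i + j < m
      · refine key (a * s i) (hA a ha i (by omega)) j hj _ ?_
        rw [mul_assoc, descWord_comm s m N (by omega) hc i j (by omega) (by omega) (by omega),
          mul_assoc]
      · obtain ⟨i, rfl⟩ : ∃ i', i = i' + 1 := ⟨i - 1, by omega⟩
        refine key (a * s i) (hA a ha i (by omega)) j hj _ ?_
        rw [mul_assoc, descWord_shift s m N (by omega) hc hb i (by omega) j (by omega) (by omega),
          mul_assoc]
    · refine Finset.card_image_le.trans ?_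
      rw [Finset.card_product, Finset.card_range, Nat.factorial_succ, mul_comm]
      exact Nat.mul_le_mul_left _ hcard

/-- The subgroup generated by the central involution. -/
def SpinSym.zSub (n : ℕ) : Subgroup (SpinSym n) := Subgroup.zpowers (SpinSym.z n)

instance (n : ℕ) : (SpinSym.zSub n).Normal :=
  ⟨fun x hx g => by
    obtain ⟨k, rfl⟩ := Subgroup.mem_zpowers_iff.1 hx
    have : Commute g (SpinSym.z n ^ k) := Commute.zpow_right (SpinSym.z_comm g).symm k
    rw [this.eq, mul_inv_cancel_right]
    exact hx⟩

theorem SpinSym.mem_zSub {n : ℕ} {x : SpinSym n} (hx : x ∈ SpinSym.zSub n) :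
    x = 1 ∨ x = SpinSym.z n := by
  obtain ⟨k, rfl⟩ := Subgroup.mem_zpowers_iff.1 hx
  have h := SpinSym.z_mul_z n
  rcases Int.even_or_odd k with ⟨l, rfl⟩ | ⟨l, rfl⟩
  · left; rw [zpow_add, ← (Commute.refl (SpinSym.z n)).mul_zpow, h, one_zpow]
  · right; rw [zpow_add, two_mul, zpow_add, ← (Commute.refl (SpinSym.z n)).mul_zpow, h, one_zpow, one_mul, zpow_one]

theorem SpinSym.quot_finite_card (n : ℕ) :
    Finite (SpinSym n ⧸ SpinSym.zSub n) ∧ Nat.card (SpinSym n ⧸ SpinSym.zSub n) ≤ n.factorial := by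
  classical
  set Q := SpinSym n ⧸ SpinSym.zSub n
  let π : SpinSym n →* Q := QuotientGroup.mk' (SpinSym.zSub n)
  have hπz : π (SpinSym.z n) = 1 :=
    (QuotientGroup.eq_one_iff _).2 (Subgroup.mem_zpowers _)
  let s : ℕ → Q := fun i => if h : i < n - 1 then π (SpinSym.t ⟨i, h⟩) else 1
  have hs : ∀ i (h : i < n - 1), s i = π (SpinSym.t ⟨i, h⟩) := fun i h => by simp [s, h]
  have S := SpinSym.isSpinSystem n
  have h2 : ∀ i, i < n - 1 → s i * s i = 1 := by
    intro i hi
    rw [hs i hi, ← map_mul, ← sq, S.t_sq, hπz]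
  have hc : ∀ i j, i + 1 < j → j < n - 1 → s i * s j = s j * s i := by
    intro i j hij hj
    have hi : i < n - 1 := by omega
    have := congrArg π (S.comm ⟨j, hj⟩ ⟨i, hi⟩ hij)
    rw [hs i hi, hs j hj]
    simpa [hπz] using this.symm
  have hb : ∀ i, i + 1 < n - 1 → s (i + 1) * s i * s (i + 1) = s i * s (i + 1) * s i := by
    intro i hi
    have hi' : i < n - 1 := by omega
    have := congrArg π (S.braid ⟨i, hi'⟩ ⟨i + 1, hi⟩ rfl)
    rw [map_pow, map_mul, hπz, ← hs i hi', ← hs _ hi] at this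
    have e1 : (s i)⁻¹ = s i := inv_eq_of_mul_eq_one_left (h2 i hi')
    have e2 : (s (i + 1))⁻¹ = s (i + 1) := inv_eq_of_mul_eq_one_left (h2 _ hi)
    have e3 : (s i * s (i + 1) * s i) * (s (i + 1) * s i * s (i + 1)) = 1 := by
      rw [← this]; simp only [pow_succ, pow_zero, one_mul, mul_assoc]
    have := eq_inv_of_mul_eq_one_right e3
    rw [this]
    simp [mul_inv_rev, e1, e2, mul_assoc]
  obtain ⟨A, h1, hA, hcard⟩ := exists_finset_coxeter s (n - 1) h2 hc hb (n - 1) le_rfl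
  have hall : ∀ x : SpinSym n, ∀ a ∈ A, a * π x ∈ A := by
    let H : Subgroup (SpinSym n) :=
      { carrier := {x | (∀ a ∈ A, a * π x ∈ A) ∧ (∀ a ∈ A, a * π x⁻¹ ∈ A)}
        one_mem' := by simp
        mul_mem' := by
          rintro x y ⟨hx, hx'⟩ ⟨hy, hy'⟩
          refine ⟨fun a ha => ?_, fun a ha => ?_⟩
          · rw [map_mul, ← mul_assoc]; exact hy _ (hx _ ha)
          · rw [mul_inv_rev, map_mul, ← mul_assoc]; exact hx' _ (hy' _ ha)
        inv_mem' := by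
          rintro x ⟨hx, hx'⟩
          exact ⟨hx', by simpa using hx⟩ }
    intro x
    have : x ∈ H := SpinSym.generated H
      (by simp [H, hπz])
      (fun a => by
        have e : π (SpinSym.t a) = s a.1 := (hs a.1 a.2).symm
        have e' : π (SpinSym.t a)⁻¹ = s a.1 := by
          rw [map_inv, e]; exact inv_eq_of_mul_eq_one_left (h2 _ a.2)
        refine ⟨fun b hb => ?_, fun b hb => ?_⟩
        · rw [e]; exact hA b hb _ a.2
        · rw [e']; exact hA b hb _ a.2) x
    exact this.1
  have hmem : ∀ q : Q, q ∈ A := by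
    intro q
    obtain ⟨x, rfl⟩ := QuotientGroup.mk'_surjective _ q
    have := hall x 1 h1
    rwa [one_mul] at this
  have hfin : Finite Q := Finite.of_injective (fun q => (⟨q, hmem q⟩ : A))
    (fun a b h => by simpa using h)
  refine ⟨hfin, ?_⟩
  have : Nat.card Q ≤ Nat.card A :=
    Nat.card_le_card_of_injective (fun q => (⟨q, hmem q⟩ : A)) (fun a b h => by simpa using h)
  rw [Nat.card_eq_fintype_card (α := A), Fintype.card_coe] at this
  refine this.trans (hcard.trans ?_)
  rcases Nat.eq_zero_or_pos n with rfl | h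
  · simp
  · rw [Nat.sub_add_cancel h]

instance SpinSym.instFinite (n : ℕ) : Finite (SpinSym n) := by
  have := (SpinSym.quot_finite_card n).1
  have : Finite (SpinSym.zSub n) := by
    refine Set.Finite.subset (Set.toFinite {1, SpinSym.z n}) ?_
    intro x hx
    exact SpinSym.mem_zSub hx
  exact Finite.of_equiv _ (Subgroup.groupEquivQuotientProdSubgroup (s := SpinSym.zSub n)).symm

theorem SpinSym.toPerm_surjective (n : ℕ) : Function.Surjective (SpinSym.toPerm n) := by
  rw [← MonoidHom.range_eq_top]
  rcases n with _ | n
  · exact Subsingleton.elim _ _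
  rw [eq_top_iff]
  intro x _
  have h := Equiv.Perm.mclosure_swap_castSucc_succ n
  have hx : x ∈ Submonoid.closure
    (Set.range fun i : Fin n => Equiv.swap i.castSucc i.succ) := by rw [h]; trivial
  refine (Submonoid.closure_le (S := (SpinSym.toPerm (n + 1)).range.toSubmonoid)).2 ?_ hx
  rintro _ ⟨i, rfl⟩
  exact ⟨SpinSym.t (n := n + 1) i, by rw [SpinSym.toPerm, SpinSym.lift_t]; rfl⟩

/-- The kernel of the covering homomorphism consists of `1` and `z`. -/
theorem SpinSym.toPerm_eq_one {n : ℕ} {x : SpinSym n} (hx : SpinSym.toPerm n x = 1) :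
    x = 1 ∨ x = SpinSym.z n := by
  obtain ⟨hf, hc⟩ := SpinSym.quot_finite_card n
  have hle : SpinSym.zSub n ≤ (SpinSym.toPerm n).ker := by
    rw [SpinSym.zSub, Subgroup.zpowers_le, MonoidHom.mem_ker, SpinSym.toPerm, SpinSym.lift_z]
  let f : SpinSym n ⧸ SpinSym.zSub n →* Equiv.Perm (Fin n) :=
    QuotientGroup.lift _ (SpinSym.toPerm n) hle
  have hsurj : Function.Surjective f := by
    intro y
    obtain ⟨x, rfl⟩ := SpinSym.toPerm_surjective n y
    exact ⟨(x : SpinSym n ⧸ SpinSym.zSub n), rfl⟩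
  have hcard : Nat.card (SpinSym n ⧸ SpinSym.zSub n) = Nat.card (Equiv.Perm (Fin n)) := by
    apply le_antisymm
    · rw [Nat.card_perm, Nat.card_fin]; exact hc
    · exact Nat.card_le_card_of_surjective f hsurj
  have hinj : Function.Injective f := (hsurj.bijective_of_nat_card_le hcard.le).1
  apply SpinSym.mem_zSub
  rw [← QuotientGroup.eq_one_iff]
  exact hinj (by rw [map_one]; exact hx)


/-! ## The spin wreath product -/

/-- The action of the spin group on `Γⁿ` by permuting the coordinates:
`(x • g) i = g (σ⁻¹ i)`, where `σ` is the permutation under `x`. -/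
def spinAction (Γ : Type*) [Group Γ] (n : ℕ) : SpinSym n →* MulAut (Fin n → Γ) :=
  mulAutArrow.comp (SpinSym.toPerm n)

/-- The spin wreath product of `Γ` with the spin group on `n` letters. -/
abbrev SpinWreath (Γ : Type*) [Group Γ] (n : ℕ) : Type _ :=
  (Fin n → Γ) ⋊[spinAction Γ n] SpinSym n

instance {Γ : Type*} [Group Γ] [Finite Γ] (n : ℕ) : Finite (SpinWreath Γ n) :=
  Finite.of_equiv _ SemidirectProduct.equivProd.symm

noncomputable instance {Γ : Type*} [Group Γ] [Finite Γ] (n : ℕ) : Fintype (SpinWreath Γ n) :=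
  Fintype.ofFinite _

namespace SpinWreath

variable {Γ : Type*} [Group Γ]

/-- The central involution. -/
def z (Γ : Type*) [Group Γ] (n : ℕ) : SpinWreath Γ n := SemidirectProduct.inr (SpinSym.z n)

/-- The parity homomorphism; `x` is even when `parity x = 1`. -/
def parity (Γ : Type*) [Group Γ] (n : ℕ) : SpinWreath Γ n →* Multiplicative (ZMod 2) :=
  (SpinSym.parity n).comp SemidirectProduct.rightHom

end SpinWreath

/-! ### Block embeddings -/

theorem SpinSym.shift_isSpinSystem {n N o : ℕ} (h : o + n ≤ N) :
    IsSpinSystem n (SpinSym.z N)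
      (fun a : Fin (n - 1) => SpinSym.t (n := N) ⟨o + a.1, by omega⟩) where
  z_sq := (SpinSym.isSpinSystem N).z_sq
  t_sq i := (SpinSym.isSpinSystem N).t_sq _
  braid i j hij := (SpinSym.isSpinSystem N).braid _ _ (by simp only; omega)
  comm i j hij := (SpinSym.isSpinSystem N).comm _ _ (by simp only; omega)
  central i := (SpinSym.isSpinSystem N).central _

/-- The homomorphism that sends `z` to `z` and shifts the indices of the generators `t` by `o`. -/
def SpinSym.shift {n N o : ℕ} (h : o + n ≤ N) : SpinSym n →* SpinSym N :=
  SpinSym.lift (SpinSym.shift_isSpinSystem h)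

/-- The embedding `i ↦ o + i` of positions. -/
def posEmb {n N o : ℕ} (h : o + n ≤ N) : Fin n ↪ Fin N :=
  ⟨fun i => ⟨o + i.1, by omega⟩, fun i j hij => by
    simp only [Fin.mk.injEq] at hij
    exact Fin.ext (by omega)⟩

theorem SpinSym.toPerm_shift {n N o : ℕ} (h : o + n ≤ N) (x : SpinSym n) :
    SpinSym.toPerm N (SpinSym.shift h x) =
      Equiv.Perm.viaEmbedding (SpinSym.toPerm n x) (posEmb h) := by
  have : (SpinSym.toPerm N).comp (SpinSym.shift h) =
      (Equiv.Perm.viaEmbeddingHom (posEmb h)).comp (SpinSym.toPerm n) := by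
    apply SpinSym.hom_ext
    · simp [SpinSym.toPerm, SpinSym.shift]
    · intro a
      simp only [MonoidHom.comp_apply, SpinSym.shift, SpinSym.lift_t, SpinSym.toPerm,
        Equiv.Perm.viaEmbeddingHom_apply]
      ext i
      by_cases hi : i ∈ Set.range (posEmb h)
      · obtain ⟨i, rfl⟩ := hi
        rw [Equiv.Perm.viaEmbedding_apply]
        unfold adjSwap
        have e1 : (⟨o + a.1, by omega⟩ : Fin N) = posEmb h ⟨a.1, by omega⟩ := rfl
        have e2 : (⟨o + a.1 + 1, by omega⟩ : Fin N) = posEmb h ⟨a.1 + 1, by omega⟩ := rfl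
        rw [e1, e2, ← (posEmb h).injective.map_swap]
      · rw [Equiv.Perm.viaEmbedding_apply_of_notMem _ _ _ hi]
        unfold adjSwap
        rw [Equiv.swap_apply_of_ne_of_ne]
        · rintro rfl; exact hi ⟨⟨a.1, by omega⟩, rfl⟩
        · rintro rfl; exact hi ⟨⟨a.1 + 1, by omega⟩, rfl⟩
  exact DFunLike.congr_fun this x

theorem SpinSym.parity_shift {n N o : ℕ} (h : o + n ≤ N) (x : SpinSym n) :
    SpinSym.parity N (SpinSym.shift h x) = SpinSym.parity n x := by
  have : (SpinSym.parity N).comp (SpinSym.shift h) = SpinSym.parity n := by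
    apply SpinSym.hom_ext
    · simp [SpinSym.parity, SpinSym.shift]
    · intro a
      simp [SpinSym.parity, SpinSym.shift]
  exact DFunLike.congr_fun this x

theorem extend_action {Γ : Type*} [Group Γ] {n N o : ℕ} (h : o + n ≤ N) (x : SpinSym n)
    (g : Fin n → Γ) :
    Function.extend (posEmb h) (spinAction Γ n x g) 1 =
      spinAction Γ N (SpinSym.shift h x) (Function.extend (posEmb h) g 1) := by
  funext i
  have e : ∀ (m : ℕ) (y : SpinSym m) (f : Fin m → Γ) (j : Fin m),
      spinAction Γ m y f j = f (SpinSym.toPerm m y⁻¹ j) := fun m y f j => by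
    rw [map_inv]; rfl
  rw [e, ← map_inv, SpinSym.toPerm_shift]
  by_cases hi : i ∈ Set.range (posEmb h)
  · obtain ⟨i, rfl⟩ := hi
    rw [Equiv.Perm.viaEmbedding_apply, (posEmb h).injective.extend_apply,
      (posEmb h).injective.extend_apply, e]
  · rw [Equiv.Perm.viaEmbedding_apply_of_notMem _ _ _ hi, Function.extend_apply' _ _ _ hi,
      Function.extend_apply' _ _ _ hi]

/-- The embedding of the spin wreath product on `n` letters into the one on `N` letters that uses
the letters `o, …, o + n - 1`: group elements are placed at these positions and `t a` goes to
`t (o + a)`. -/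
noncomputable def SpinWreath.emb {Γ : Type*} [Group Γ] {n N o : ℕ} (h : o + n ≤ N) :
    SpinWreath Γ n →* SpinWreath Γ N :=
  SemidirectProduct.map (Function.ExtendByOne.hom Γ (posEmb h)) (SpinSym.shift h) (fun x => by
    ext g : 1
    exact extend_action h x g)

section Blocks

variable {Γ : Type*} [Group Γ] {n k N : ℕ} (h : n + k = N)

/-- The embedding of the first factor of the spin product. -/
noncomputable def SpinWreath.embL : SpinWreath Γ n →* SpinWreath Γ N :=
  SpinWreath.emb (o := 0) (by omega)

/-- The embedding of the second factor of the spin product. -/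
noncomputable def SpinWreath.embR : SpinWreath Γ k →* SpinWreath Γ N :=
  SpinWreath.emb (o := n) (by omega)

theorem mult_zmod_two (a : Multiplicative (ZMod 2)) : a = 1 ∨ a = Multiplicative.ofAdd 1 := by
  revert a; decide

theorem mult_zmod_two_ne : (1 : Multiplicative (ZMod 2)) ≠ Multiplicative.ofAdd 1 := by decide

theorem mult_zmod_two_sq :
    Multiplicative.ofAdd (1 : ZMod 2) * Multiplicative.ofAdd (1 : ZMod 2) = 1 := by decide

/-- `z` if both parities are odd, and `1` otherwise. -/
def SpinSym.zPow (N : ℕ) (a b : Multiplicative (ZMod 2)) : SpinSym N :=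
  if a = Multiplicative.ofAdd 1 ∧ b = Multiplicative.ofAdd 1 then SpinSym.z N else 1

theorem SpinSym.zPow_mul_left (N : ℕ) (a a' b : Multiplicative (ZMod 2)) :
    SpinSym.zPow N (a * a') b = SpinSym.zPow N a b * SpinSym.zPow N a' b := by
  rcases mult_zmod_two a with rfl | rfl <;> rcases mult_zmod_two a' with rfl | rfl <;>
    rcases mult_zmod_two b with rfl | rfl <;>
    simp [zPow, mult_zmod_two_ne, mult_zmod_two_sq, SpinSym.z_mul_z, -ofAdd_add]

theorem SpinSym.zPow_symm (N : ℕ) (a b : Multiplicative (ZMod 2)) :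
    SpinSym.zPow N a b = SpinSym.zPow N b a := by
  simp [zPow, and_comm]

theorem SpinSym.zPow_comm (N : ℕ) (a b : Multiplicative (ZMod 2)) (x : SpinSym N) :
    SpinSym.zPow N a b * x = x * SpinSym.zPow N a b := by
  unfold zPow; split_ifs
  · exact SpinSym.z_comm x
  · simp

theorem SpinSym.toPerm_z (n : ℕ) : SpinSym.toPerm n (SpinSym.z n) = 1 := by
  rw [SpinSym.toPerm, SpinSym.lift_z]

theorem SpinSym.parity_z (n : ℕ) : SpinSym.parity n (SpinSym.z n) = 1 := by
  rw [SpinSym.parity, SpinSym.lift_z]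

theorem SpinSym.parity_t {n : ℕ} (a : Fin (n - 1)) :
    SpinSym.parity n (SpinSym.t a) = Multiplicative.ofAdd 1 := by
  rw [SpinSym.parity, SpinSym.lift_t]

/-- Multiplication of a shift homomorphism by the sign rule. -/
def SpinSym.twist {m o : ℕ} (h : o + m ≤ N) (b : Multiplicative (ZMod 2)) :
    SpinSym m →* SpinSym N where
  toFun x := zPow N (parity m x) b * shift h x
  map_one' := by simp [zPow, mult_zmod_two_ne]
  map_mul' x y := by
    rw [map_mul, map_mul, zPow_mul_left, mul_assoc, mul_assoc,
      ← mul_assoc (zPow N (parity m y) b), zPow_comm N _ _ (shift h x)]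
    simp only [mul_assoc]

theorem SpinSym.shift_mul_shift (x : SpinSym n) (y : SpinSym k) :
    shift (o := n) (N := N) (by omega) y * shift (o := 0) (N := N) (by omega) x =
      zPow N (parity n x) (parity k y) *
        (shift (o := 0) (N := N) (by omega) x * shift (o := n) (N := N) (by omega) y) := by
  have hL : 0 + n ≤ N := by omega
  have hR : n + k ≤ N := by omega
  -- a rule that holds on generators holds everywhere, in each variable
  have step (x : SpinSym n)
      (hx : ∀ b, shift hR (t b) * shift hL x =
        zPow N (parity n x) (parity k (t b)) * (shift hL x * shift hR (t b))) :
      ∀ y, shift hR y * shift hL x =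
        zPow N (parity n x) (parity k y) * (shift hL x * shift hR y) := by
    have e : (MulAut.conj (shift hL x)⁻¹).toMonoidHom.comp (shift hR) =
        twist hR (parity n x) := by
      apply hom_ext
      · simp [twist, shift, parity_z, zPow, mult_zmod_two_ne, ← z_comm]
      · intro b
        have := hx b
        simp only [MonoidHom.comp_apply, MulEquiv.coe_toMonoidHom, MulAut.conj_apply, inv_inv,
          twist, MonoidHom.coe_mk, OneHom.coe_mk]
        rw [mul_assoc, this, zPow_comm, mul_assoc, inv_mul_cancel_left, zPow_symm, zPow_comm]
    intro y
    have := DFunLike.congr_fun e y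
    simp only [MonoidHom.comp_apply, MulEquiv.coe_toMonoidHom, MulAut.conj_apply, inv_inv,
      twist, MonoidHom.coe_mk, OneHom.coe_mk, mul_assoc] at this
    rw [inv_mul_eq_iff_eq_mul] at this
    rw [this, zPow_symm, ← mul_assoc, ← mul_assoc, zPow_comm]
  refine step x (fun b => ?_) y
  have e : (MulAut.conj (shift hR (t b))).toMonoidHom.comp (shift hL) =
      twist hL (parity k (t b)) := by
    apply hom_ext
    · simp [twist, shift, parity_z, zPow, mult_zmod_two_ne, ← z_comm]
    · intro a
      have hc := (isSpinSystem N).comm ⟨n + b.1, by omega⟩ ⟨0 + a.1, by omega⟩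
        (by simp only; omega)
      simp only [MonoidHom.comp_apply, MulEquiv.coe_toMonoidHom, MulAut.conj_apply,
        twist, MonoidHom.coe_mk, OneHom.coe_mk, shift, lift_t, parity_t, zPow, and_self, if_true]
      rw [hc, mul_inv_cancel_right]
  have := DFunLike.congr_fun e x
  simp only [MonoidHom.comp_apply, MulEquiv.coe_toMonoidHom, MulAut.conj_apply,
    twist, MonoidHom.coe_mk, OneHom.coe_mk] at this
  rw [mul_inv_eq_iff_eq_mul, mul_assoc] at this
  exact this

theorem SpinWreath.z_mul_z (N : ℕ) : SpinWreath.z Γ N * SpinWreath.z Γ N = 1 := by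
  rw [SpinWreath.z, ← map_mul, SpinSym.z_mul_z, map_one]

theorem spinAction_z (N : ℕ) : spinAction Γ N (SpinSym.z N) = 1 := by
  rw [spinAction, MonoidHom.comp_apply, SpinSym.toPerm_z, map_one]

theorem SpinWreath.z_comm {N : ℕ} (x : SpinWreath Γ N) :
    SpinWreath.z Γ N * x = x * SpinWreath.z Γ N := by
  apply SemidirectProduct.ext
  · simp [SpinWreath.z, spinAction_z]
  · simp [SpinWreath.z, SpinSym.z_comm]

theorem SpinWreath.parity_z (N : ℕ) : SpinWreath.parity Γ N (SpinWreath.z Γ N) = 1 := by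
  simp [SpinWreath.z, SpinWreath.parity, SpinSym.parity_z]

theorem SpinWreath.parity_emb {o : ℕ} (h : o + n ≤ N) (x : SpinWreath Γ n) :
    SpinWreath.parity Γ N (SpinWreath.emb h x) = SpinWreath.parity Γ n x :=
  SpinSym.parity_shift h x.right

theorem SpinWreath.emb_z {o : ℕ} (h : o + n ≤ N) :
    SpinWreath.emb h (SpinWreath.z Γ n) = SpinWreath.z Γ N := by
  rw [SpinWreath.z, SpinWreath.emb, SemidirectProduct.map_inr, SpinSym.shift, SpinSym.lift_z]
  rfl

theorem spinAction_apply {n : ℕ} (x : SpinSym n) (g : Fin n → Γ) (i : Fin n) :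
    spinAction Γ n x g i = g (SpinSym.toPerm n x⁻¹ i) := by
  rw [map_inv]; rfl

/-- A block element does not move functions supported outside its block. -/
theorem spinAction_shift_of_disjoint {m N o : ℕ} (h : o + m ≤ N) (x : SpinSym m)
    (g : Fin N → Γ) (hg : ∀ i, i ∈ Set.range (posEmb h) → g i = 1) :
    spinAction Γ N (SpinSym.shift h x) g = g := by
  funext i
  rw [spinAction_apply, ← map_inv, SpinSym.toPerm_shift]
  by_cases hi : i ∈ Set.range (posEmb h)
  · rw [hg i hi]
    obtain ⟨i, rfl⟩ := hi
    rw [Equiv.Perm.viaEmbedding_apply]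
    exact hg _ ⟨_, rfl⟩
  · rw [Equiv.Perm.viaEmbedding_apply_of_notMem _ _ _ hi]

theorem not_mem_both {i : Fin N} (hL : i ∈ Set.range (posEmb (n := n) (o := 0) (N := N) (by omega)))
    (hR : i ∈ Set.range (posEmb (n := k) (o := n) (N := N) (by omega))) : False := by
  obtain ⟨a, rfl⟩ := hL
  obtain ⟨b, hb⟩ := hR
  have : n + b.1 = 0 + a.1 := congrArg Fin.val hb
  omega

/-- Elements of the two blocks commute up to the sign rule. -/
theorem SpinWreath.embR_mul_embL (x : SpinWreath Γ n) (y : SpinWreath Γ k) :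
    embR h y * embL h x =
      SemidirectProduct.inr (SpinSym.zPow N (parity Γ n x) (parity Γ k y)) *
        (embL h x * embR h y) := by
  have hz : ∀ a b, spinAction Γ N (SpinSym.zPow N a b) = 1 := fun a b => by
    unfold SpinSym.zPow; split_ifs
    · exact spinAction_z N
    · exact map_one _
  have hLout : ∀ i ∈ Set.range (posEmb (n := k) (o := n) (N := N) (by omega)),
      (embL h x).left i = 1 := fun i hi =>
    Function.extend_apply' _ _ _ (fun hL => not_mem_both h hL hi)
  have hRout : ∀ i ∈ Set.range (posEmb (n := n) (o := 0) (N := N) (by omega)),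
      (embR h y).left i = 1 := fun i hi =>
    Function.extend_apply' _ _ _ (fun hR => not_mem_both h hi hR)
  apply SemidirectProduct.ext
  · have e1 : spinAction Γ N (embR h y).right (embL h x).left = (embL h x).left :=
      spinAction_shift_of_disjoint _ _ _ hLout
    have e2 : spinAction Γ N (embL h x).right (embR h y).left = (embR h y).left :=
      spinAction_shift_of_disjoint _ _ _ hRout
    simp only [SemidirectProduct.mul_left, SemidirectProduct.left_inr,
      SemidirectProduct.right_inr, hz, e1, e2, one_mul, MulAut.one_apply]
    funext i
    simp only [Pi.mul_apply]
    by_cases hi : i ∈ Set.range (posEmb (n := n) (o := 0) (N := N) (by omega))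
    · rw [hRout i hi]; simp
    · have : (embL h x).left i = 1 := Function.extend_apply' _ _ _ hi
      rw [this]; simp
  · exact SpinSym.shift_mul_shift h x.right y.right

end Blocks


/-! ## The basic spin supermodule -/



/-- The Kronecker product `M 0 ⊗ M 1 ⊗ ⋯ ⊗ M (k - 1)` of `2 × 2` matrices. The index set
`Fin k → Fin 2` is the standard basis of the `k`-fold tensor power of `ℂ^{1|1}`. -/
def kron (k : ℕ) (M : ℕ → Matrix (Fin 2) (Fin 2) ℂ) :
    Matrix (Fin k → Fin 2) (Fin k → Fin 2) ℂ :=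
  fun a b => ∏ l : Fin k, M l (a l) (b l)

/-- The Pauli matrix `σ₁`. -/
def pauliX : Matrix (Fin 2) (Fin 2) ℂ := !![0, 1; 1, 0]

/-- The Pauli matrix `σ₂`. -/
def pauliY : Matrix (Fin 2) (Fin 2) ℂ := !![0, -Complex.I; Complex.I, 0]

/-- The Pauli matrix `σ₃`. -/
def pauliZ : Matrix (Fin 2) (Fin 2) ℂ := !![1, 0; 0, -1]

/-- The tensor factors of the Clifford generator number `j` (counted from `0`): `σ₃` before the
position `j / 2`, then `σ₁` (`j` even) or `σ₂` (`j` odd), then identity matrices. -/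
def cliffordFactor (j l : ℕ) : Matrix (Fin 2) (Fin 2) ℂ :=
  if l < j / 2 then pauliZ else if l = j / 2 then (if Even j then pauliX else pauliY) else 1

/-- The matrices of the Clifford generators `e (j + 1)`, `j = 0, 1, …`. -/
noncomputable def cliffordGen (k j : ℕ) : Matrix (Fin k → Fin 2) (Fin k → Fin 2) ℂ :=
  Complex.I • kron k (cliffordFactor j)

theorem kron_mul (k : ℕ) (M M' : ℕ → Matrix (Fin 2) (Fin 2) ℂ) :
    kron k M * kron k M' = kron k (fun l => M l * M' l) := by
  ext a b
  simp only [Matrix.mul_apply, kron]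
  rw [Finset.prod_univ_sum]
  simp [Finset.prod_mul_distrib]

theorem kron_one (k : ℕ) : kron k (fun _ => 1) = 1 := by
  ext a b
  simp only [kron, Matrix.one_apply]
  by_cases h : a = b
  · simp [h]
  · obtain ⟨l, hl⟩ := Function.ne_iff.1 h
    rw [if_neg h]
    exact Finset.prod_eq_zero (Finset.mem_univ l) (if_neg hl)

theorem kron_neg (k p : ℕ) (hp : p < k) (M M' : ℕ → Matrix (Fin 2) (Fin 2) ℂ)
    (h : ∀ l, l ≠ p → M l = M' l) (hpp : M p = -M' p) : kron k M = -kron k M' := by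
  ext a b
  simp only [kron, Matrix.neg_apply]
  rw [← Finset.mul_prod_erase _ _ (Finset.mem_univ (⟨p, hp⟩ : Fin k)),
    ← Finset.mul_prod_erase _ (fun l : Fin k => M' l (a l) (b l))
      (Finset.mem_univ (⟨p, hp⟩ : Fin k))]
  simp only [hpp, Matrix.neg_apply, neg_mul, neg_inj]
  congr 1
  refine Finset.prod_congr rfl fun l hl => ?_
  rw [h l.1 (fun e => (Finset.mem_erase.1 hl).1 (Fin.ext e))]

theorem pauliX_sq : pauliX * pauliX = 1 := by
  ext i j; fin_cases i <;> fin_cases j <;> simp [pauliX]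

theorem pauliY_sq : pauliY * pauliY = 1 := by
  ext i j; fin_cases i <;> fin_cases j <;> simp [pauliY]

theorem pauliZ_sq : pauliZ * pauliZ = 1 := by
  ext i j; fin_cases i <;> fin_cases j <;> simp [pauliZ]

theorem pauliXY : pauliX * pauliY = -(pauliY * pauliX) := by
  ext i j; fin_cases i <;> fin_cases j <;> simp [pauliX, pauliY]

theorem pauliXZ : pauliX * pauliZ = -(pauliZ * pauliX) := by
  ext i j; fin_cases i <;> fin_cases j <;> simp [pauliX, pauliZ]

theorem pauliYZ : pauliY * pauliZ = -(pauliZ * pauliY) := by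
  ext i j; fin_cases i <;> fin_cases j <;> simp [pauliY, pauliZ]

theorem cliffordGen_sq (k j : ℕ) : cliffordGen k j * cliffordGen k j = -1 := by
  have : (fun l => cliffordFactor j l * cliffordFactor j l) = fun _ => 1 := by
    funext l
    unfold cliffordFactor
    split_ifs <;> simp [pauliX_sq, pauliY_sq, pauliZ_sq]
  rw [cliffordGen, Matrix.smul_mul, Matrix.mul_smul, smul_smul, kron_mul, this, kron_one]
  simp

theorem cliffordGen_anticomm_of_lt (k i j : ℕ) (hij : i < j) (hj : j < 2 * k) :
    cliffordGen k i * cliffordGen k j = -(cliffordGen k j * cliffordGen k i) := by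
  rw [cliffordGen, cliffordGen, Matrix.smul_mul, Matrix.mul_smul, Matrix.smul_mul,
    Matrix.mul_smul, kron_mul, kron_mul,
    kron_neg k (i / 2) (by omega) _ (fun l => cliffordFactor j l * cliffordFactor i l)]
  · simp
  · intro l hl
    unfold cliffordFactor
    by_cases h1 : l < i / 2
    · rw [if_pos h1, if_pos (by omega)]
    · rw [if_neg h1, if_neg hl]; simp
  · unfold cliffordFactor
    rw [if_neg (lt_irrefl _), if_pos rfl]
    by_cases h1 : i / 2 < j / 2
    · rw [if_pos h1]
      split_ifs
      · exact pauliXZ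
      · exact pauliYZ
    · have h2 : i / 2 = j / 2 := by omega
      have h3 : Even i := by rw [Nat.even_iff]; omega
      have h4 : ¬ Even j := by rw [Nat.even_iff]; omega
      rw [if_neg h1, if_pos h2, if_pos h3, if_neg h4]
      exact pauliXY

theorem cliffordGen_anticomm (k i j : ℕ) (hij : i ≠ j) (hi : i < 2 * k) (hj : j < 2 * k) :
    cliffordGen k i * cliffordGen k j = -(cliffordGen k j * cliffordGen k i) := by
  rcases lt_or_gt_of_ne hij with h | h
  · exact cliffordGen_anticomm_of_lt k i j h hj
  · rw [cliffordGen_anticomm_of_lt k j i h hi, neg_neg]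

/-- The matrix of the generator number `a` (counted from `0`) of the spin group in the basic spin
supermodule. In terms of `j = a + 1` it is `√((j + 1) / (2 j)) e_j - √((j - 1) / (2 j)) e_{j - 1}`;
for `a = 0` the second coefficient vanishes. -/
noncomputable def basicSpinGen (k a : ℕ) : Matrix (Fin k → Fin 2) (Fin k → Fin 2) ℂ :=
  (Real.sqrt ((a + 2) / (2 * (a + 1))) : ℂ) • cliffordGen k a -
    (Real.sqrt (a / (2 * (a + 1))) : ℂ) • cliffordGen k (a - 1)

theorem sqrt_sq_complex {x : ℝ} (hx : 0 ≤ x) :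
    (Real.sqrt x : ℂ) * (Real.sqrt x : ℂ) = (x : ℂ) := by
  rw [← Complex.ofReal_mul, Real.mul_self_sqrt hx]

theorem basicSpinGen_sq (k a : ℕ) (ha : a < 2 * k) :
    basicSpinGen k a * basicSpinGen k a = -1 := by
  have hx : (0 : ℝ) ≤ (a + 2) / (2 * (a + 1)) := by positivity
  have hy : (0 : ℝ) ≤ a / (2 * (a + 1)) := by positivity
  have hxy : (((a : ℝ) + 2) / (2 * (a + 1))) + (a / (2 * (a + 1))) = 1 := by
    have : (a : ℝ) + 1 ≠ 0 := by positivity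
    field_simp; ring
  unfold basicSpinGen
  set x : ℝ := ((a : ℝ) + 2) / (2 * (a + 1)) with hxdef
  set y : ℝ := (a : ℝ) / (2 * (a + 1)) with hydef
  rcases Nat.eq_zero_or_pos a with rfl | hpos
  · have y0 : y = 0 := by simp [hydef]
    have x0 : x = 1 := by rw [← hxy, y0, add_zero]
    simp [x0, y0, cliffordGen_sq]
  · have h1 := cliffordGen_anticomm k a (a - 1) (by omega) ha (by omega)
    have e : (x : ℂ) + y = 1 := by exact_mod_cast hxy
    simp only [sub_mul, mul_sub, Matrix.smul_mul, Matrix.mul_smul, smul_smul, cliffordGen_sq, h1,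
      sqrt_sq_complex hx, sqrt_sq_complex hy]
    rw [mul_comm ((√y : ℝ) : ℂ) ((√x : ℝ) : ℂ)]
    linear_combination (norm := module) (-e) • (1 : Matrix (Fin k → Fin 2) (Fin k → Fin 2) ℂ)

theorem basicSpinGen_anticomm_far (k a b : ℕ) (hab : b + 1 < a) (ha : a < 2 * k) :
    basicSpinGen k a * basicSpinGen k b = -(basicSpinGen k b * basicSpinGen k a) := by
  unfold basicSpinGen
  have h1 := cliffordGen_anticomm k a b (by omega) ha (by omega)
  have h2 := cliffordGen_anticomm k a (b - 1) (by omega) ha (by omega)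
  have h3 := cliffordGen_anticomm k (a - 1) b (by omega) (by omega) (by omega)
  have h4 := cliffordGen_anticomm k (a - 1) (b - 1) (by omega) (by omega) (by omega)
  simp only [sub_mul, mul_sub, Matrix.smul_mul, Matrix.mul_smul, smul_smul, h1, h2, h3, h4,
    smul_neg]
  simp only [mul_comm (Complex.ofReal (√((b + 2) / (2 * (b + 1))))),
    mul_comm (Complex.ofReal (√(b / (2 * (b + 1)))))]
  abel

theorem basicSpinGen_near (k a : ℕ) (ha : a + 1 < 2 * k) :
    basicSpinGen k a * basicSpinGen k (a + 1) + basicSpinGen k (a + 1) * basicSpinGen k a = 1 := by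
  have hx : (0 : ℝ) ≤ (a + 2) / (2 * (a + 1)) := by positivity
  have hxy : (√(((a : ℝ) + 2) / (2 * (a + 1))) : ℂ) *
      (√(((a + 1 : ℕ) : ℝ) / (2 * ((a + 1 : ℕ) + 1))) : ℂ) = 1 / 2 := by
    rw [← Complex.ofReal_mul, ← Real.sqrt_mul hx]
    have : ((a : ℝ) + 2) / (2 * (a + 1)) * (((a + 1 : ℕ) : ℝ) / (2 * ((a + 1 : ℕ) + 1))) =
        (1 / 2) ^ 2 := by
      have : (a : ℝ) + 1 ≠ 0 := by positivity
      have : (a : ℝ) + 2 ≠ 0 := by positivity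
      have : (a : ℝ) + 1 + 1 ≠ 0 := by positivity
      push_cast
      field_simp; ring
    rw [this, Real.sqrt_sq (by norm_num)]
    norm_num
  have h1 := cliffordGen_anticomm k a (a + 1) (by omega) (by omega) ha
  have hsq := cliffordGen_sq k a
  have hv : a = 0 → (√((a : ℝ) / (2 * (a + 1))) : ℂ) = 0 := by rintro rfl; simp
  unfold basicSpinGen
  rw [Nat.add_sub_cancel]
  set u : ℂ := (√(((a : ℝ) + 2) / (2 * (a + 1))) : ℂ)
  set w : ℂ := (√(((a + 1 : ℕ) : ℝ) / (2 * ((a + 1 : ℕ) + 1))) : ℂ)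
  set p : ℂ := (√((((a + 1 : ℕ) : ℝ) + 2) / (2 * ((a + 1 : ℕ) + 1))) : ℂ)
  set v : ℂ := (√((a : ℝ) / (2 * (a + 1))) : ℂ)
  have h2 : v • (cliffordGen k (a - 1) * cliffordGen k a) =
      v • (-(cliffordGen k a * cliffordGen k (a - 1))) := by
    rcases Nat.eq_zero_or_pos a with h | h
    · rw [hv h, zero_smul, zero_smul]
    · rw [cliffordGen_anticomm k (a - 1) a (by omega) (by omega) (by omega)]
  have h3 : v • (cliffordGen k (a - 1) * cliffordGen k (a + 1)) =
      v • (-(cliffordGen k (a + 1) * cliffordGen k (a - 1))) := by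
    rcases Nat.eq_zero_or_pos a with h | h
    · rw [hv h, zero_smul, zero_smul]
    · rw [cliffordGen_anticomm k (a - 1) (a + 1) (by omega) (by omega) (by omega)]
  simp only [sub_mul, mul_sub, Matrix.smul_mul, Matrix.mul_smul, smul_smul, hsq, h1]
  linear_combination (norm := module) w • h2 - p • h3 +
    (2 * hxy) • (1 : Matrix (Fin k → Fin 2) (Fin k → Fin 2) ℂ)

/-- The matrix of the parity operator `σ₃ ⊗ ⋯ ⊗ σ₃` of the tensor power of `ℂ^{1|1}`. -/
def superParity (k : ℕ) : Matrix (Fin k → Fin 2) (Fin k → Fin 2) ℂ := kron k (fun _ => pauliZ)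

theorem superParity_sq (k : ℕ) : superParity k * superParity k = 1 := by
  rw [superParity, kron_mul]
  simp only [pauliZ_sq, kron_one]

theorem superParity_cliffordGen (k j : ℕ) (hj : j < 2 * k) :
    superParity k * cliffordGen k j = -(cliffordGen k j * superParity k) := by
  rw [superParity, cliffordGen, Matrix.smul_mul, Matrix.mul_smul, kron_mul, kron_mul,
    kron_neg k (j / 2) (by omega) _ (fun l => cliffordFactor j l * pauliZ), smul_neg]
  · intro l hl
    unfold cliffordFactor
    rw [if_neg hl]
    split_ifs <;> simp
  · unfold cliffordFactor
    rw [if_neg (lt_irrefl _), if_pos rfl]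
    split_ifs
    · rw [pauliXZ, neg_neg]
    · rw [pauliYZ, neg_neg]

theorem superParity_basicSpinGen (k a : ℕ) (ha : a < 2 * k) :
    superParity k * basicSpinGen k a = -(basicSpinGen k a * superParity k) := by
  unfold basicSpinGen
  simp only [mul_sub, sub_mul, Matrix.mul_smul, Matrix.smul_mul,
    superParity_cliffordGen k a ha, superParity_cliffordGen k (a - 1) (by omega), smul_neg]
  abel

/-- The generators of the spin group as invertible matrices. -/
noncomputable def basicSpinUnit (n : ℕ) (a : Fin (n - 1)) :
    (Matrix (Fin (n / 2) → Fin 2) (Fin (n / 2) → Fin 2) ℂ)ˣ where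
  val := basicSpinGen (n / 2) a
  inv := -basicSpinGen (n / 2) a
  val_inv := by rw [mul_neg, basicSpinGen_sq _ _ (by omega), neg_neg]
  inv_val := by rw [neg_mul, basicSpinGen_sq _ _ (by omega), neg_neg]

theorem basicSpinUnit_isSpinSystem (n : ℕ) : IsSpinSystem n
    (-1 : (Matrix (Fin (n / 2) → Fin 2) (Fin (n / 2) → Fin 2) ℂ)ˣ) (basicSpinUnit n) where
  z_sq := by simp
  t_sq i := by
    ext1
    simp only [basicSpinUnit, sq, Units.val_neg, Units.val_one]
    exact basicSpinGen_sq _ _ (by omega)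
  braid i j hij := by
    ext1
    simp only [basicSpinUnit, Units.val_pow_eq_pow_val, Units.val_mul, Units.val_neg,
      Units.val_one, hij]
    have h := basicSpinGen_near (n / 2) i.1 (by omega)
    have h1 := basicSpinGen_sq (n / 2) i.1 (by omega)
    have h2 := basicSpinGen_sq (n / 2) (i.1 + 1) (by omega)
    generalize basicSpinGen (n / 2) i.1 = A at *
    generalize basicSpinGen (n / 2) (i.1 + 1) = B at *
    have h3 : A * B * (A * B) = A * B - 1 := by
      have : B * A = 1 - A * B := by rw [← h]; abel
      calc A * B * (A * B) = A * (B * A) * B := by simp only [mul_assoc]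
        _ = A * B - (A * A) * (B * B) := by rw [this]; simp only [mul_sub, sub_mul, mul_one,
              mul_assoc]
        _ = A * B - 1 := by rw [h1, h2]; simp
    rw [pow_succ, sq, h3, sub_mul, h3]
    simp
  comm i j hij := by
    ext1
    simp only [basicSpinUnit, Units.val_mul, Units.val_neg, Units.val_one]
    rw [basicSpinGen_anticomm_far _ _ _ hij (by omega)]
    simp
  central i := by simp

/-- The basic spin representation of the spin group by matrices. -/
noncomputable def basicSpin (n : ℕ) :
    SpinSym n →* (Matrix (Fin (n / 2) → Fin 2) (Fin (n / 2) → Fin 2) ℂ)ˣ :=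
  SpinSym.lift (basicSpinUnit_isSpinSystem n)

/-- The basic spin supermodule of the spin group on `n` letters: the `⌊n / 2⌋`-fold tensor power
of `ℂ^{1|1}`. -/
noncomputable def basicSpinRep (n : ℕ) :
    Representation ℂ (SpinSym n) ((Fin (n / 2) → Fin 2) → ℂ) :=
  ((Matrix.toLinAlgEquiv' (R := ℂ) (n := Fin (n / 2) → Fin 2)).toAlgHom.toRingHom.toMonoidHom.comp
    (Units.coeHom _)).comp (basicSpin n)

theorem basicSpinRep_apply (n : ℕ) (x : SpinSym n) :
    basicSpinRep n x = Matrix.toLin' (basicSpin n x).1 := rfl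

theorem basicSpinRep_z (n : ℕ) : basicSpinRep n (SpinSym.z n) = -1 := by
  rw [basicSpinRep_apply, basicSpin, SpinSym.lift_z]
  simp
  rfl

theorem basicSpin_parity (n : ℕ) (x : SpinSym n) :
    superParity (n / 2) * (basicSpin n x).1 =
      (if SpinSym.parity n x = 1 then 1 else -1) * (basicSpin n x).1 * superParity (n / 2) := by
  let P : (Matrix (Fin (n / 2) → Fin 2) (Fin (n / 2) → Fin 2) ℂ)ˣ :=
    ⟨superParity _, superParity _, superParity_sq _, superParity_sq _⟩
  let tw : SpinSym n →* (Matrix (Fin (n / 2) → Fin 2) (Fin (n / 2) → Fin 2) ℂ)ˣ :=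
    { toFun := fun x => (if SpinSym.parity n x = 1 then 1 else -1) * basicSpin n x
      map_one' := by simp
      map_mul' := fun x y => by
        rw [map_mul, map_mul]
        rcases mult_zmod_two (SpinSym.parity n x) with h | h <;>
          rcases mult_zmod_two (SpinSym.parity n y) with h' | h' <;>
          simp [h, h', mult_zmod_two_ne.symm, mult_zmod_two_sq, -ofAdd_add] }
  have e : (MulAut.conj P).toMonoidHom.comp (basicSpin n) = tw := by
    apply SpinSym.hom_ext
    · simp [tw, basicSpin, SpinSym.parity_z]
    · intro a
      ext1
      simp only [MonoidHom.comp_apply, MulEquiv.coe_toMonoidHom, MulAut.conj_apply, basicSpin,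
        SpinSym.lift_t, tw, MonoidHom.coe_mk, OneHom.coe_mk, SpinSym.parity_t,
        mult_zmod_two_ne.symm, if_false, Units.val_mul, Units.val_neg, neg_mul,
        one_mul]
      change superParity (n / 2) * basicSpinGen (n / 2) a.1 * superParity (n / 2) =
        -basicSpinGen (n / 2) a.1
      rw [superParity_basicSpinGen _ _ (by omega), neg_mul, mul_assoc, superParity_sq, mul_one]
  have := congrArg Units.val (DFunLike.congr_fun e x)
  simp only [MonoidHom.comp_apply, MulEquiv.coe_toMonoidHom, MulAut.conj_apply, tw,
    MonoidHom.coe_mk, OneHom.coe_mk, Units.val_mul] at this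
  have h2 : superParity (n / 2) * (basicSpin n x).1 =
      superParity (n / 2) * (basicSpin n x).1 * superParity (n / 2) * superParity (n / 2) := by
    rw [mul_assoc (_ * _), superParity_sq, mul_one]
  rw [h2]
  have h3 : superParity (n / 2) * (basicSpin n x).1 * superParity (n / 2) =
    ((if SpinSym.parity n x = 1 then 1 else -1 :
      (Matrix (Fin (n / 2) → Fin 2) (Fin (n / 2) → Fin 2) ℂ)ˣ)).1 * (basicSpin n x).1 := this
  rw [h3]
  split_ifs <;> simp

theorem basicSpinRep_character_of_odd (n : ℕ) (x : SpinSym n) (hx : SpinSym.parity n x ≠ 1) :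
    (basicSpinRep n).character x = 0 := by
  have h := basicSpin_parity n x
  rw [if_neg hx] at h
  rw [Representation.character, basicSpinRep_apply, Matrix.trace_toLin'_eq]
  have h2 : (basicSpin n x).1 = -(superParity (n / 2) * ((basicSpin n x).1 * superParity (n / 2)))
      := by
    rw [← mul_assoc, h, mul_assoc _ (superParity _), superParity_sq, mul_one, neg_one_mul, neg_neg]
  have h3 := congrArg Matrix.trace h2
  rw [Matrix.trace_neg, Matrix.trace_mul_comm, mul_assoc, superParity_sq, mul_one] at h3
  exact self_eq_neg.1 h3

theorem SpinSym.z_ne_one (n : ℕ) : SpinSym.z n ≠ 1 := by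
  intro h
  have := congrArg (basicSpin n) h
  rw [map_one, basicSpin, SpinSym.lift_z] at this
  have := congrArg Units.val this
  have := congrFun (congrFun this (fun _ => 0)) (fun _ => 0)
  simp at this
  norm_num at this

/-! ## Spin supermodules of the wreath product -/

open scoped TensorProduct

section Characters

variable {Γ : Type*} [Group Γ] {V : Type*} [AddCommGroup V] [Module ℂ V]

/-- The `n`-th tensor power of a representation `ρ` of `Γ`, as a representation of the spin wreath
product: `(g, x)` sends `v₁ ⊗ ⋯ ⊗ vₙ` to the tensor with factors `ρ (g i) (v (σ⁻¹ i))`, where `σ` is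
the permutation under `x`. -/
noncomputable def tensorPower (ρ : Representation ℂ Γ V) (n : ℕ) :
    Representation ℂ (SpinWreath Γ n) (⨂[ℂ] _ : Fin n, V) where
  toFun x := PiTensorProduct.map (fun i => ρ (x.left i)) ∘ₗ
    (PiTensorProduct.reindex ℂ (fun _ : Fin n => V) (SpinSym.toPerm n x.right)).toLinearMap
  map_one' := by
    apply PiTensorProduct.ext
    ext v
    simp only [LinearMap.compMultilinearMap_apply, LinearMap.comp_apply, LinearEquiv.coe_coe,
      PiTensorProduct.reindex_tprod, PiTensorProduct.map_tprod, SemidirectProduct.one_left,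
      SemidirectProduct.one_right, map_one, Pi.one_apply, Module.End.one_apply]
    rfl
  map_mul' x y := by
    apply PiTensorProduct.ext
    ext v
    simp only [LinearMap.compMultilinearMap_apply, LinearMap.comp_apply, LinearEquiv.coe_coe,
      PiTensorProduct.reindex_tprod, PiTensorProduct.map_tprod, Module.End.mul_apply]
    congr 1
    funext i
    rw [SemidirectProduct.mul_left, SemidirectProduct.mul_right, Pi.mul_apply, spinAction_apply,
      map_inv, map_mul, map_mul, Module.End.mul_apply]
    rfl

/-- The spin supermodule of the spin wreath product obtained from the tensor power of `ρ` and the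
basic spin supermodule. -/
noncomputable def spinModule (ρ : Representation ℂ Γ V) (n : ℕ) :
    Representation ℂ (SpinWreath Γ n)
      ((⨂[ℂ] _ : Fin n, V) ⊗[ℂ] ((Fin (n / 2) → Fin 2) → ℂ)) :=
  (tensorPower ρ n).tprod ((basicSpinRep n).comp SemidirectProduct.rightHom)

end Characters


/-! ## Spin super class functions -/

section ClassFunctions

variable {G : Type*} [Group G]

/-- The spin super class functions on a group with a central involution `z` and a parity `d`:
class functions `f` with `f (z x) = -f x` that vanish on odd elements. -/
def superClass (z : G) (d : G →* Multiplicative (ZMod 2)) : Submodule ℂ (G → ℂ) where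
  carrier := {f | (∀ x y, f (x * y * x⁻¹) = f y) ∧ (∀ x, f (z * x) = -f x) ∧
    ∀ x, d x ≠ 1 → f x = 0}
  zero_mem' := by simp
  add_mem' := by
    rintro f g ⟨h1, h2, h3⟩ ⟨h1', h2', h3'⟩
    refine ⟨fun x y => ?_, fun x => ?_, fun x hx => ?_⟩
    · rw [Pi.add_apply, Pi.add_apply, h1, h1']
    · rw [Pi.add_apply, Pi.add_apply, h2, h2', neg_add]
    · rw [Pi.add_apply, h3 x hx, h3' x hx, add_zero]
  smul_mem' := by
    rintro c f ⟨h1, h2, h3⟩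
    refine ⟨fun x y => ?_, fun x => ?_, fun x hx => ?_⟩
    · rw [Pi.smul_apply, Pi.smul_apply, h1]
    · rw [Pi.smul_apply, Pi.smul_apply, h2, smul_neg]
    · rw [Pi.smul_apply, h3 x hx, smul_zero]

variable {z : G} {d : G →* Multiplicative (ZMod 2)} (H : Subgroup G) (hz : z ∈ H)

/-- Spin super class functions on a subgroup that contains the central involution. -/
abbrev superClassOn (d : G →* Multiplicative (ZMod 2)) : Submodule ℂ (H → ℂ) :=
  superClass (⟨z, hz⟩ : H) (d.comp H.subtype)

/-- Restriction to a subgroup. -/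
def res : superClass z d →ₗ[ℂ] superClassOn H hz d where
  toFun f := ⟨fun w => f.1 w.1,
    ⟨fun x y => f.2.1 x.1 y.1, fun x => f.2.2.1 x.1, fun x hx => f.2.2.2 x.1 hx⟩⟩
  map_add' _ _ := rfl
  map_smul' _ _ := rfl

open Classical in
/-- Induction from a subgroup, by the formula for the character of the induced module. -/
noncomputable def ind [Fintype G] (hc : ∀ x, z * x = x * z) :
    superClassOn H hz d →ₗ[ℂ] superClass z d where
  toFun F := ⟨fun w => (Nat.card H : ℂ)⁻¹ *
      ∑ s : G, if hs : s⁻¹ * w * s ∈ H then F.1 ⟨s⁻¹ * w * s, hs⟩ else 0, by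
    refine ⟨fun x y => ?_, fun x => ?_, fun x hx => ?_⟩ <;> beta_reduce
    · congr 1
      refine Fintype.sum_equiv (Equiv.mulLeft x⁻¹) _ _ fun s => ?_
      have : s⁻¹ * (x * y * x⁻¹) * s = (x⁻¹ * s)⁻¹ * y * (x⁻¹ * s) := by group
      simp only [this, Equiv.coe_mulLeft]
      rfl
    · rw [← mul_neg, ← Finset.sum_neg_distrib]
      congr 1
      refine Finset.sum_congr rfl fun s _ => ?_
      have e : s⁻¹ * (z * x) * s = z * (s⁻¹ * x * s) := by
        rw [← mul_assoc, ← hc]; simp only [mul_assoc]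
      by_cases hs : s⁻¹ * x * s ∈ H
      · have hs' : s⁻¹ * (z * x) * s ∈ H := by rw [e]; exact H.mul_mem hz hs
        rw [dif_pos hs, dif_pos hs']
        have e' : (⟨s⁻¹ * (z * x) * s, hs'⟩ : H) = ⟨z, hz⟩ * ⟨s⁻¹ * x * s, hs⟩ := Subtype.ext e
        rw [e', F.2.2.1]
      · have hs' : ¬ s⁻¹ * (z * x) * s ∈ H := by
          rw [e]; exact fun h => hs ((H.mul_mem_cancel_left hz).1 h)
        rw [dif_neg hs, dif_neg hs', neg_zero]
    · rw [Finset.sum_eq_zero, mul_zero]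
      intro s _
      split_ifs with hs
      · refine F.2.2.2 _ ?_
        simpa [mul_comm (d s)⁻¹, mul_assoc] using hx
      · rfl⟩
  map_add' F F' := by
    ext w
    simp only [Submodule.coe_add, Pi.add_apply, ← mul_add, ← Finset.sum_add_distrib]
    congr 1
    refine Finset.sum_congr rfl fun s _ => ?_
    split_ifs <;> simp
  map_smul' c F := by
    ext w
    simp only [Submodule.coe_smul, Pi.smul_apply, smul_eq_mul, RingHom.id_apply]
    rw [mul_left_comm, Finset.mul_sum _ _ c]
    congr 1
    refine Finset.sum_congr rfl fun s _ => ?_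
    split_ifs <;> simp

end ClassFunctions

section Spin

variable {Γ : Type*} [Group Γ]

/-- The spin super class functions on the spin wreath product. -/
abbrev RMinus (Γ : Type*) [Group Γ] (n : ℕ) : Submodule ℂ (SpinWreath Γ n → ℂ) :=
  superClass (SpinWreath.z Γ n) (SpinWreath.parity Γ n)

/-- The sum over all `n` of the spaces of spin super class functions. -/
abbrev RGamma (Γ : Type*) [Group Γ] : Type _ := DirectSum ℕ (fun n => RMinus Γ n)

section Characters

variable {V : Type*} [AddCommGroup V] [Module ℂ V] [FiniteDimensional ℂ V]

theorem spinModule_character (ρ : Representation ℂ Γ V) (n : ℕ) (x : SpinWreath Γ n) :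
    (spinModule ρ n).character x =
      (tensorPower ρ n).character x * (basicSpinRep n).character x.right := by
  rw [spinModule, Representation.char_tensor]
  rfl

/-- The character of the spin supermodule built from `ρ` and the basic spin supermodule. -/
noncomputable def basicChar (ρ : Representation ℂ Γ V) (n : ℕ) : RMinus Γ n :=
  ⟨(spinModule ρ n).character, by
    refine ⟨fun x y => Representation.char_conj _ y x, fun x => ?_, fun x hx => ?_⟩
    · have : spinModule ρ n (SpinWreath.z Γ n) = (-1 : ℂ) • 1 := by
        have h1 : tensorPower ρ n (SpinWreath.z Γ n) = 1 := by
          apply PiTensorProduct.ext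
          ext v
          simp only [tensorPower, SpinWreath.z, MonoidHom.coe_mk, OneHom.coe_mk,
            LinearMap.compMultilinearMap_apply, LinearMap.comp_apply, LinearEquiv.coe_coe,
            PiTensorProduct.reindex_tprod, PiTensorProduct.map_tprod,
            SemidirectProduct.left_inr, SemidirectProduct.right_inr, SpinSym.toPerm_z, map_one,
            Pi.one_apply, Module.End.one_apply]
          rfl
        have h2 : ((basicSpinRep n).comp SemidirectProduct.rightHom) (SpinWreath.z Γ n) = -1 :=
          basicSpinRep_z n
        rw [spinModule, Representation.tprod_apply, h1, h2]
        apply TensorProduct.ext'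
        intro a b
        simp [TensorProduct.tmul_neg, -LinearMap.smul_apply, LinearMap.smul_apply (-1 : ℂ)]
      have h3 : spinModule ρ n (SpinWreath.z Γ n * x) = (-1 : ℂ) • spinModule ρ n x := by
        rw [map_mul, this, smul_mul_assoc, one_mul]
      rw [Representation.character, h3, map_smul, smul_eq_mul, neg_one_mul]
      rfl
    · rw [spinModule_character, basicSpinRep_character_of_odd n x.right hx, mul_zero]⟩

end Characters

section Product

variable {n k N : ℕ} (h : n + k = N)

theorem SpinWreath.embL_z : SpinWreath.embL h (SpinWreath.z Γ n) = SpinWreath.z Γ N :=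
  SpinWreath.emb_z _

theorem SpinWreath.embR_z : SpinWreath.embR h (SpinWreath.z Γ k) = SpinWreath.z Γ N :=
  SpinWreath.emb_z _

theorem SpinWreath.zPow_eq_embL (a b : Multiplicative (ZMod 2)) :
    (SemidirectProduct.inr (SpinSym.zPow N a b) : SpinWreath Γ N) =
      SpinWreath.embL h (SemidirectProduct.inr (SpinSym.zPow n a b)) := by
  unfold SpinSym.zPow
  split_ifs
  · exact (SpinWreath.emb_z _).symm
  · simp

theorem SpinWreath.exists_embR_mul_embL (x : SpinWreath Γ n) (y : SpinWreath Γ k) :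
    ∃ c, parity Γ n c = parity Γ n x ∧ embR h y * embL h x = embL h c * embR h y := by
  refine ⟨SemidirectProduct.inr (SpinSym.zPow n (parity Γ n x) (parity Γ k y)) * x, ?_, ?_⟩
  · have : parity Γ n (SemidirectProduct.inr (SpinSym.zPow n (parity Γ n x) (parity Γ k y))) =
        1 := by
      unfold SpinSym.zPow
      split_ifs
      · exact parity_z n
      · simp
    rw [map_mul, this, one_mul]
  · rw [embR_mul_embL, zPow_eq_embL h, ← mul_assoc, ← map_mul]

theorem SpinWreath.embR_comm_embL (x : SpinWreath Γ n) (y : SpinWreath Γ k)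
    (hxy : parity Γ n x = 1 ∨ parity Γ k y = 1) :
    embR h y * embL h x = embL h x * embR h y := by
  have : SpinSym.zPow N (parity Γ n x) (parity Γ k y) = 1 := by
    unfold SpinSym.zPow
    rw [if_neg]
    rintro ⟨h1, h2⟩
    rcases hxy with h3 | h3
    · exact mult_zmod_two_ne (h3.symm.trans h1)
    · exact mult_zmod_two_ne (h3.symm.trans h2)
  rw [embR_mul_embL, this, map_one, one_mul]

/-- The spin product of two spin wreath products, as a subgroup of the larger one. -/
noncomputable def spinProd (Γ : Type*) [Group Γ] {n k N : ℕ} (h : n + k = N) :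
    Subgroup (SpinWreath Γ N) where
  carrier := Set.range fun p : SpinWreath Γ n × SpinWreath Γ k =>
    SpinWreath.embL h p.1 * SpinWreath.embR h p.2
  one_mem' := ⟨(1, 1), by simp⟩
  mul_mem' := by
    rintro _ _ ⟨⟨x, y⟩, rfl⟩ ⟨⟨x', y'⟩, rfl⟩
    obtain ⟨c, -, e⟩ := SpinWreath.exists_embR_mul_embL h x' y
    refine ⟨(x * c, y * y'), ?_⟩
    beta_reduce
    simp only [map_mul]
    rw [mul_assoc, ← mul_assoc _ _ (SpinWreath.embR h y'), ← e]
    simp only [mul_assoc]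
  inv_mem' := by
    rintro _ ⟨⟨x, y⟩, rfl⟩
    obtain ⟨c, -, e⟩ := SpinWreath.exists_embR_mul_embL h x⁻¹ y⁻¹
    refine ⟨(c, y⁻¹), ?_⟩
    beta_reduce
    rw [← e, mul_inv_rev, map_inv, map_inv]

theorem SpinWreath.mem_spinProd (x : SpinWreath Γ n) (y : SpinWreath Γ k) :
    SpinWreath.embL h x * SpinWreath.embR h y ∈ spinProd Γ h := ⟨(x, y), rfl⟩

theorem SpinWreath.embL_mem (x : SpinWreath Γ n) : SpinWreath.embL h x ∈ spinProd Γ h :=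
  ⟨(x, 1), by simp⟩

theorem SpinWreath.embR_mem (y : SpinWreath Γ k) : SpinWreath.embR h y ∈ spinProd Γ h :=
  ⟨(1, y), by simp⟩

theorem SpinWreath.z_mem : SpinWreath.z Γ N ∈ spinProd Γ h := by
  have := SpinWreath.embL_mem (Γ := Γ) h (SpinWreath.z Γ n)
  rwa [SpinWreath.embL, SpinWreath.emb_z] at this

/-- The spin super class functions on the spin product. -/
noncomputable abbrev RProd (Γ : Type*) [Group Γ] {n k N : ℕ} (h : n + k = N) : Submodule ℂ (spinProd Γ h → ℂ) :=
  superClassOn (spinProd Γ h) (SpinWreath.z_mem h) (SpinWreath.parity Γ N)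

/-- The blocks meet only in `1` and `z`. -/
theorem SpinWreath.embL_eq_embR {a : SpinWreath Γ n} {b : SpinWreath Γ k}
    (hab : SpinWreath.embL h a = SpinWreath.embR h b) :
    (a = 1 ∧ b = 1) ∨ (a = SpinWreath.z Γ n ∧ b = SpinWreath.z Γ k) := by
  have hl := congrArg SemidirectProduct.left hab
  have hr := congrArg (fun w => SpinSym.toPerm N w.right) hab
  have hr : Equiv.Perm.viaEmbedding (SpinSym.toPerm n a.right) (posEmb (o := 0) (by omega)) =
      Equiv.Perm.viaEmbedding (SpinSym.toPerm k b.right) (posEmb (o := n) (N := N) (by omega)) := by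
    rw [← SpinSym.toPerm_shift, ← SpinSym.toPerm_shift]
    exact hr
  have ha1 : a.left = 1 := by
    funext i
    have := congrFun hl (posEmb (o := 0) (by omega) i)
    have e1 : (SpinWreath.embL h a).left (posEmb (o := 0) (by omega) i) = a.left i :=
      (posEmb (o := 0) (N := N) (by omega)).injective.extend_apply _ _ _
    have e2 : (SpinWreath.embR h b).left (posEmb (o := 0) (by omega) i) = 1 :=
      Function.extend_apply' _ _ _ (fun hR => not_mem_both h ⟨i, rfl⟩ hR)
    rw [← e1, this, e2]; rfl
  have hb1 : b.left = 1 := by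
    funext i
    have := congrFun hl (posEmb (o := n) (by omega) i)
    have e1 : (SpinWreath.embR h b).left (posEmb (o := n) (by omega) i) = b.left i :=
      (posEmb (o := n) (N := N) (by omega)).injective.extend_apply _ _ _
    have e2 : (SpinWreath.embL h a).left (posEmb (o := n) (by omega) i) = 1 :=
      Function.extend_apply' _ _ _ (fun hL => not_mem_both h hL ⟨i, rfl⟩)
    rw [← e1, ← this, e2]; rfl
  have ha2 : SpinSym.toPerm n a.right = 1 := by
    ext1 i
    have := DFunLike.congr_fun hr (posEmb (o := 0) (by omega) i)
    rw [Equiv.Perm.viaEmbedding_apply, Equiv.Perm.viaEmbedding_apply_of_notMem _ _ _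
      (fun hR => not_mem_both h ⟨i, rfl⟩ hR)] at this
    exact (posEmb _).injective this
  have hb2 : SpinSym.toPerm k b.right = 1 := by
    ext1 i
    have := DFunLike.congr_fun hr (posEmb (o := n) (by omega) i)
    rw [Equiv.Perm.viaEmbedding_apply, Equiv.Perm.viaEmbedding_apply_of_notMem _ _ _
      (fun hL => not_mem_both h hL ⟨i, rfl⟩)] at this
    exact ((posEmb _).injective this).symm
  have eqA : a = 1 ∨ a = SpinWreath.z Γ n := by
    rcases SpinSym.toPerm_eq_one ha2 with e | e
    · left; exact SemidirectProduct.ext ha1 e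
    · right; exact SemidirectProduct.ext ha1 e
  have eqB : b = 1 ∨ b = SpinWreath.z Γ k := by
    rcases SpinSym.toPerm_eq_one hb2 with e | e
    · left; exact SemidirectProduct.ext hb1 e
    · right; exact SemidirectProduct.ext hb1 e
  have hz : SpinWreath.z Γ N ≠ 1 := fun e =>
    SpinSym.z_ne_one N (congrArg SemidirectProduct.right e)
  rcases eqA with rfl | rfl <;> rcases eqB with rfl | rfl
  · exact Or.inl ⟨rfl, rfl⟩
  · rw [map_one, SpinWreath.embR, SpinWreath.emb_z] at hab
    exact absurd hab.symm hz
  · rw [map_one, SpinWreath.embL, SpinWreath.emb_z] at hab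
    exact absurd hab hz
  · exact Or.inr ⟨rfl, rfl⟩

/-- The super outer tensor product on functions: its value at the product of `x` (in the first
block) and `y` (in the second block) is `u x * v y`. -/
noncomputable def outerFun (u : RMinus Γ n) (v : RMinus Γ k) (w : spinProd Γ h) : ℂ :=
  u.1 w.2.choose.1 * v.1 w.2.choose.2

theorem outerFun_apply (u : RMinus Γ n) (v : RMinus Γ k) (x : SpinWreath Γ n)
    (y : SpinWreath Γ k) :
    outerFun h u v ⟨SpinWreath.embL h x * SpinWreath.embR h y, SpinWreath.mem_spinProd h x y⟩ =
      u.1 x * v.1 y := by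
  unfold outerFun
  generalize_proofs hw
  have hs := hw.choose_spec
  generalize hw.choose = p at hs ⊢
  obtain ⟨x', y'⟩ := p
  simp only at hs ⊢
  have hab : SpinWreath.embL h (x⁻¹ * x') = SpinWreath.embR h (y * y'⁻¹) := by
    rw [map_mul, map_mul, map_inv, map_inv, inv_mul_eq_iff_eq_mul, ← mul_assoc,
      eq_mul_inv_iff_mul_eq, hs]
  rcases SpinWreath.embL_eq_embR h hab with ⟨e1, e2⟩ | ⟨e1, e2⟩
  · rw [← inv_mul_eq_one.1 e1, mul_inv_eq_one.1 e2]
  · have e1' : x' = SpinWreath.z Γ n * x := by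
      rw [SpinWreath.z_comm, ← e1, mul_inv_cancel_left]
    have e2' : y = SpinWreath.z Γ k * y' := by rw [← e2, inv_mul_cancel_right]
    rw [e1', e2', u.2.2.1, v.2.2.1]
    ring

theorem parity_embL_mul_embR (x : SpinWreath Γ n) (y : SpinWreath Γ k) :
    SpinWreath.parity Γ N (SpinWreath.embL h x * SpinWreath.embR h y) =
      SpinWreath.parity Γ n x * SpinWreath.parity Γ k y := by
  rw [map_mul]
  exact congrArg₂ _ (SpinWreath.parity_emb _ _) (SpinWreath.parity_emb _ _)

theorem outerFun_mem (u : RMinus Γ n) (v : RMinus Γ k) : outerFun h u v ∈ RProd Γ h := by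
  refine ⟨?_, ?_, ?_⟩
  · rintro ⟨_, ⟨a, b⟩, rfl⟩ ⟨_, ⟨x, y⟩, rfl⟩
    have hval : outerFun h u v ⟨_, (⟨(x, y), rfl⟩ : _ ∈ spinProd Γ h)⟩ = u.1 x * v.1 y :=
      outerFun_apply h u v x y
    rw [hval]
    by_cases hxy : SpinWreath.parity Γ n x = 1 ∧ SpinWreath.parity Γ k y = 1
    · have e1 := SpinWreath.embR_comm_embL h x b (Or.inl hxy.1)
      have e2 := SpinWreath.embR_comm_embL h a⁻¹ (b * y * b⁻¹) (Or.inr (by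
        rw [map_mul, map_mul, hxy.2, mul_one, map_inv, mul_inv_cancel]))
      have e3 : (SpinWreath.embL h a * SpinWreath.embR h b) *
          (SpinWreath.embL h x * SpinWreath.embR h y) *
          (SpinWreath.embL h a * SpinWreath.embR h b)⁻¹ =
          SpinWreath.embL h (a * x * a⁻¹) * SpinWreath.embR h (b * y * b⁻¹) := by
        calc _ = SpinWreath.embL h a * (SpinWreath.embR h b * SpinWreath.embL h x) *
              SpinWreath.embR h y * (SpinWreath.embR h b)⁻¹ * (SpinWreath.embL h a)⁻¹ := by group
          _ = SpinWreath.embL h a * SpinWreath.embL h x *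
              (SpinWreath.embR h (b * y * b⁻¹) * SpinWreath.embL h a⁻¹) := by
            rw [e1]; simp only [map_mul, map_inv, mul_assoc]
          _ = _ := by rw [e2]; simp only [map_mul, mul_assoc]
      have := outerFun_apply h u v (a * x * a⁻¹) (b * y * b⁻¹)
      rw [u.2.1, v.2.1] at this
      rw [← this]
      congr 1
      exact Subtype.ext e3
    · obtain ⟨c, hc, e1⟩ := SpinWreath.exists_embR_mul_embL h x b
      obtain ⟨c', hc', e2⟩ := SpinWreath.exists_embR_mul_embL h a⁻¹ (b * y * b⁻¹)
      have e3 : (SpinWreath.embL h a * SpinWreath.embR h b) *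
          (SpinWreath.embL h x * SpinWreath.embR h y) *
          (SpinWreath.embL h a * SpinWreath.embR h b)⁻¹ =
          SpinWreath.embL h (a * c * c') * SpinWreath.embR h (b * y * b⁻¹) := by
        calc _ = SpinWreath.embL h a * (SpinWreath.embR h b * SpinWreath.embL h x) *
              SpinWreath.embR h y * (SpinWreath.embR h b)⁻¹ * (SpinWreath.embL h a)⁻¹ := by group
          _ = SpinWreath.embL h a * SpinWreath.embL h c *
              (SpinWreath.embR h (b * y * b⁻¹) * SpinWreath.embL h a⁻¹) := by
            rw [e1]; simp only [map_mul, map_inv, mul_assoc]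
          _ = _ := by rw [e2]; simp only [map_mul, mul_assoc]
      have h1 := outerFun_apply h u v (a * c * c') (b * y * b⁻¹)
      have h2 : outerFun h u v (⟨_, (⟨(a, b), rfl⟩ : _ ∈ spinProd Γ h)⟩ *
          ⟨_, (⟨(x, y), rfl⟩ : _ ∈ spinProd Γ h)⟩ *
          (⟨_, (⟨(a, b), rfl⟩ : _ ∈ spinProd Γ h)⟩)⁻¹) =
          u.1 (a * c * c') * v.1 (b * y * b⁻¹) := by
        rw [← h1]
        congr 1
        exact Subtype.ext e3
      rw [h2, v.2.1]
      by_cases hx : SpinWreath.parity Γ n x = 1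
      · rw [v.2.2.2 y (fun hy => hxy ⟨hx, hy⟩), mul_zero, mul_zero]
      · rw [u.2.2.2 x hx, u.2.2.2 (a * c * c') (by
          rw [map_mul, map_mul, hc, hc', map_inv, mul_right_comm, mul_inv_cancel, one_mul]
          exact hx)]
  · rintro ⟨_, ⟨x, y⟩, rfl⟩
    have h1 := outerFun_apply h u v (SpinWreath.z Γ n * x) y
    have h2 := outerFun_apply h u v x y
    rw [u.2.2.1, neg_mul, ← h2] at h1
    rw [← h1]
    congr 1
    refine Subtype.ext ?_
    change _ = SpinWreath.embL h (SpinWreath.z Γ n * x) * _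
    rw [map_mul, SpinWreath.embL_z, mul_assoc]
    rfl
  · rintro ⟨_, ⟨x, y⟩, rfl⟩ hx
    have hx' : SpinWreath.parity Γ n x * SpinWreath.parity Γ k y ≠ 1 := by
      rw [← parity_embL_mul_embR h]; exact hx
    have hval : outerFun h u v ⟨_, (⟨(x, y), rfl⟩ : _ ∈ spinProd Γ h)⟩ = u.1 x * v.1 y :=
      outerFun_apply h u v x y
    rw [hval]
    by_cases hx1 : SpinWreath.parity Γ n x = 1
    · rw [v.2.2.2 y (fun hy => hx' (by rw [hx1, hy, one_mul])), mul_zero]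
    · rw [u.2.2.2 x hx1, zero_mul]

/-- The super outer tensor product of spin super class functions. -/
noncomputable def outer : RMinus Γ n →ₗ[ℂ] RMinus Γ k →ₗ[ℂ] RProd Γ h :=
  LinearMap.mk₂ ℂ (fun u v => ⟨outerFun h u v, outerFun_mem h u v⟩)
    (fun u u' v => by ext w; simp [outerFun, add_mul])
    (fun c u v => by ext w; simp [outerFun, mul_assoc])
    (fun u v v' => by ext w; simp [outerFun, mul_add])
    (fun c u v => by ext w; simp [outerFun, mul_left_comm])

variable [Finite Γ]

/-- Restriction from the spin wreath product to the spin product. -/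
noncomputable def resProd : RMinus Γ N →ₗ[ℂ] RProd Γ h :=
  res (spinProd Γ h) (SpinWreath.z_mem h)

/-- Induction from the spin product to the spin wreath product. -/
noncomputable def indProd : RProd Γ h →ₗ[ℂ] RMinus Γ N :=
  ind (spinProd Γ h) (SpinWreath.z_mem h) SpinWreath.z_comm

variable {W : Type*} [AddCommGroup W] [Module ℂ W] [FiniteDimensional ℂ W]
  (ξ : Representation ℂ Γ W)

/-- The weighted bilinear form `⟨η * f, g⟩ = |G|⁻¹ ∑ η x * f x * g x⁻¹` over the even elements `x`,
where `η` is the character of the `n`-th tensor power of `ξ`. -/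
noncomputable def weightedForm (n : ℕ) (f g : SpinWreath Γ n → ℂ) : ℂ :=
  (Nat.card (SpinWreath Γ n) : ℂ)⁻¹ *
    ∑ x : SpinWreath Γ n with SpinWreath.parity Γ n x = 1,
      (tensorPower ξ n).character x * f x * g x⁻¹

/-- Pairing of the first tensor factor with `u` by the weighted form. -/
noncomputable def contract (u : RMinus Γ n) : RProd Γ h →ₗ[ℂ] RMinus Γ k where
  toFun F := ⟨fun y => weightedForm ξ n u.1 (fun x =>
      F.1 ⟨SpinWreath.embL h x * SpinWreath.embR h y, SpinWreath.mem_spinProd h x y⟩), by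
    refine ⟨fun b y => ?_, fun y => ?_, fun y hy => ?_⟩ <;> beta_reduce
    · unfold weightedForm
      congr 1
      refine Finset.sum_congr rfl fun x hx => ?_
      beta_reduce
      have hx : SpinWreath.parity Γ n x⁻¹ = 1 := by
        rw [map_inv, (Finset.mem_filter.1 hx).2, inv_one]
      congr 1
      have := F.2.1 ⟨_, SpinWreath.embR_mem h b⟩ ⟨_, SpinWreath.mem_spinProd h x⁻¹ y⟩
      rw [← this]
      refine congrArg F.1 (Subtype.ext ?_)
      change SpinWreath.embL h x⁻¹ * SpinWreath.embR h (b * y * b⁻¹) =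
        SpinWreath.embR h b * (SpinWreath.embL h x⁻¹ * SpinWreath.embR h y) *
          (SpinWreath.embR h b)⁻¹
      rw [← mul_assoc (SpinWreath.embR h b), SpinWreath.embR_comm_embL h x⁻¹ b (Or.inl hx)]
      simp only [map_mul, map_inv, mul_assoc]
    · unfold weightedForm
      rw [← mul_neg, ← Finset.sum_neg_distrib]
      congr 1
      refine Finset.sum_congr rfl fun x hx => ?_
      beta_reduce
      rw [← mul_neg]
      congr 1
      rw [← F.2.2.1]
      refine congrArg F.1 (Subtype.ext ?_)
      change SpinWreath.embL h x⁻¹ * SpinWreath.embR h (SpinWreath.z Γ k * y) =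
        SpinWreath.z Γ N * (SpinWreath.embL h x⁻¹ * SpinWreath.embR h y)
      rw [map_mul, SpinWreath.embR_z, ← mul_assoc, ← SpinWreath.z_comm, mul_assoc]
    · unfold weightedForm
      rw [Finset.sum_eq_zero, mul_zero]
      intro x hx
      beta_reduce
      have hx : SpinWreath.parity Γ n x⁻¹ = 1 := by
        rw [map_inv, (Finset.mem_filter.1 hx).2, inv_one]
      rw [F.2.2.2, mul_zero]
      change SpinWreath.parity Γ N (SpinWreath.embL h x⁻¹ * SpinWreath.embR h y) ≠ 1
      rw [parity_embL_mul_embR, hx, one_mul]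
      exact hy⟩
  map_add' F F' := by
    ext y
    simp only [weightedForm, Submodule.coe_add, Pi.add_apply, mul_add, Finset.sum_add_distrib]
  map_smul' c F := by
    ext y
    simp only [weightedForm, Submodule.coe_smul, Pi.smul_apply, smul_eq_mul, RingHom.id_apply,
      Finset.mul_sum]
    refine Finset.sum_congr rfl fun x _ => ?_
    ring

theorem contract_apply (u : RMinus Γ n) (F : RProd Γ h) (y : SpinWreath Γ k) :
    (contract h ξ u F).1 y = weightedForm ξ n u.1 (fun x =>
      F.1 ⟨SpinWreath.embL h x * SpinWreath.embR h y, SpinWreath.mem_spinProd h x y⟩) := rfl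

theorem outer_apply (f : RMinus Γ n) (g : RMinus Γ k) (x : SpinWreath Γ n) (y : SpinWreath Γ k) :
    (outer h f g).1 ⟨SpinWreath.embL h x * SpinWreath.embR h y, SpinWreath.mem_spinProd h x y⟩ =
      f.1 x * g.1 y := outerFun_apply h f g x y

/-- On a super outer tensor product, `contract` pairs `u` with the first factor. -/
theorem contract_outer (u f : RMinus Γ n) (g : RMinus Γ k) :
    contract h ξ u (outer h f g) = weightedForm ξ n u.1 f.1 • g := by
  refine Subtype.ext (funext fun y => ?_)
  rw [contract_apply, Submodule.coe_smul, Pi.smul_apply, smul_eq_mul]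
  simp only [outer_apply]
  unfold weightedForm
  rw [mul_assoc, Finset.sum_mul]
  simp only [mul_assoc]

end Product

/-! ## Twisted vertex operators -/

section Operators

variable [Finite Γ]

open scoped DirectSum

/-- `f ↦ Ind (u ⊗ f)`, as an operator on `RGamma Γ`. -/
noncomputable def creation {n : ℕ} (u : RMinus Γ n) : Module.End ℂ (RGamma Γ) :=
  DirectSum.toModule ℂ ℕ (RGamma Γ) fun m =>
    DirectSum.lof ℂ ℕ (fun j => RMinus Γ j) (n + m) ∘ₗ indProd rfl ∘ₗ outer rfl u

variable {W : Type*} [AddCommGroup W] [Module ℂ W] [FiniteDimensional ℂ W]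
  (ξ : Representation ℂ Γ W)

/-- `f ↦ ⟨u, Res f⟩`, as an operator on `RGamma Γ`; it is zero in degrees below the degree of `u`. -/
noncomputable def annihilation {n : ℕ} (u : RMinus Γ n) : Module.End ℂ (RGamma Γ) :=
  DirectSum.toModule ℂ ℕ (RGamma Γ) fun m =>
    if h : n ≤ m then
      DirectSum.lof ℂ ℕ (fun j => RMinus Γ j) (m - n) ∘ₗ
        contract (Nat.add_sub_of_le h) ξ u ∘ₗ resProd (Nat.add_sub_of_le h)
    else 0

/-- Given one element `q l` in every degree, write `H (-l)` for `creation (q l)` and `H l` for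
`annihilation (q l)`. This is the coefficient of `z ^ (-n)` in the product of `∑ H (-k) z ^ k` and
`∑ H l (-z) ^ (-l)` (sums over `k, l ≥ 0`), that is, the sum of `(-1) ^ l H (-k) H l` over all
`k, l ≥ 0` with `l - k = n`. On degree `m` only the terms with `l ≤ m` contribute. -/
noncomputable def vertexCoeff (q : ∀ l, RMinus Γ l) (n : ℤ) : Module.End ℂ (RGamma Γ) :=
  DirectSum.toModule ℂ ℕ (RGamma Γ) fun m =>
    (∑ p ∈ Finset.range (m + 1) ×ˢ Finset.range (m + n.natAbs + 1) with (p.1 : ℤ) - p.2 = n,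
      (-1 : ℂ) ^ p.1 • (creation (q p.2) * annihilation ξ (q p.1))) ∘ₗ
        DirectSum.lof ℂ ℕ (fun j => RMinus Γ j) m

variable {V : Type*} [AddCommGroup V] [Module ℂ V] [FiniteDimensional ℂ V]
  (ρ : Representation ℂ Γ V)

/-- The basic spin character attached to the virtual representation `-ρ`, that is, to `0 - ρ`: the
alternating sum of the inductions of the outer products of the basic spin characters attached to
the zero representation and to `ρ`. -/
noncomputable def basicCharNeg (n : ℕ) : RMinus Γ n :=
  ∑ m : Fin (n + 1), (-1 : ℂ) ^ m.1 •
    indProd (n := n - m.1) (k := m.1) (by omega)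
      (outer _ (basicChar (1 : Representation ℂ Γ PUnit) (n - m.1)) (basicChar ρ m.1))

/-- The factor `2 ^ (r / 2)`, where `r` is `0` or `1` according to whether `n` is even or odd. -/
noncomputable def parityFactor (n : ℕ) : ℂ := ((Real.sqrt 2 ^ (n % 2) : ℝ) : ℂ)

/-- The operators `X⁺ₙ(ρ)`: the coefficients of the twisted vertex operator `X(ρ, z)`, for the
weight `ξ`. -/
noncomputable def vertexPlus (n : ℤ) : Module.End ℂ (RGamma Γ) :=
  vertexCoeff ξ (fun l => parityFactor l • basicChar ρ l) n

/-- The operators `X⁻ₙ(ρ)`: the coefficients of the twisted vertex operator `X(-ρ, z)`, for the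
weight `ξ`. -/
noncomputable def vertexMinus (n : ℤ) : Module.End ℂ (RGamma Γ) :=
  vertexCoeff ξ (fun l => parityFactor l • basicCharNeg ρ l) n

end Operators

end Spin

end SpinVertex

/-! The double cover can be eliminated. A spin super class function vanishes at every element over a
permutation of even order: up to conjugation an even cycle splits off as an odd block, at an even
element the complementary block is odd too, and moving one past the other shows that `w` is
conjugate to `z w` (`rminus_apply_eq_zero`). A permutation of odd order has exactly one lift of odd
order to the spin group, so the values at these lifts determine the function (`transfer_injective`).
An element of R^-_Γ thus becomes a family `hatG f` of functions of Γ-labelled permutations of all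
finite sets, invariant under relabelling. Inducing an outer product becomes a sum over invariant
subsets (`hatG_creation`); restricting and pairing becomes an average over labelled permutations of
`l` additional points (`hatG_annihilation`). No signs remain, and the creation operators commute
among themselves, as do the annihilation operators, because disjoint unions are commutative and
associative.

In this language the basic spin characters, scaled by 2^{n̄/2}, form a family `charFam ρ` that is
multiplicative under disjoint union, and multiplicative families are determined by their values at
cycles. Write Q_k for `createOp` and D_l for `annihOp`. Three facts carry the proof. (1) D_l Q_k = ∑
c_j Q_{k-j} D_{l-j} over j ≤ k, l, where c_j is the pairing of the two families in degree j
(`annihOp_mul_createOp`, from `contr_grade_mul`). (2) Summing over labels first, Schur orthogonality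
gives c_j = 0 for j > 0 when the irreducible representations are inequivalent. When they coincide
there remains the mean of `spinFam x * spinFam x⁻¹`, whose value at a cycle of length m is 1 -
(-1)^m; this gives c_0 = 1 and c_j = 2 for j > 0, the coefficients of (1 + t)/(1 - t)
(`pairing_charFam_self`, `pairing_charFam_of_isEmpty`). (3) ∑ (-1)^a Q_a Q_b over a + b = n is 0 for
n > 0 and 1 for n = 0, and likewise for D (`sum_createOp_mul_createOp`, `sum_annihOp_mul_annihOp`).
Indeed the family and its version with signs (-1)^n add up to zero at every cycle.

The rest is formal. Normal ordering X_n X_{n'} produces the sums ∑_{j ≥ 0} (-1)^j c_j Q_{x+j}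
Q_{y-j}. If c_j = 0 for j > 0 the result is symmetric and the operators commute
(`IsVertexSum.commute`). If c_j = 2 for j > 0, adding the reversed product completes the sum to all
integers j with coefficient 2; the relation for Q leaves only x + y = 0, and then the relation for D
leaves only n + n' = 0 (`IsVertexSum.anticommute`). Finally, χ_k(0) = 0 for k > 0, so χ_n(-γ) =
(-1)^n χ_n(γ) and X⁻_n = (-1)^n X⁺_n (`vertexMinus_eq`), which reduces all relations to those among
the X⁺. -/

namespace SpinVertex

/-! ## Labelled permutations of finite sets -/

/-- A permutation of `U` together with a labelling of `U` by elements of `Γ`. -/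
abbrev Str (Γ : Type*) (U : Type) : Type _ := (U → Γ) × Equiv.Perm U

namespace Str

variable {Γ : Type*} {U V W : Type}

/-- Transport along a bijection. -/
def map (e : U ≃ V) (x : Str Γ U) : Str Γ V := (x.1 ∘ e.symm, e.permCongr x.2)

/-- Disjoint union. -/
def sum (x : Str Γ U) (y : Str Γ V) : Str Γ (U ⊕ V) :=
  (Sum.elim x.1 y.1, Equiv.sumCongr x.2 y.2)

/-- The inverse in the wreath product. -/
def inv [Group Γ] (x : Str Γ U) : Str Γ U := (fun i => (x.1 (x.2 i))⁻¹, x.2⁻¹)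

/-- Invariance of a subset under the permutation. -/
def IsInv (A : Set U) (x : Str Γ U) : Prop := ∀ i, x.2 i ∈ A ↔ i ∈ A

/-- Restriction to an invariant subset. -/
def restr (A : Set U) (x : Str Γ U) (h : x.IsInv A) : Str Γ A :=
  (fun i => x.1 i, x.2.subtypePerm h)

theorem map_map (e : U ≃ V) (e' : V ≃ W) (x : Str Γ U) :
    (x.map e).map e' = x.map (e.trans e') := rfl

@[simp] theorem map_refl (x : Str Γ U) : x.map (Equiv.refl U) = x := rfl

/-- Transport as a bijection. -/
def mapEquiv (Γ : Type*) (e : U ≃ V) : Str Γ U ≃ Str Γ V where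
  toFun := map e
  invFun := map e.symm
  left_inv x := by rw [map_map, Equiv.self_trans_symm, map_refl]
  right_inv x := by rw [map_map, Equiv.symm_trans_self, map_refl]

theorem inv_map [Group Γ] (e : U ≃ V) (x : Str Γ U) : (x.map e).inv = x.inv.map e := by
  refine Prod.ext (funext fun i => ?_) (Equiv.ext fun i => ?_)
  · simp [map, inv]
  · rfl

theorem inv_sum [Group Γ] (x : Str Γ U) (y : Str Γ V) : (x.sum y).inv = x.inv.sum y.inv := by
  refine Prod.ext (funext fun i => ?_) (Equiv.ext fun i => ?_)
  · rcases i with i | i <;> rfl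
  · rcases i with i | i <;> rfl

theorem sum_map {U' V' : Type} (e : U ≃ U') (e' : V ≃ V') (x : Str Γ U) (y : Str Γ V) :
    (x.map e).sum (y.map e') = (x.sum y).map (Equiv.sumCongr e e') := by
  refine Prod.ext (funext fun i => ?_) (Equiv.ext fun i => ?_)
  · rcases i with i | i <;> rfl
  · rcases i with i | i <;> rfl

theorem sum_sum_comm (x : Str Γ U) (y : Str Γ V) (w : Str Γ W) :
    (x.sum (y.sum w)).map ((Equiv.sumAssoc U V W).symm) = (x.sum y).sum w := by
  refine Prod.ext (funext fun i => ?_) (Equiv.ext fun i => ?_)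
  · rcases i with (i | i) | i <;> rfl
  · rcases i with (i | i) | i <;> rfl

theorem isInv_compl {A : Set U} {x : Str Γ U} : x.IsInv Aᶜ ↔ x.IsInv A := by
  simp only [IsInv, Set.mem_compl_iff, not_iff_not]

theorem IsInv.compl {A : Set U} {x : Str Γ U} (h : x.IsInv A) : x.IsInv Aᶜ := isInv_compl.2 h

theorem isInv_inv [Group Γ] {A : Set U} {x : Str Γ U} : x.inv.IsInv A ↔ x.IsInv A := by
  constructor
  · intro h i
    have := h (x.2 i)
    simpa [inv] using this.symm
  · intro h i
    have := h (x.2⁻¹ i)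
    simpa [inv] using this.symm

theorem isInv_map {e : U ≃ V} {A : Set V} {x : Str Γ U} :
    (x.map e).IsInv A ↔ x.IsInv (e ⁻¹' A) := by
  constructor
  · intro h i
    simpa [map] using h (e i)
  · intro h i
    simpa [map] using h (e.symm i)

theorem restr_map {e : U ≃ V} {A : Set V} {x : Str Γ U} (h : (x.map e).IsInv A) :
    (x.map e).restr A h = (x.restr (e ⁻¹' A) (isInv_map.1 h)).map
      (e.subtypeEquiv (p := fun a => a ∈ e ⁻¹' A) (q := fun b => b ∈ A) fun _ => Iff.rfl) := rfl

theorem isInv_sum {C : Set (U ⊕ V)} {x : Str Γ U} {y : Str Γ V} :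
    (x.sum y).IsInv C ↔ x.IsInv (Sum.inl ⁻¹' C) ∧ y.IsInv (Sum.inr ⁻¹' C) :=
  Sum.forall

theorem restr_sum {C : Set (U ⊕ V)} {x : Str Γ U} {y : Str Γ V} (h : (x.sum y).IsInv C) :
    ((x.sum y).restr C h).map (Equiv.subtypeSum (p := fun c => c ∈ C)) =
      (x.restr _ (isInv_sum.1 h).1).sum (y.restr _ (isInv_sum.1 h).2) := by
  refine Prod.ext (funext fun i => ?_) (Equiv.ext fun i => ?_)
  · rcases i with i | i <;> rfl
  · rcases i with i | i <;> rfl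

open Classical in
theorem sum_restr {A : Set U} {x : Str Γ U} (h : x.IsInv A) :
    ((x.restr A h).sum (x.restr Aᶜ h.compl)).map (Equiv.Set.sumCompl A) = x := by
  refine Prod.ext (funext fun i => ?_) (Equiv.ext fun i => ?_)
  · by_cases hi : i ∈ A
    · simp [map, sum, restr, Equiv.Set.sumCompl_symm_apply_of_mem hi]
    · simp [map, sum, restr, Equiv.Set.sumCompl_symm_apply_of_notMem hi]
  · by_cases hi : i ∈ A
    · simp [map, sum, restr, Equiv.Set.sumCompl_symm_apply_of_mem hi]
      rfl
    · simp [map, sum, restr, Equiv.Set.sumCompl_symm_apply_of_notMem hi]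
      rfl

theorem isInv_image_val {A : Set U} {x : Str Γ U} (h : x.IsInv A) {B : Set A} :
    (x.restr A h).IsInv B ↔ x.IsInv (Subtype.val '' B) := by
  constructor
  · intro hB i
    by_cases hi : i ∈ A
    · have : (⟨x.2 i, (h i).2 hi⟩ : A) ∈ B ↔ ⟨i, hi⟩ ∈ B := hB ⟨i, hi⟩
      simpa [hi, (h i).2 hi] using this
    · have hi' : x.2 i ∉ A := fun h' => hi ((h i).1 h')
      simp [hi, hi']
  · intro hB i
    have := hB i
    change (⟨x.2 i, (h i).2 i.2⟩ : A) ∈ B ↔ i ∈ B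
    simpa [(h i).2 i.2] using this

/-- The image of a subset of a subset is in bijection with it. -/
noncomputable def imageVal {A : Set U} (B : Set A) : (Subtype.val '' B : Set U) ≃ B :=
  (Equiv.Set.image _ B Subtype.val_injective).symm

theorem restr_image_val {A : Set U} {x : Str Γ U} (h : x.IsInv A) {B : Set A}
    (hB : (x.restr A h).IsInv B) :
    (x.restr (Subtype.val '' B) ((isInv_image_val h).1 hB)).map (imageVal B) =
      (x.restr A h).restr B hB := by
  refine Prod.ext (funext fun i => ?_) (Equiv.ext fun i => ?_)
  · simp [map, restr, imageVal]
  · apply (imageVal B).symm.injective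
    apply Subtype.ext
    simp [map, restr, imageVal]
    rfl

/-- Labelled permutations for which `A` is invariant are pairs of labelled permutations. -/
noncomputable def isInvEquiv (Γ : Type*) (A : Set U) :
    {x : Str Γ U // x.IsInv A} ≃ Str Γ A × Str Γ (Aᶜ : Set U) := by
  classical
  exact
  { toFun := fun x => (x.1.restr A x.2, x.1.restr Aᶜ x.2.compl)
    invFun := fun p => ⟨(p.1.sum p.2).map (Equiv.Set.sumCompl A), by
      rw [isInv_map, isInv_sum]
      refine ⟨fun i => ?_, fun i => ?_⟩
      · simp
      · have h1 := i.2
        have h2 := (p.2.2 i).2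
        simp only [Set.mem_compl_iff] at h1 h2
        simp [h1, h2]⟩
    left_inv := fun x => Subtype.ext (sum_restr x.2)
    right_inv := fun p => by
      refine Prod.ext (Prod.ext (funext fun i => ?_) (Equiv.ext fun i => ?_))
        (Prod.ext (funext fun i => ?_) (Equiv.ext fun i => ?_))
      · simp [map, sum, restr]
      · apply Subtype.ext
        simp [map, sum, restr, Equiv.Set.sumCompl_symm_apply_of_mem i.2]
      · simp [map, sum, restr]
      · apply Subtype.ext
        simp [map, sum, restr, Equiv.Set.sumCompl_symm_apply_of_notMem i.2] }

end Str

/-! ## Class functions on labelled permutations -/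

/-- A function on the labelled permutations of every set. -/
abbrev Fam (Γ : Type*) : Type _ := ∀ U : Type, Str Γ U → ℂ

/-- Invariance under relabelling of the underlying set. -/
def IsNat {Γ : Type*} (φ : Fam Γ) : Prop :=
  ∀ (U V : Type) (e : U ≃ V) (x : Str Γ U), φ V (x.map e) = φ U x

section Fam

variable {Γ : Type*} {U V W : Type}

open Classical in
/-- The value on the restriction to `A`, or zero if `A` is not invariant. -/
noncomputable def loc (φ : Fam Γ) (A : Set U) (x : Str Γ U) : ℂ :=
  if h : x.IsInv A then φ A (x.restr A h) else 0

theorem loc_of_isInv (φ : Fam Γ) {A : Set U} {x : Str Γ U} (h : x.IsInv A) :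
    loc φ A x = φ A (x.restr A h) := dif_pos h

theorem loc_of_not_isInv (φ : Fam Γ) {A : Set U} {x : Str Γ U} (h : ¬ x.IsInv A) :
    loc φ A x = 0 := dif_neg h

/-- The product of families: the sum over the decompositions into two invariant subsets. -/
noncomputable def Fam.mul (φ ψ : Fam Γ) : Fam Γ := fun U x =>
  ∑ᶠ A : Set U, loc φ A x * loc ψ Aᶜ x

theorem loc_map {φ : Fam Γ} (hφ : IsNat φ) (e : U ≃ V) (A : Set V) (x : Str Γ U) :
    loc φ A (x.map e) = loc φ (e ⁻¹' A) x := by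
  by_cases h : (x.map e).IsInv A
  · rw [loc_of_isInv φ h, loc_of_isInv φ (Str.isInv_map.1 h), Str.restr_map h]
    exact hφ _ _ _ _
  · rw [loc_of_not_isInv φ h, loc_of_not_isInv φ (fun h' => h (Str.isInv_map.2 h'))]

theorem IsNat.mul {φ ψ : Fam Γ} (hφ : IsNat φ) (hψ : IsNat ψ) : IsNat (φ.mul ψ) := by
  intro U V e x
  unfold Fam.mul
  rw [← finsum_comp_equiv (Equiv.Set.congr e)]
  refine finsum_congr fun A => ?_
  rw [loc_map hφ, loc_map hψ, Set.preimage_compl]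
  have : e ⁻¹' (Equiv.Set.congr e A) = A := by
    ext i; simp [Equiv.Set.congr]
  rw [this]

theorem loc_image_val {φ : Fam Γ} (hφ : IsNat φ) {A : Set U} {x : Str Γ U} (h : x.IsInv A)
    (B : Set A) : loc φ B (x.restr A h) = loc φ (Subtype.val '' B) x := by
  by_cases hB : (x.restr A h).IsInv B
  · rw [loc_of_isInv φ hB, loc_of_isInv φ ((Str.isInv_image_val h).1 hB),
      ← Str.restr_image_val h hB]
    exact hφ _ _ _ _
  · rw [loc_of_not_isInv φ hB, loc_of_not_isInv φ (fun h' => hB ((Str.isInv_image_val h).2 h'))]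

/-- An invariant subset together with an invariant subset of its complement is an ordered pair of
disjoint invariant subsets. In this form the first two factors play symmetric roles. -/
theorem mul_mul_eq [Finite U] (φ : Fam Γ) {ψ χ : Fam Γ} (hψ : IsNat ψ) (hχ : IsNat χ)
    (x : Str Γ U) :
    φ.mul (ψ.mul χ) U x = ∑ᶠ p : {p : Set U × Set U // Disjoint p.1 p.2},
      loc φ p.1.1 x * (loc ψ p.1.2 x * loc χ (p.1.1 ∪ p.1.2)ᶜ x) := by
  classical
  let E : {p : Set U × Set U // Disjoint p.1 p.2} ≃ Σ A : Set U, Set (Aᶜ : Set U) :=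
    { toFun := fun p => ⟨p.1.1, Subtype.val ⁻¹' p.1.2⟩
      invFun := fun q => ⟨(q.1, Subtype.val '' q.2), by
        rw [Set.disjoint_left]
        rintro a ha ⟨b, -, rfl⟩
        exact b.2 ha⟩
      left_inv := fun p => by
        refine Subtype.ext (Prod.ext rfl ?_)
        change Subtype.val '' (Subtype.val ⁻¹' p.1.2) = p.1.2
        rw [Subtype.image_preimage_coe]
        exact Set.inter_eq_right.2 (fun a ha ha' => Set.disjoint_left.1 p.2 ha' ha)
      right_inv := fun q => by
        refine Sigma.ext rfl (heq_of_eq ?_)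
        exact Set.preimage_image_eq _ Subtype.val_injective }
  have : Fintype (Set U) := Fintype.ofFinite _
  have : ∀ A : Set U, Fintype (Set (Aᶜ : Set U)) := fun A => Fintype.ofFinite _
  rw [← finsum_comp_equiv E.symm, finsum_eq_sum_of_fintype, Fintype.sum_sigma]
  unfold Fam.mul
  rw [finsum_eq_sum_of_fintype]
  refine Finset.sum_congr rfl fun A _ => ?_
  by_cases hA : x.IsInv A
  · rw [loc_of_isInv _ hA.compl, finsum_eq_sum_of_fintype, Finset.mul_sum]
    refine Finset.sum_congr rfl fun B _ => ?_
    rw [loc_image_val hψ, loc_image_val hχ]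
    congr 3
    ext i
    simp [E]
  · rw [loc_of_not_isInv _ hA, zero_mul, Finset.sum_eq_zero]
    intro B _
    rw [show (E.symm ⟨A, B⟩).1.1 = A from rfl, loc_of_not_isInv _ hA, zero_mul]

/-- Multiplications by natural families commute. -/
theorem mul_left_comm_fam [Finite U] {φ ψ χ : Fam Γ} (hφ : IsNat φ) (hψ : IsNat ψ)
    (hχ : IsNat χ) (x : Str Γ U) : φ.mul (ψ.mul χ) U x = ψ.mul (φ.mul χ) U x := by
  rw [mul_mul_eq φ hψ hχ, mul_mul_eq ψ hφ hχ]
  let E : {p : Set U × Set U // Disjoint p.1 p.2} ≃ {p : Set U × Set U // Disjoint p.1 p.2} :=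
    (Equiv.prodComm _ _).subtypeEquiv fun p => disjoint_comm
  rw [← finsum_comp_equiv E]
  refine finsum_congr fun p => ?_
  have h1 : (E p).1.1 = p.1.2 := rfl
  have h2 : (E p).1.2 = p.1.1 := rfl
  rw [h1, h2, Set.union_comm]
  ring

end Fam

end SpinVertex

namespace SpinVertex

open scoped Nat
open Finset.HasAntidiagonal (antidiagonal)

/-! ### Averages over labelled permutations. -/

section Integral

variable {Γ : Type*} {U V W : Type}

/-- The normalized sum over all labelled permutations of `U`. -/
noncomputable def integral (U : Type) (Φ : Str Γ U → ℂ) : ℂ :=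
  (((Nat.card U)! : ℂ) * (Nat.card Γ : ℂ) ^ Nat.card U)⁻¹ * ∑ᶠ x : Str Γ U, Φ x

theorem integral_map (e : U ≃ V) (Φ : Str Γ V → ℂ) :
    integral V Φ = integral U fun x => Φ (x.map e) := by
  unfold integral
  rw [Nat.card_congr e, ← finsum_comp_equiv (Str.mapEquiv Γ e)]
  rfl

theorem integral_integral_map {U' V' : Type} {Θ : ∀ U V : Type, Str Γ U → Str Γ V → ℂ}
    (hΘ : ∀ (U V U' V' : Type) (e : U ≃ U') (e' : V ≃ V') (x : Str Γ U) (y : Str Γ V),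
      Θ U' V' (x.map e) (y.map e') = Θ U V x y) (e : U ≃ U') (e' : V ≃ V') :
    (integral U' fun x => integral V' fun y => Θ U' V' x y) =
      integral U fun x => integral V fun y => Θ U V x y := by
  rw [integral_map e (Φ := fun x => integral V' fun y => Θ U' V' x y)]
  congr 1
  funext x
  rw [integral_map e' (Φ := fun y => Θ U' V' (x.map e) y)]
  congr 1
  funext y
  exact hΘ _ _ _ _ _ _ _ _

variable [Finite Γ]

theorem integral_const_mul [Finite U] (c : ℂ) (Φ : Str Γ U → ℂ) :
    integral U (fun x => c * Φ x) = c * integral U Φ := by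
  have : Fintype (Str Γ U) := Fintype.ofFinite _
  simp only [integral, finsum_eq_sum_of_fintype, ← Finset.mul_sum]
  ring

theorem integral_mul_const [Finite U] (c : ℂ) (Φ : Str Γ U → ℂ) :
    integral U (fun x => Φ x * c) = integral U Φ * c := by
  simp only [mul_comm _ c, integral_const_mul]

theorem integral_comm [Finite U] [Finite V] (Φ : Str Γ U → Str Γ V → ℂ) :
    (integral U fun x => integral V fun y => Φ x y) =
      integral V fun y => integral U fun x => Φ x y := by
  have : Fintype (Str Γ U) := Fintype.ofFinite _
  have : Fintype (Str Γ V) := Fintype.ofFinite _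
  simp only [integral, finsum_eq_sum_of_fintype, ← Finset.mul_sum]
  rw [Finset.sum_comm]
  ring

theorem integral_finset_sum [Finite U] {ι : Type*} (s : Finset ι) (Φ : ι → Str Γ U → ℂ) :
    (integral U fun x => ∑ i ∈ s, Φ i x) = ∑ i ∈ s, integral U (Φ i) := by
  have : Fintype (Str Γ U) := Fintype.ofFinite _
  simp only [integral, finsum_eq_sum_of_fintype, ← Finset.mul_sum]
  rw [Finset.sum_comm]

theorem integral_finsum [Finite U] {ι : Type*} [Finite ι] (Φ : ι → Str Γ U → ℂ) :
    (integral U fun x => ∑ᶠ i, Φ i x) = ∑ᶠ i, integral U (Φ i) := by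
  have : Fintype ι := Fintype.ofFinite _
  simp only [finsum_eq_sum_of_fintype, integral_finset_sum]

theorem sum_eq_integral [Nonempty Γ] [Finite U] [Fintype (Str Γ U)] (Φ : Str Γ U → ℂ) :
    ∑ x, Φ x = ((Nat.card U)! : ℂ) * (Nat.card Γ : ℂ) ^ Nat.card U * integral U Φ := by
  have h1 : (((Nat.card U)! : ℂ)) ≠ 0 := by exact_mod_cast (Nat.factorial_ne_zero _)
  have h2 : (Nat.card Γ : ℂ) ≠ 0 := by exact_mod_cast Nat.card_pos.ne'
  rw [integral, ← mul_assoc, mul_inv_cancel₀ (mul_ne_zero h1 (pow_ne_zero _ h2)), one_mul,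
    finsum_eq_sum_of_fintype]

theorem sum_dite_eq_sum_subtype {α : Type*} [Fintype α] (p : α → Prop) [DecidablePred p]
    (f : ∀ a, p a → ℂ) :
    ∑ a, (if h : p a then f a h else 0) = ∑ a : {a // p a}, f a.1 a.2 := by
  rw [← Fintype.sum_subtype_add_sum_subtype p]
  have : ∑ i : {x // ¬p x}, (if h : p i.1 then f i.1 h else 0) = 0 :=
    Finset.sum_eq_zero fun a _ => dif_neg a.2
  rw [this, add_zero]
  exact Finset.sum_congr rfl fun a _ => dif_pos a.2

theorem sum_set_card [Finite U] [Fintype (Set U)] (n : ℕ) (hn : Nat.card U = n)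
    (f : ℕ → ℕ → ℂ) :
    ∑ A : Set U, f (Nat.card A) (Nat.card (Aᶜ : Set U)) =
      ∑ p ∈ antidiagonal n, (n.choose p.1 : ℂ) * f p.1 p.2 := by
  classical
  have : Fintype U := Fintype.ofFinite _
  have h : ∑ A : Set U, f (Nat.card A) (Nat.card (Aᶜ : Set U)) =
      ∑ s ∈ (Finset.univ : Finset U).powerset, f s.card (n - s.card) := by
    rw [Finset.powerset_univ]
    refine (Fintype.sum_equiv Fintype.finsetEquivSet _ _ fun s => ?_).symm
    have h1 : Nat.card (Fintype.finsetEquivSet s : Set U) = s.card := by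
      simp
    have h2 : Nat.card ((Fintype.finsetEquivSet s)ᶜ : Set U) = n - s.card := by
      rw [Nat.card_coe_set_eq, Set.ncard_compl, ← Nat.card_coe_set_eq, h1, hn]
    rw [h1, h2]
  rw [h, Finset.sum_powerset_apply_card (fun a => f a (n - a)), Finset.card_univ,
    ← Nat.card_eq_fintype_card, hn, Finset.Nat.sum_antidiagonal_eq_sum_range_succ_mk]
  simp

open Classical in
/-- Integrating a sum over decompositions into two invariant subsets. -/
theorem integral_sum_decomp [Nonempty Γ] [Finite U] {n : ℕ} (hn : Nat.card U = n)
    (Θ : ∀ U V : Type, Str Γ U → Str Γ V → ℂ)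
    (hΘ : ∀ (U V U' V' : Type) (e : U ≃ U') (e' : V ≃ V') (x : Str Γ U) (y : Str Γ V),
      Θ U' V' (x.map e) (y.map e') = Θ U V x y) :
    (integral U fun x : Str Γ U => ∑ᶠ A : Set U,
      if h : x.IsInv A then Θ A (Aᶜ : Set U) (x.restr A h) (x.restr Aᶜ h.compl) else 0) =
    ∑ p ∈ antidiagonal n,
      integral (Fin p.1) fun x => integral (Fin p.2) fun y => Θ (Fin p.1) (Fin p.2) x y := by
  have hfin : Fintype (Str Γ U) := Fintype.ofFinite _
  have hfin' : Fintype (Set U) := Fintype.ofFinite _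
  let J : ℕ → ℕ → ℂ := fun a b =>
    integral (Fin a) fun x => integral (Fin b) fun y => Θ (Fin a) (Fin b) x y
  have hΓ : (Nat.card Γ : ℂ) ≠ 0 := by exact_mod_cast Nat.card_pos.ne'
  -- Labelled permutations preserving `A` are pairs of labelled permutations of `A` and of its
  -- complement, so the sum depends only on the two cardinalities.
  have key : ∀ A : Set U, (∑ x : Str Γ U,
      if h : x.IsInv A then Θ A (Aᶜ : Set U) (x.restr A h) (x.restr Aᶜ h.compl) else 0) =
      (Nat.card Γ : ℂ) ^ n * (((Nat.card A)! : ℂ) * ((Nat.card (Aᶜ : Set U))! : ℂ) *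
        J (Nat.card A) (Nat.card (Aᶜ : Set U))) := by
    intro A
    have hcard : Nat.card A + Nat.card (Aᶜ : Set U) = n := by
      rw [← hn, Nat.card_coe_set_eq, Nat.card_coe_set_eq, Set.ncard_add_ncard_compl]
    have hJ : J (Nat.card A) (Nat.card (Aᶜ : Set U)) =
        integral A fun x => integral (Aᶜ : Set U) fun y => Θ A (Aᶜ : Set U) x y := by
      exact integral_integral_map hΘ (Finite.equivFin A) (Finite.equivFin (Aᶜ : Set U))
    have : Fintype (Str Γ A) := Fintype.ofFinite _
    have : Fintype (Str Γ (Aᶜ : Set U)) := Fintype.ofFinite _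
    rw [sum_dite_eq_sum_subtype (fun x : Str Γ U => x.IsInv A) fun x h =>
      Θ A (Aᶜ : Set U) (x.restr A h) (x.restr Aᶜ h.compl)]
    refine (Fintype.sum_equiv (Str.isInvEquiv Γ A) _
      (fun p => Θ A (Aᶜ : Set U) p.1 p.2) fun x => rfl).trans ?_
    rw [Fintype.sum_prod_type, hJ]
    simp only [sum_eq_integral, integral_const_mul]
    rw [← hcard, pow_add]
    ring
  rw [integral, finsum_eq_sum_of_fintype]
  simp only [finsum_eq_sum_of_fintype]
  rw [Finset.sum_comm, Finset.sum_congr rfl fun A _ => key A, ← Finset.mul_sum,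
    sum_set_card n hn fun a b => ((a ! : ℂ) * (b ! : ℂ)) * J a b, hn, Finset.mul_sum,
    Finset.mul_sum]
  refine Finset.sum_congr rfl fun p hp => ?_
  have hp : p.1 + p.2 = n := Finset.HasAntidiagonal.mem_antidiagonal.1 hp
  -- The number of subsets of a given size cancels the two factorials against the normalization `n
  -- !`.
  have h3 : (n.choose p.1 : ℂ) * ((p.1)! * (p.2)!) = n ! := by
    rw [← hp, ← mul_assoc, Nat.choose_symm_add]
    exact_mod_cast Nat.add_choose_mul_factorial_mul_factorial p.1 p.2
  have h4 : (n ! : ℂ) ≠ 0 := by exact_mod_cast Nat.factorial_ne_zero n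
  rw [← mul_assoc (n.choose p.1 : ℂ), h3]
  field_simp
  rfl

end Integral
end SpinVertex

namespace SpinVertex

open Finset.HasAntidiagonal (antidiagonal)

/-! ### Multiplicative families and contraction. -/

section Contraction

variable {Γ : Type*} {U V W : Type}

/-- The part of a family supported on sets with `k` elements. -/
noncomputable def Fam.grade (k : ℕ) (φ : Fam Γ) : Fam Γ := fun U x =>
  if Nat.card U = k then φ U x else 0

theorem IsNat.grade {φ : Fam Γ} (hφ : IsNat φ) (k : ℕ) : IsNat (φ.grade k) := by
  intro U V e x
  unfold Fam.grade
  rw [Nat.card_congr e, hφ]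

theorem loc_grade (φ : Fam Γ) (k : ℕ) (A : Set U) (x : Str Γ U) :
    loc (φ.grade k) A x = if Nat.card A = k then loc φ A x else 0 := by
  unfold loc Fam.grade
  split_ifs <;> rfl

/-- Multiplicativity under disjoint unions. -/
structure IsMult (φ : Fam Γ) : Prop where
  isNat : IsNat φ
  sum : ∀ (U V : Type) [Finite U] [Finite V] (x : Str Γ U) (y : Str Γ V),
    φ (U ⊕ V) (x.sum y) = φ U x * φ V y
  empty : ∀ (U : Type) [IsEmpty U] (x : Str Γ U), φ U x = 1

theorem loc_sum {φ : Fam Γ} (hφ : IsNat φ) (C : Set (U ⊕ V)) {x : Str Γ U} {y : Str Γ V}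
    (hx : x.IsInv (Sum.inl ⁻¹' C)) (hy : y.IsInv (Sum.inr ⁻¹' C)) :
    loc φ C (x.sum y) = φ _ ((x.restr _ hx).sum (y.restr _ hy)) := by
  have h : (x.sum y).IsInv C := Str.isInv_sum.2 ⟨hx, hy⟩
  rw [loc_of_isInv _ h, ← Str.restr_sum h]
  exact (hφ _ _ _ _).symm

theorem IsMult.loc_sum {φ : Fam Γ} (hφ : IsMult φ) [Finite U] [Finite V] (C : Set (U ⊕ V))
    (x : Str Γ U) (y : Str Γ V) :
    loc φ C (x.sum y) = loc φ (Sum.inl ⁻¹' C) x * loc φ (Sum.inr ⁻¹' C) y := by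
  by_cases hx : x.IsInv (Sum.inl ⁻¹' C)
  · by_cases hy : y.IsInv (Sum.inr ⁻¹' C)
    · rw [SpinVertex.loc_sum hφ.isNat C hx hy, loc_of_isInv _ hx, loc_of_isInv _ hy]
      exact hφ.sum _ _ _ _
    · rw [loc_of_not_isInv _ hy, loc_of_not_isInv _ fun h => hy (Str.isInv_sum.1 h).2, mul_zero]
  · rw [loc_of_not_isInv _ hx, loc_of_not_isInv _ fun h => hx (Str.isInv_sum.1 h).1, zero_mul]

theorem IsMult.eq_mul_restr {φ : Fam Γ} (hφ : IsMult φ) [Finite U] {A : Set U} {x : Str Γ U}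
    (h : x.IsInv A) : φ U x = φ A (x.restr A h) * φ (Aᶜ : Set U) (x.restr Aᶜ h.compl) := by
  classical
  conv_lhs => rw [← Str.sum_restr h]
  rw [hφ.isNat, hφ.sum]

variable [Group Γ]

/-- Pairing of the first `l` letters with `φ`. -/
noncomputable def contr (φ : Fam Γ) (l : ℕ) (f : Fam Γ) : Fam Γ := fun U y =>
  integral (Fin l) fun x => φ _ x * f (Fin l ⊕ U) (x.inv.sum y)

theorem IsNat.contr {f : Fam Γ} (hf : IsNat f) (φ : Fam Γ) (l : ℕ) :
    IsNat (contr φ l f) := by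
  intro U V e y
  unfold SpinVertex.contr
  congr 1
  funext x
  have : x.inv.sum (y.map e) = (x.inv.sum y).map (Equiv.sumCongr (Equiv.refl _) e) := by
    rw [← Str.sum_map, Str.map_refl]
  rw [this, hf]

/-- The pairing of two families in degree `l`. -/
noncomputable def pairing (φ ψ : Fam Γ) (l : ℕ) : ℂ :=
  integral (Fin l) fun x => φ _ x * ψ _ x.inv

theorem contr_congr {φ : Fam Γ} {l : ℕ} {f g : Fam Γ}
    (h : ∀ (V : Type) [Finite V], f V = g V) [Finite U] : contr φ l f U = contr φ l g U := by
  funext y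
  simp only [contr, h]

variable [Finite Γ]

/-- The order of averaging may be exchanged, and the relabelling that swaps the two added blocks
identifies the integrands. -/
theorem contr_contr_comm [Finite U] (φ ψ : Fam Γ) {f : Fam Γ} (hf : IsNat f) (l m : ℕ)
    (y : Str Γ U) : contr φ l (contr ψ m f) U y = contr ψ m (contr φ l f) U y := by
  unfold contr
  simp only [← integral_const_mul]
  rw [integral_comm]
  congr 1; funext x'
  congr 1; funext x
  have : x'.inv.sum (x.inv.sum y) = (x.inv.sum (x'.inv.sum y)).map
      (((Equiv.sumAssoc _ _ _).symm.trans (Equiv.sumCongr (Equiv.sumComm _ _) (Equiv.refl _))).trans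
        (Equiv.sumAssoc _ _ _)) := by
    refine Prod.ext (funext fun i => ?_) (Equiv.ext fun i => ?_)
    · rcases i with i | i | i <;> rfl
    · rcases i with i | i | i <;> rfl
  rw [this, hf]
  ring

/-- Contraction is adjoint to multiplication: by `integral_sum_decomp`, a labelled permutation of
`n` points with a chosen invariant subset amounts to two independent labelled permutations. -/
theorem sum_contr_contr [Finite U] {φ ψ f : Fam Γ} (hφ : IsNat φ) (hψ : IsNat ψ) (hf : IsNat f)
    (n : ℕ) (y : Str Γ U) :
    ∑ p ∈ antidiagonal n, contr φ p.1 (contr ψ p.2 f) U y = contr (φ.mul ψ) n f U y := by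
  classical
  have h := integral_sum_decomp (Γ := Γ) (U := Fin n) (n := n) (by simp)
    (fun A B x x' => φ A x * (ψ B x' * f (A ⊕ B ⊕ U) (x.inv.sum (x'.inv.sum y))))
    (fun A B A' B' e e' x x' => by
      have : (x.map e).inv.sum ((x'.map e').inv.sum y) = (x.inv.sum (x'.inv.sum y)).map
          (Equiv.sumCongr e (Equiv.sumCongr e' (Equiv.refl _))) := by
        rw [← Str.sum_map, ← Str.sum_map, Str.inv_map, Str.inv_map, Str.map_refl]
      rw [hφ, hψ, this, hf])
  have e1 : ∀ p ∈ antidiagonal n, contr φ p.1 (contr ψ p.2 f) U y =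
      integral (Fin p.1) fun x => integral (Fin p.2) fun x' => φ (Fin p.1) x *
        (ψ (Fin p.2) x' * f (Fin p.1 ⊕ Fin p.2 ⊕ U) (x.inv.sum (x'.inv.sum y))) := by
    intro p _
    -- Exchanging the contractions puts the `φ`-block leftmost, as in the integrand of `h`.
    rw [contr_contr_comm φ ψ hf]
    unfold contr
    simp only [← integral_const_mul]
    rw [integral_comm]
    simp only [mul_left_comm]
  rw [Finset.sum_congr rfl e1, ← h]
  unfold contr
  congr 1; funext x
  have : Fintype (Set (Fin n)) := Fintype.ofFinite _
  rw [Fam.mul, finsum_eq_sum_of_fintype, finsum_eq_sum_of_fintype, Finset.sum_mul]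
  refine Finset.sum_congr rfl fun A _ => ?_
  by_cases hA : x.IsInv A
  · rw [dif_pos hA, loc_of_isInv _ hA, loc_of_isInv _ hA.compl, mul_assoc]
    congr 2
    have : (x.inv.sum y) = (((x.restr A hA).inv.sum ((x.restr Aᶜ hA.compl).inv.sum y))).map
        ((Equiv.sumAssoc _ _ _).symm.trans
          (Equiv.sumCongr (Equiv.Set.sumCompl A) (Equiv.refl _))) := by
      rw [← Str.map_map, Str.sum_sum_comm, ← Str.sum_map, Str.map_refl, ← Str.inv_sum,
        ← Str.inv_map, Str.sum_restr]
    rw [this, hf]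
  · rw [dif_neg hA, loc_of_not_isInv _ hA, zero_mul, zero_mul]

end Contraction
end SpinVertex

namespace SpinVertex

open Finset.HasAntidiagonal (antidiagonal)

/-! ### The product of families, its unit and its interaction with contraction. -/

section Products

variable {Γ : Type*} {U V W : Type}

theorem mul_comm_fam (φ ψ : Fam Γ) (x : Str Γ U) :
    φ.mul ψ U x = ψ.mul φ U x := by
  unfold Fam.mul
  rw [← finsum_comp_equiv (compl_involutive (α := Set U)).toPerm]
  refine finsum_congr fun A => ?_
  change loc φ Aᶜ x * loc ψ Aᶜᶜ x = _
  rw [compl_compl, mul_comm]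

theorem loc_congr {φ φ' : Fam Γ} [Finite U] (h : ∀ (V : Type) [Finite V], φ V = φ' V)
    (A : Set U) (x : Str Γ U) : loc φ A x = loc φ' A x := by
  unfold loc
  rw [h A]

/-- Only subsets of the finite set `U` are evaluated, so a factor may be replaced when the
replacement is known on finite sets alone. The formulas for the operators are of this kind. -/
theorem mul_congr_fam {φ φ' ψ ψ' : Fam Γ} [Finite U] (h : ∀ (V : Type) [Finite V], φ V = φ' V)
    (h' : ∀ (V : Type) [Finite V], ψ V = ψ' V) : φ.mul ψ U = φ'.mul ψ' U := by
  funext x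
  unfold Fam.mul
  refine finsum_congr fun A => ?_
  rw [loc_congr h, loc_congr h']

theorem mul_assoc_fam [Finite U] {φ ψ χ : Fam Γ} (hφ : IsNat φ) (hψ : IsNat ψ) (hχ : IsNat χ)
    (x : Str Γ U) : (φ.mul ψ).mul χ U x = φ.mul (ψ.mul χ) U x := by
  rw [mul_comm_fam, mul_left_comm_fam hχ hφ hψ]
  exact congrFun (mul_congr_fam (fun _ _ => rfl) fun V _ => funext fun y => mul_comm_fam _ _ y) x

theorem mul_add_fam [Finite U] (φ ψ ψ' : Fam Γ) (x : Str Γ U) :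
    φ.mul (fun U x => ψ U x + ψ' U x) U x = φ.mul ψ U x + φ.mul ψ' U x := by
  have : Fintype (Set U) := Fintype.ofFinite _
  simp only [Fam.mul, finsum_eq_sum_of_fintype, ← Finset.sum_add_distrib, ← mul_add]
  refine Finset.sum_congr rfl fun A _ => ?_
  congr 1
  unfold loc
  split_ifs <;> simp

theorem smul_mul_fam (c : ℂ) (φ ψ : Fam Γ) (x : Str Γ U) :
    Fam.mul (fun U x => c * φ U x) ψ U x = c * φ.mul ψ U x := by
  unfold Fam.mul
  rw [mul_finsum]
  refine finsum_congr fun A => ?_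
  rw [← mul_assoc]
  congr 1
  unfold loc
  split_ifs <;> simp

theorem sum_mul_fam [Finite U] {ι : Type*} (s : Finset ι) (φ : ι → Fam Γ) (ψ : Fam Γ)
    (x : Str Γ U) :
    Fam.mul (fun U x => ∑ i ∈ s, φ i U x) ψ U x = ∑ i ∈ s, (φ i).mul ψ U x := by
  have : Fintype (Set U) := Fintype.ofFinite _
  simp only [Fam.mul, finsum_eq_sum_of_fintype]
  rw [Finset.sum_comm]
  refine Finset.sum_congr rfl fun A _ => ?_
  rw [← Finset.sum_mul]
  congr 1
  unfold loc
  split_ifs <;> simp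

theorem card_add_card_compl [Finite U] (A : Set U) :
    Nat.card A + Nat.card (Aᶜ : Set U) = Nat.card U := by
  rw [Nat.card_coe_set_eq, Nat.card_coe_set_eq, Set.ncard_add_ncard_compl]

/-- For each subset exactly one pair of degrees can contribute, given by the sizes of the subset and
of its complement. -/
theorem sum_grade_mul_grade [Finite U] (φ ψ : Fam Γ) (n : ℕ) (x : Str Γ U) :
    ∑ p ∈ antidiagonal n, (φ.grade p.1).mul (ψ.grade p.2) U x = (φ.mul ψ).grade n U x := by
  have : Fintype (Set U) := Fintype.ofFinite _
  simp only [Fam.mul, Fam.grade, finsum_eq_sum_of_fintype]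
  rw [Finset.sum_comm]
  have : ∀ A : Set U, ∑ p ∈ antidiagonal n, loc (φ.grade p.1) A x * loc (ψ.grade p.2) Aᶜ x =
      if Nat.card U = n then loc φ A x * loc ψ Aᶜ x else 0 := by
    intro A
    have hA := card_add_card_compl A
    simp only [loc_grade]
    split_ifs with h
    · rw [Finset.sum_eq_single (Nat.card A, Nat.card (Aᶜ : Set U))]
      · simp
      · rintro ⟨a, b⟩ - hne
        by_cases h1 : Nat.card A = a
        · by_cases h2 : Nat.card (Aᶜ : Set U) = b
          · exact absurd (by rw [h1, h2]) hne
          · rw [if_neg h2, mul_zero]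
        · rw [if_neg h1, zero_mul]
      · intro h'
        exact absurd (Finset.HasAntidiagonal.mem_antidiagonal.2 (hA.trans h)) h'
    · refine Finset.sum_eq_zero fun p hp => ?_
      have := Finset.HasAntidiagonal.mem_antidiagonal.1 hp
      by_cases h1 : Nat.card A = p.1
      · rw [if_neg (fun h2 : Nat.card (Aᶜ : Set U) = p.2 => h (by omega)), mul_zero]
      · rw [if_neg h1, zero_mul]
  have h2 := Finset.sum_congr (s₁ := Finset.univ) rfl fun (A : Set U) _ => this A
  refine h2.trans ?_
  split_ifs <;> simp

theorem sum_grade_mul_mul [Finite U] {φ ψ f : Fam Γ} (hφ : IsNat φ) (hψ : IsNat ψ)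
    (hf : IsNat f) (n : ℕ) (x : Str Γ U) :
    ∑ p ∈ antidiagonal n, (φ.grade p.1).mul ((ψ.grade p.2).mul f) U x =
      ((φ.mul ψ).grade n).mul f U x := by
  simp only [← mul_assoc_fam (hφ.grade _) (hψ.grade _) hf]
  rw [← sum_mul_fam]
  exact congrFun (mul_congr_fam (fun V _ => funext fun y => sum_grade_mul_grade φ ψ n y)
    fun _ _ => rfl) x

/-- The hypotheses say that `φ` is the unit of the product on finite sets: only the empty subset
contributes, and it lies in degree zero. -/
theorem grade_mul_of_vanish [Finite U] {φ f : Fam Γ} (hf : IsNat f)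
    (h0 : ∀ (V : Type) [Finite V] [Nonempty V] (x : Str Γ V), φ V x = 0)
    (h1 : ∀ (V : Type) [IsEmpty V] (x : Str Γ V), φ V x = 1) (n : ℕ) (x : Str Γ U) :
    (φ.grade n).mul f U x = if n = 0 then f U x else 0 := by
  unfold Fam.mul
  rw [finsum_eq_single _ (∅ : Set U)]
  · have he : x.IsInv (∅ : Set U) := fun i => by simp
    rw [loc_grade, loc_of_isInv _ he, h1, Nat.card_of_isEmpty]
    simp only [eq_comm (a := 0) (b := n)]
    split_ifs with hn
    · rw [one_mul, Set.compl_empty, loc_of_isInv _ (fun i => by simp : x.IsInv Set.univ)]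
      rw [← hf _ _ (Equiv.Set.univ U)]
      rfl
    · rw [zero_mul]
  · intro A hA
    have : Nonempty A := (Set.nonempty_iff_ne_empty.2 hA).to_subtype
    rw [loc_grade]
    have : loc φ A x = 0 := by
      unfold loc
      split_ifs
      · exact h0 _ _
      · rfl
    rw [this, ite_self, zero_mul]

variable [Group Γ]

/-- The analogue for contraction: the only contribution comes from the unique labelled permutation
of no points. -/
theorem contr_of_vanish [Finite Γ] {φ f : Fam Γ} (hf : IsNat f)
    (h0 : ∀ (V : Type) [Finite V] [Nonempty V] (x : Str Γ V), φ V x = 0)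
    (h1 : ∀ (V : Type) [IsEmpty V] (x : Str Γ V), φ V x = 1) (n : ℕ) (y : Str Γ U) :
    contr φ n f U y = if n = 0 then f U y else 0 := by
  unfold contr
  split_ifs with hn
  · subst hn
    have : Unique (Str Γ (Fin 0)) := Unique.mk' _
    rw [integral, finsum_eq_single _ default (fun x hx => absurd (Subsingleton.elim _ _) hx), h1]
    simp only [Nat.card_fin, Nat.factorial_zero, pow_zero]
    rw [← hf U (Fin 0 ⊕ U) (Equiv.emptySum (Fin 0) U).symm y]
    have : (default : Str Γ (Fin 0)).inv.sum y = y.map (Equiv.emptySum (Fin 0) U).symm := by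
      refine Prod.ext (funext fun i => ?_) (Equiv.ext fun i => ?_)
      · rcases i with i | i
        · exact i.elim0
        · rfl
      · rcases i with i | i
        · exact i.elim0
        · rfl
    rw [this]
    simp
  · have : Nonempty (Fin n) := ⟨⟨0, by omega⟩⟩
    simp [h0, integral]

theorem finsum_set_sum [Finite U] [Finite V] (G : Set (U ⊕ V) → ℂ) :
    ∑ᶠ C, G C = ∑ᶠ B : Set V, ∑ᶠ A : Set U, G (Set.sumEquiv.symm (A, B)) := by
  have : Fintype (Set U) := Fintype.ofFinite _
  have : Fintype (Set V) := Fintype.ofFinite _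
  rw [← finsum_comp_equiv (Set.sumEquiv (α := U) (β := V)).symm.toEquiv]
  simp only [finsum_eq_sum_of_fintype, Fintype.sum_prod_type_right]
  rfl

variable [Finite Γ]

/-- A Mackey formula. An invariant subset `C` of the `l` added points together with `U` has a trace
`A` on the added points and a trace `B` on `U`. Multiplicativity of `q` separates `A` from the other
added points, and multiplicativity of `q'` separates `A` from `B`. The points of `A` give the
pairing of `q` with `q'`, the set `B` keeps the remaining degree of `q'`, and the other added points
are contracted with `f`. -/
theorem contr_grade_mul [Finite U] {q q' f : Fam Γ} (hq : IsMult q) (hq' : IsMult q')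
    (hf : IsNat f) (l k : ℕ) (y : Str Γ U) :
    contr q l ((q'.grade k).mul f) U y = ∑ p ∈ antidiagonal l, if p.1 ≤ k then
      pairing q q' p.1 * ((q'.grade (k - p.1)).mul (contr q p.2 f)) U y else 0 := by
  classical
  -- With the trace `B` on `U` fixed, the integrand becomes a function of the two restrictions of
  -- `x`, as `integral_sum_decomp` requires.
  have hT : ∀ (B : Set U) (hB : y.IsInv B) (A : Set (Fin l)) (C : Set (Fin l ⊕ U)),
      Sum.inl ⁻¹' C = A → Sum.inr ⁻¹' C = B → ∀ x : Str Γ (Fin l),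
      q _ x * (loc (q'.grade k) C (x.inv.sum y) * loc f Cᶜ (x.inv.sum y)) =
        if hA : x.IsInv A then q A (x.restr A hA) * (q (Aᶜ : Set _) (x.restr Aᶜ hA.compl) *
          ((if Nat.card A + Nat.card B = k then
            q' A (x.restr A hA).inv * q' B (y.restr B hB) else 0) *
            f ((Aᶜ : Set _) ⊕ (Bᶜ : Set _)) ((x.restr Aᶜ hA.compl).inv.sum (y.restr Bᶜ hB.compl))))
        else 0 := by
    rintro B hB A C rfl rfl x
    by_cases hA : x.IsInv (Sum.inl ⁻¹' C)
    · have hA' := Str.isInv_inv.2 hA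
      have e1 : Nat.card C = Nat.card (Sum.inl ⁻¹' C : Set (Fin l)) +
          Nat.card (Sum.inr ⁻¹' C : Set U) := by
        rw [← Nat.card_sum]
        exact Nat.card_congr (Equiv.subtypeSum (p := fun c => c ∈ C))
      have e2 : loc f Cᶜ (x.inv.sum y) = f _ ((x.inv.restr _ hA'.compl).sum
        (y.restr _ hB.compl)) := loc_sum hf Cᶜ hA'.compl hB.compl
      rw [dif_pos hA, hq.eq_mul_restr hA, loc_grade, hq'.loc_sum, loc_of_isInv _ hA',
        loc_of_isInv _ hB, e1, e2, mul_assoc]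
      rfl
    · have hA' : ¬ (x.inv.sum y).IsInv C := fun h => hA (Str.isInv_inv.1 (Str.isInv_sum.1 h).1)
      rw [dif_neg hA, loc_of_not_isInv _ hA', zero_mul, mul_zero]
  have key : ∀ B : Set U, (integral (Fin l) fun x => ∑ᶠ A : Set (Fin l), q _ x *
      (loc (q'.grade k) (Set.sumEquiv.symm (A, B)) (x.inv.sum y) *
        loc f (Set.sumEquiv.symm (A, B))ᶜ (x.inv.sum y))) =
      ∑ p ∈ antidiagonal l, if p.1 ≤ k then pairing q q' p.1 *
        (loc (q'.grade (k - p.1)) B y * loc (contr q p.2 f) Bᶜ y) else 0 := by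
    intro B
    have hC : ∀ A : Set (Fin l), Sum.inl ⁻¹' (Set.sumEquiv.symm (A, B)) = A ∧
        Sum.inr ⁻¹' (Set.sumEquiv.symm (A, B)) = B := fun A => by
      constructor <;> ext i <;> simp
    by_cases hB : y.IsInv B
    · simp only [fun A => hT B hB A _ (hC A).1 (hC A).2]
      rw [integral_sum_decomp (n := l) (by simp) (fun X X' x x' => q X x * (q X' x' *
          ((if Nat.card X + Nat.card B = k then q' X x.inv * q' B (y.restr B hB) else 0) *
            f (X' ⊕ (Bᶜ : Set _)) (x'.inv.sum (y.restr Bᶜ hB.compl)))))]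
      · refine Finset.sum_congr rfl fun p hp => ?_
        rw [loc_grade, loc_of_isInv _ hB, loc_of_isInv _ hB.compl, Nat.card_fin]
        -- The degree condition is stated by addition here and by truncated subtraction in the goal;
        -- the two agree when `p.1 ≤ k`.
        by_cases h1 : p.1 + Nat.card B = k
        · have h2 : Nat.card B = k - p.1 := by omega
          rw [if_pos (by omega), if_pos h2]
          simp only [if_pos h1, pairing, contr]
          rw [← integral_mul_const]
          congr 1; funext x
          rw [← integral_const_mul, ← integral_const_mul]
          congr 1; funext x'
          ring
        · simp only [if_neg h1, zero_mul, mul_zero]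
          have h3 : ∀ n : ℕ, (integral (Fin n) fun _ : Str Γ (Fin n) => (0 : ℂ)) = 0 := fun n => by
            simp [integral]
          simp only [h3]
          split_ifs <;> first | omega | simp
      · intro X X' Y Y' e e' x x'
        have : (x'.map e').inv.sum (y.restr Bᶜ hB.compl) =
            (x'.inv.sum (y.restr Bᶜ hB.compl)).map (Equiv.sumCongr e' (Equiv.refl _)) := by
          rw [← Str.sum_map, Str.map_refl, Str.inv_map]
        rw [hq.isNat, hq.isNat, Str.inv_map, hq'.isNat, this, hf, Nat.card_congr e]
    · have h1 : ∀ (A : Set (Fin l)) (x : Str Γ (Fin l)),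
          loc (q'.grade k) (Set.sumEquiv.symm (A, B)) (x.inv.sum y) = 0 := fun A x =>
        loc_of_not_isInv _ fun h => hB (by simpa only [(hC A).2] using (Str.isInv_sum.1 h).2)
      simp only [h1, zero_mul, mul_zero, finsum_zero, loc_of_not_isInv _ hB, ite_self,
        Finset.sum_const_zero, integral]
  have hfin : Fintype (Set U) := Fintype.ofFinite _
  calc contr q l ((q'.grade k).mul f) U y
      = ∑ B : Set U, integral (Fin l) fun x => ∑ᶠ A : Set (Fin l), q _ x *
        (loc (q'.grade k) (Set.sumEquiv.symm (A, B)) (x.inv.sum y) *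
          loc f (Set.sumEquiv.symm (A, B))ᶜ (x.inv.sum y)) := by
        rw [← finsum_eq_sum_of_fintype, ← integral_finsum]
        unfold contr
        congr 1; funext x
        rw [Fam.mul, finsum_set_sum, mul_finsum]
        refine finsum_congr fun B => ?_
        rw [mul_finsum]
    _ = _ := by
        rw [Finset.sum_congr rfl fun B _ => key B, Finset.sum_comm]
        refine Finset.sum_congr rfl fun p _ => ?_
        split_ifs
        · rw [← Finset.mul_sum, Fam.mul, finsum_eq_sum_of_fintype]
        · simp

end Products
end SpinVertex

namespace SpinVertex

open Finset.HasAntidiagonal (antidiagonal)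

/-! ### Multiplicative families are determined by cycles; the sign family. -/

section Multiplicative

variable {Γ : Type*} {U V W : Type}

/-- Transitivity of the permutation. -/
def Str.IsTrans (x : Str Γ U) : Prop := ∀ i j, x.2.SameCycle i j

theorem Str.isInv_orbit (x : Str Γ U) (i : U) : x.IsInv {j | x.2.SameCycle i j} := fun _ =>
  Equiv.Perm.sameCycle_apply_right

theorem Str.isTrans_restr_orbit (x : Str Γ U) (i : U) :
    (x.restr _ (x.isInv_orbit i)).IsTrans := fun a b =>
  (Equiv.Perm.sameCycle_subtypePerm (h := x.isInv_orbit i)).2 (a.2.symm.trans b.2)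

theorem Str.IsTrans.isInv {x : Str Γ U} (hx : x.IsTrans) {A : Set U} (hA : x.IsInv A) :
    A = ∅ ∨ A = Set.univ := by
  rcases A.eq_empty_or_nonempty with h | ⟨i, hi⟩
  · exact Or.inl h
  · refine Or.inr (Set.eq_univ_of_forall fun j => ?_)
    obtain ⟨k, rfl⟩ := hx i j
    have hA' : ∀ k : ℤ, ∀ a, (x.2 ^ k) a ∈ A ↔ a ∈ A := fun k a => by
      induction k using Int.induction_on generalizing a with
      | zero => simp
      | succ k ih => rw [zpow_add_one, Equiv.Perm.mul_apply, ih, hA]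
      | pred k ih =>
        rw [zpow_sub_one, Equiv.Perm.mul_apply, ih, ← hA, ← Equiv.Perm.mul_apply, mul_inv_cancel,
          Equiv.Perm.one_apply]
    exact (hA' k i).2 hi

/-- Multiplicative families that agree on cycles agree. -/
theorem IsMult.ext {φ ψ : Fam Γ} (hφ : IsMult φ) (hψ : IsMult ψ)
    (h : ∀ (V : Type) [Finite V] [Nonempty V] (x : Str Γ V), x.IsTrans → φ V x = ψ V x)
    [Finite U] (x : Str Γ U) : φ U x = ψ U x := by
  induction hn : Nat.card U using Nat.strong_induction_on generalizing U with
  | _ n ih =>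
    rcases isEmpty_or_nonempty U with hU | ⟨⟨i⟩⟩
    · rw [hφ.empty, hψ.empty]
    · have hC := x.isInv_orbit i
      have hne : Nonempty ({j | x.2.SameCycle i j} : Set U) :=
        ⟨⟨i, Equiv.Perm.SameCycle.refl _ _⟩⟩
      have hc := card_add_card_compl ({j | x.2.SameCycle i j} : Set U)
      have hpos : 0 < Nat.card ({j | x.2.SameCycle i j} : Set U) := Nat.card_pos
      rw [hφ.eq_mul_restr hC, hψ.eq_mul_restr hC, h _ _ (x.isTrans_restr_orbit i),
        ih _ (by omega) _ rfl]

/-- A multiplicative family that vanishes on cycles vanishes on nonempty sets. -/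
theorem IsMult.eq_zero {φ : Fam Γ} (hφ : IsMult φ)
    (h : ∀ (V : Type) [Finite V] [Nonempty V] (x : Str Γ V), x.IsTrans → φ V x = 0)
    [Finite U] [hU : Nonempty U] (x : Str Γ U) : φ U x = 0 := by
  obtain ⟨i⟩ := hU
  have hne : Nonempty ({j | x.2.SameCycle i j} : Set U) := ⟨⟨i, Equiv.Perm.SameCycle.refl _ _⟩⟩
  rw [hφ.eq_mul_restr (x.isInv_orbit i), h _ _ (x.isTrans_restr_orbit i), zero_mul]

/-- A subset of a disjoint union is a pair of subsets, so the sum over decompositions factorizes. -/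
theorem IsMult.mul {φ ψ : Fam Γ} (hφ : IsMult φ) (hψ : IsMult ψ) : IsMult (φ.mul ψ) where
  isNat := hφ.isNat.mul hψ.isNat
  sum U V _ _ x y := by
    have : Fintype (Set U) := Fintype.ofFinite _
    have : Fintype (Set V) := Fintype.ofFinite _
    have : Fintype (Set (U ⊕ V)) := Fintype.ofFinite _
    simp only [Fam.mul, finsum_eq_sum_of_fintype]
    rw [Fintype.sum_mul_sum, ← Fintype.sum_prod_type']
    refine Fintype.sum_equiv Set.sumEquiv.toEquiv _ _ fun C => ?_
    rw [hφ.loc_sum, hψ.loc_sum]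
    change _ = loc φ (Sum.inl ⁻¹' C) x * loc ψ (Sum.inl ⁻¹' C)ᶜ x *
      (loc φ (Sum.inr ⁻¹' C) y * loc ψ (Sum.inr ⁻¹' C)ᶜ y)
    rw [Set.preimage_compl, Set.preimage_compl]
    ring
  empty U _ x := by
    unfold Fam.mul
    have h : ∀ A : Set U, x.IsInv A := fun A i => isEmptyElim i
    rw [finsum_eq_single _ (∅ : Set U) (fun A hA => absurd (Subsingleton.elim A ∅) hA),
      loc_of_isInv _ (h _), loc_of_isInv _ (h _), hφ.empty, hψ.empty, one_mul]

theorem loc_empty {φ : Fam Γ} (hφ : IsMult φ) (x : Str Γ U) : loc φ ∅ x = 1 := by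
  rw [loc_of_isInv _ (fun i => by simp), hφ.empty]

theorem loc_univ {φ : Fam Γ} (hφ : IsNat φ) (x : Str Γ U) : loc φ Set.univ x = φ U x := by
  rw [loc_of_isInv _ (fun i => by simp), ← hφ _ _ (Equiv.Set.univ U)]
  rfl

/-- A transitive permutation has only the two trivial invariant subsets, so at cycles the product of
families is addition. -/
theorem IsMult.mul_of_isTrans {φ ψ : Fam Γ} (hφ : IsMult φ) (hψ : IsMult ψ) [Finite U]
    [Nonempty U] {x : Str Γ U} (hx : x.IsTrans) : φ.mul ψ U x = φ U x + ψ U x := by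
  classical
  have : Fintype (Set U) := Fintype.ofFinite _
  rw [Fam.mul, finsum_eq_sum_of_fintype,
    Finset.sum_eq_add_of_mem (∅ : Set U) Set.univ (Finset.mem_univ _) (Finset.mem_univ _)
      Set.empty_ne_univ]
  · rw [Set.compl_empty, Set.compl_univ, loc_empty hφ, loc_univ hφ.isNat, loc_empty hψ,
      loc_univ hψ.isNat]
    ring
  · rintro A - ⟨h1, h2⟩
    have : ¬ x.IsInv A := fun h => (hx.isInv h).elim h1 h2
    rw [loc_of_not_isInv _ this, zero_mul]

open Classical in
/-- The sign of the permutation. -/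
noncomputable def signFam (Γ : Type*) : Fam Γ := fun U x =>
  if _h : Finite U then
    letI := Fintype.ofFinite U
    ((Equiv.Perm.sign x.2 : ℤ) : ℂ)
  else 0

theorem signFam_eq [Fintype U] [DecidableEq U] (x : Str Γ U) :
    signFam Γ U x = ((Equiv.Perm.sign x.2 : ℤ) : ℂ) := by
  unfold signFam
  rw [dif_pos (inferInstance : Finite U)]
  congr!

theorem signFam_isMult (Γ : Type*) : IsMult (signFam Γ) where
  isNat U V e x := by
    classical
    by_cases h : Finite U
    · have := Fintype.ofFinite U
      have := Fintype.ofEquiv U e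
      rw [signFam_eq, signFam_eq]
      simp [Str.map]
    · have h' : ¬ Finite V := fun h' => h (Finite.of_equiv V e.symm)
      rw [signFam, signFam, dif_neg h, dif_neg h']
  sum U V _ _ x y := by
    classical
    have := Fintype.ofFinite U
    have := Fintype.ofFinite V
    rw [signFam_eq, signFam_eq, signFam_eq]
    have : (x.sum y).2 = Equiv.Perm.sumCongr x.2 y.2 := rfl
    rw [this, Equiv.Perm.sign_sumCongr]
    push_cast
    ring
  empty U _ x := by
    classical
    have := Fintype.ofFinite U
    rw [signFam_eq, Subsingleton.elim x.2 1]
    simp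

/-- The constant family. -/
theorem one_isMult (Γ : Type*) : IsMult (fun _ _ => 1 : Fam Γ) where
  isNat _ _ _ _ := rfl
  sum _ _ _ _ _ _ := (one_mul 1).symm
  empty _ _ _ := rfl

theorem Str.IsTrans.isCycle [Fintype U] [DecidableEq U] {x : Str Γ U} (hx : x.IsTrans)
    (h : 1 < Fintype.card U) : x.2.IsCycle ∧ x.2.support = Finset.univ := by
  have hne : ∀ i, x.2 i ≠ i := by
    intro i hi
    have : ∀ j, j = i := fun j => by
      obtain ⟨k, rfl⟩ := hx i j
      exact Equiv.Perm.zpow_apply_eq_self_of_apply_eq_self hi k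
    have := Fintype.card_le_one_iff.2 fun a b => (this a).trans (this b).symm
    omega
  obtain ⟨i⟩ : Nonempty U := Fintype.card_pos_iff.1 (by omega)
  refine ⟨⟨i, hne i, fun j _ => hx i j⟩, Finset.eq_univ_of_forall fun j => ?_⟩
  rw [Equiv.Perm.mem_support]
  exact hne j

/-- The one-point case is included: there the permutation is the identity, which is transitive but
not a cycle in the sense of `IsCycle`. -/
theorem signFam_of_isTrans [Finite U] [Nonempty U] {x : Str Γ U} (hx : x.IsTrans) :
    signFam Γ U x = -(-1) ^ Nat.card U := by
  classical
  have := Fintype.ofFinite U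
  rw [signFam_eq, Nat.card_eq_fintype_card]
  rcases Nat.lt_or_ge 1 (Fintype.card U) with h | h
  · obtain ⟨h1, h2⟩ := hx.isCycle h
    rw [h1.sign, h2, Finset.card_univ]
    simp
  · have h1 : Fintype.card U = 1 := le_antisymm h Fintype.card_pos
    have : Subsingleton U := Fintype.card_le_one_iff_subsingleton.1 h
    rw [Subsingleton.elim x.2 1, h1]
    simp

theorem orderOf_of_isTrans [Finite U] [Nonempty U] {x : Str Γ U} (hx : x.IsTrans) :
    orderOf x.2 = Nat.card U := by
  classical
  have := Fintype.ofFinite U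
  rw [Nat.card_eq_fintype_card]
  rcases Nat.lt_or_ge 1 (Fintype.card U) with h | h
  · obtain ⟨h1, h2⟩ := hx.isCycle h
    rw [h1.orderOf, h2, Finset.card_univ]
  · have h1 : Fintype.card U = 1 := le_antisymm h Fintype.card_pos
    have : Subsingleton U := Fintype.card_le_one_iff_subsingleton.1 h
    rw [Subsingleton.elim x.2 1, h1, orderOf_one]

variable [Finite Γ] [Nonempty Γ]

theorem integral_one (n : ℕ) : (integral (Fin n) fun _ : Str Γ (Fin n) => (1 : ℂ)) = 1 := by
  classical
  have := Fintype.ofFinite Γ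
  have h := sum_eq_integral (Γ := Γ) (U := Fin n) (fun _ => 1)
  have h1 : ((n.factorial : ℂ)) ≠ 0 := by exact_mod_cast (Nat.factorial_ne_zero _)
  have h2 : (Nat.card Γ : ℂ) ≠ 0 := by exact_mod_cast Nat.card_pos.ne'
  simp only [Finset.sum_const, Finset.card_univ, Fintype.card_prod, Fintype.card_fun,
    Fintype.card_perm, Fintype.card_fin, Nat.card_fin, nsmul_eq_mul, mul_one,
    ← Nat.card_eq_fintype_card (α := Γ)] at h
  refine mul_left_cancel₀ (mul_ne_zero h1 (pow_ne_zero n h2)) ?_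
  rw [← h]
  push_cast
  ring

/-- From two points on, multiplication by a transposition negates the sum. -/
theorem integral_signFam (n : ℕ) : integral (Fin n) (signFam Γ (Fin n)) = if n ≤ 1 then 1 else 0 := by
  classical
  have := Fintype.ofFinite Γ
  split_ifs with h
  · rw [← integral_one (Γ := Γ) n]
    congr 1; funext x
    have : Subsingleton (Fin n) := Fin.subsingleton_iff_le_one.2 h
    rw [signFam_eq, Subsingleton.elim x.2 1]
    simp
  · rw [integral, finsum_eq_sum_of_fintype]
    have h1 : ∑ x : Str Γ (Fin n), signFam Γ (Fin n) x = -∑ x : Str Γ (Fin n), signFam Γ (Fin n) x := by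
      rw [← Finset.sum_neg_distrib]
      refine Fintype.sum_equiv (Equiv.prodCongr (Equiv.refl _)
        (Equiv.mulLeft (Equiv.swap (⟨0, by omega⟩ : Fin n) ⟨1, by omega⟩))) _ _ fun x => ?_
      rw [signFam_eq, signFam_eq]
      simp
    rw [self_eq_neg.1 h1, mul_zero]

/-- The average of a product is the convolution of the averages. The sign contributes 1 + t and the
constant family 1/(1 - t), so these are the coefficients of (1 + t)/(1 - t). -/
theorem integral_sign_mul_one (n : ℕ) :
    integral (Fin n) ((signFam Γ).mul (fun _ _ => 1) (Fin n)) = if n = 0 then 1 else 2 := by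
  classical
  have h := integral_sum_decomp (Γ := Γ) (U := Fin n) (n := n) (by simp)
    (fun A B x _ => signFam Γ A x) (fun A B A' B' e e' x x' => (signFam_isMult Γ).isNat _ _ _ _)
  have e : (fun x : Str Γ (Fin n) => ∑ᶠ A : Set (Fin n),
      if h : x.IsInv A then signFam Γ A (x.restr A h) else 0) =
      (signFam Γ).mul (fun _ _ => 1) (Fin n) := by
    funext x
    unfold Fam.mul
    refine finsum_congr fun A => ?_
    by_cases hA : x.IsInv A
    · rw [dif_pos hA, loc_of_isInv _ hA, loc_of_isInv _ hA.compl, mul_one]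
    · rw [dif_neg hA, loc_of_not_isInv _ hA, zero_mul]
  rw [← e, h]
  have h2 : ∀ p : ℕ × ℕ, (integral (Fin p.1) fun x => integral (Fin p.2) fun _ : Str Γ (Fin p.2) =>
      signFam Γ (Fin p.1) x) = if p.1 ≤ 1 then 1 else 0 := fun p => by
    have := fun x : Str Γ (Fin p.1) => integral_const_mul (Γ := Γ) (U := Fin p.2)
      (signFam Γ (Fin p.1) x) (fun _ => 1)
    simp only [mul_one, integral_one] at this
    simp only [this]
    exact integral_signFam p.1
  simp only [h2]
  rw [Finset.Nat.sum_antidiagonal_eq_sum_range_succ_mk]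
  rcases n with _ | n
  · rw [Finset.sum_range_one, if_pos zero_le_one, if_pos rfl]
  · rw [if_neg (Nat.succ_ne_zero n), Finset.sum_range_succ', Finset.sum_range_succ',
      Finset.sum_eq_zero fun k _ => if_neg (by omega)]
    norm_num

end Multiplicative
end SpinVertex

namespace SpinVertex

/-! ## Lifts of odd order -/

section OddLift

theorem parity_eq_one_of_odd {G : Type*} [Group G] (d : G →* Multiplicative (ZMod 2)) {x : G}
    (hx : Odd (orderOf x)) : d x = 1 := by
  obtain ⟨k, hk⟩ := hx
  have h1 : d x ^ (2 * k + 1) = 1 := by rw [← hk, ← map_pow, pow_orderOf_eq_one, map_one]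
  have h2 : d x ^ 2 = 1 := by
    rcases mult_zmod_two (d x) with h | h <;> rw [h] <;> decide
  rwa [pow_succ, pow_mul, h2, one_pow, one_mul] at h1

theorem odd_orderOf_of_pow {G : Type*} [Group G] {x : G} {m : ℕ} (hm : Odd m) (h : x ^ m = 1) :
    Odd (orderOf x) := Odd.of_dvd_nat hm (orderOf_dvd_of_pow_eq_one h)

theorem odd_orderOf_map {G H : Type*} [Group G] [Group H] (f : G →* H) {x : G}
    (hx : Odd (orderOf x)) : Odd (orderOf (f x)) := Odd.of_dvd_nat hx (orderOf_map_dvd f x)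

theorem Commute.odd_orderOf_mul {G : Type*} [Group G] {x y : G} (h : Commute x y)
    (hx : Odd (orderOf x)) (hy : Odd (orderOf y)) : Odd (orderOf (x * y)) := by
  refine odd_orderOf_of_pow (hx.mul hy) ?_
  rw [h.mul_pow, pow_mul, pow_orderOf_eq_one, one_pow, mul_comm (orderOf x), pow_mul,
    pow_orderOf_eq_one, one_pow, one_mul]

theorem SpinSym.eq_or_eq_z_mul {n : ℕ} {x y : SpinSym n} (h : toPerm n x = toPerm n y) :
    x = y ∨ x = z n * y := by
  have : toPerm n (x * y⁻¹) = 1 := by rw [map_mul, map_inv, h, mul_inv_cancel]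
  rcases toPerm_eq_one this with e | e
  · exact Or.inl (mul_inv_eq_one.1 e)
  · exact Or.inr (mul_inv_eq_iff_eq_mul.1 e)

theorem SpinSym.z_pow_odd {n m : ℕ} (hm : Odd m) : z n ^ m = z n := by
  obtain ⟨k, rfl⟩ := hm
  rw [pow_succ, pow_mul, sq, z_mul_z, one_pow, one_mul]

/-- Two lifts differ at most by `z`. If `x = z y` with both orders odd, raising to the product of
the orders would give `z = 1`. -/
theorem SpinSym.eq_of_odd {n : ℕ} {x y : SpinSym n} (hx : Odd (orderOf x)) (hy : Odd (orderOf y))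
    (h : toPerm n x = toPerm n y) : x = y := by
  rcases eq_or_eq_z_mul h with e | e
  · exact e
  · exfalso
    have h1 : x ^ (orderOf x * orderOf y) = 1 := by rw [pow_mul, pow_orderOf_eq_one, one_pow]
    rw [e, (show Commute (z n) y from z_comm y).mul_pow, ← e, z_pow_odd (hx.mul hy), mul_comm (orderOf x),
      pow_mul, pow_orderOf_eq_one, one_pow, mul_one] at h1
    exact z_ne_one n h1

/-- If `m` is the odd order of the permutation, a lift has `m`-th power 1 or `z`; in the second case
the other lift works, since an odd power of `z` is `z`. -/
theorem SpinSym.exists_odd_lift {n : ℕ} {σ : Equiv.Perm (Fin n)} (hσ : Odd (orderOf σ)) :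
    ∃ x, toPerm n x = σ ∧ Odd (orderOf x) := by
  obtain ⟨y, rfl⟩ := toPerm_surjective n σ
  have h1 : toPerm n (y ^ orderOf (toPerm n y)) = 1 := by rw [map_pow, pow_orderOf_eq_one]
  rcases toPerm_eq_one h1 with e | e
  · exact ⟨y, rfl, odd_orderOf_of_pow hσ e⟩
  · refine ⟨z n * y, by rw [map_mul, toPerm_z, one_mul], odd_orderOf_of_pow hσ ?_⟩
    rw [(show Commute (z n) y from z_comm y).mul_pow, e, z_pow_odd hσ, z_mul_z]

open Classical in
/-- The lift of odd order of a permutation of odd order. -/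
noncomputable def SpinSym.oddLift {n : ℕ} (σ : Equiv.Perm (Fin n)) : SpinSym n :=
  if h : Odd (orderOf σ) then (exists_odd_lift h).choose else 1

theorem SpinSym.oddLift_spec {n : ℕ} {σ : Equiv.Perm (Fin n)} (h : Odd (orderOf σ)) :
    toPerm n (oddLift σ) = σ ∧ Odd (orderOf (oddLift σ)) := by
  rw [oddLift, dif_pos h]
  exact (exists_odd_lift h).choose_spec

theorem SpinSym.oddLift_toPerm {n : ℕ} {x : SpinSym n} (h : Odd (orderOf x)) :
    oddLift (toPerm n x) = x := by
  have := oddLift_spec (odd_orderOf_map (toPerm n) h)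
  exact eq_of_odd this.2 h this.1

variable {Γ : Type*} [Group Γ] {n k N : ℕ}

/-- The labelled permutation under an element of the spin wreath product. -/
def SpinWreath.toStr (w : SpinWreath Γ n) : Str Γ (Fin n) :=
  (w.left, SpinSym.toPerm n w.right)

theorem SpinWreath.exists_toStr (x : Str Γ (Fin n)) : ∃ w : SpinWreath Γ n, w.toStr = x := by
  obtain ⟨y, hy⟩ := SpinSym.toPerm_surjective n x.2
  exact ⟨⟨x.1, y⟩, Prod.ext rfl hy⟩

theorem SpinWreath.exists_odd_toStr {x : Str Γ (Fin n)} (h : Odd (orderOf x.2)) :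
    ∃ w : SpinWreath Γ n, w.toStr = x ∧ Odd (orderOf w.right) :=
  ⟨⟨x.1, SpinSym.oddLift x.2⟩, Prod.ext rfl (SpinSym.oddLift_spec h).1, (SpinSym.oddLift_spec h).2⟩

theorem SpinWreath.toStr_z_mul (w : SpinWreath Γ n) : (z Γ n * w).toStr = w.toStr := by
  refine Prod.ext ?_ ?_
  · simp [toStr, z, spinAction_z]
  · simp [toStr, z, SpinSym.toPerm_z]

theorem SpinWreath.eq_or_eq_z_mul {w w' : SpinWreath Γ n} (h : w.toStr = w'.toStr) :
    w = w' ∨ w = z Γ n * w' := by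
  rcases SpinSym.eq_or_eq_z_mul (congrArg Prod.snd h) with e | e
  · exact Or.inl (SemidirectProduct.ext (congrArg Prod.fst h) e)
  · refine Or.inr (SemidirectProduct.ext ?_ e)
    rw [show w.left = w'.left from congrArg Prod.fst h]
    simp [z, spinAction_z]

theorem SpinWreath.eq_of_odd {w w' : SpinWreath Γ n} (hw : Odd (orderOf w.right))
    (hw' : Odd (orderOf w'.right)) (h : w.toStr = w'.toStr) : w = w' :=
  SemidirectProduct.ext (congrArg Prod.fst h) (SpinSym.eq_of_odd hw hw' (congrArg Prod.snd h))

theorem SpinWreath.toStr_conj (t : SpinSym n) (w : SpinWreath Γ n) :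
    (SemidirectProduct.inr t * w * (SemidirectProduct.inr t)⁻¹ : SpinWreath Γ n).toStr =
      w.toStr.map (SpinSym.toPerm n t) := by
  refine Prod.ext (funext fun i => ?_) ?_
  · simp [toStr, Str.map, spinAction_apply]
  · refine Equiv.ext fun i => ?_
    simp [toStr, Str.map]

open Classical in
/-- The function on labelled permutations whose value is that of `f` at the lift of odd order. -/
noncomputable def transfer (f : RMinus Γ n) (x : Str Γ (Fin n)) : ℂ :=
  if Odd (orderOf x.2) then f.1 ⟨x.1, SpinSym.oddLift x.2⟩ else 0

theorem transfer_toStr (f : RMinus Γ n) {w : SpinWreath Γ n} (h : Odd (orderOf w.right)) :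
    transfer f w.toStr = f.1 w := by
  rw [transfer, if_pos (show Odd (orderOf w.toStr.2) from odd_orderOf_map (SpinSym.toPerm n) h)]
  change f.1 ⟨w.left, SpinSym.oddLift (SpinSym.toPerm n w.right)⟩ = _
  rw [SpinSym.oddLift_toPerm h]

theorem transfer_of_not_odd (f : RMinus Γ n) {x : Str Γ (Fin n)} (h : ¬ Odd (orderOf x.2)) :
    transfer f x = 0 := if_neg h

theorem orderOf_permCongr {U V : Type} (e : U ≃ V) (σ : Equiv.Perm U) :
    orderOf (e.permCongr σ) = orderOf σ :=
  MulEquiv.orderOf_eq e.permCongrHom σ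

/-- Relabelling is conjugation by a lift of the relabelling permutation, and conjugation preserves
the oddness of the order. -/
theorem transfer_map (f : RMinus Γ n) (τ : Equiv.Perm (Fin n)) (x : Str Γ (Fin n)) :
    transfer f (x.map τ) = transfer f x := by
  by_cases h : Odd (orderOf x.2)
  · obtain ⟨w, rfl, hw⟩ := SpinWreath.exists_odd_toStr h
    obtain ⟨t, rfl⟩ := SpinSym.toPerm_surjective n τ
    rw [← SpinWreath.toStr_conj, transfer_toStr f hw, transfer_toStr, f.2.1]
    have : (SemidirectProduct.inr t * w * (SemidirectProduct.inr t)⁻¹ : SpinWreath Γ n).right =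
      t * w.right * t⁻¹ := by simp
    rw [this]
    rwa [← MulAut.conj_apply, MulEquiv.orderOf_eq]
  · rw [transfer_of_not_odd f h, transfer_of_not_odd]
    rwa [Str.map, orderOf_permCongr]

open Classical in
/-- The class function on labelled permutations given by a sequence of spin super class functions. -/
noncomputable def hat (f : ∀ n, RMinus Γ n) : Fam Γ := fun U x =>
  if _h : Finite U then transfer (f (Nat.card U)) (x.map (Finite.equivFin U)) else 0

/-- By `transfer_map` the enumeration chosen in the definition does not matter. -/
theorem hat_eq (f : ∀ n, RMinus Γ n) {U : Type} (e : U ≃ Fin n) (x : Str Γ U) :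
    hat f U x = transfer (f n) (x.map e) := by
  have : Finite U := Finite.of_equiv _ e.symm
  obtain rfl : Nat.card U = n := by rw [Nat.card_congr e, Nat.card_fin]
  rw [hat, dif_pos this, ← transfer_map _ ((Finite.equivFin U).symm.trans e), Str.map_map]
  congr 2
  ext i; simp

theorem hat_fin (f : ∀ n, RMinus Γ n) (x : Str Γ (Fin n)) :
    hat f (Fin n) x = transfer (f n) x := hat_eq f (Equiv.refl _) x

theorem hat_isNat (f : ∀ n, RMinus Γ n) : IsNat (hat f) := by
  intro U V e x
  by_cases h : Finite V
  · rw [hat_eq f (Finite.equivFin V), hat_eq f (e.trans (Finite.equivFin V)), Str.map_map]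
  · have h' : ¬ Finite U := fun h' => h (Finite.of_equiv U e)
    rw [hat, hat, dif_neg h, dif_neg h']

theorem hat_of_not_odd (f : ∀ n, RMinus Γ n) {U : Type} {x : Str Γ U}
    (h : ¬ Odd (orderOf x.2)) : hat f U x = 0 := by
  unfold hat
  split_ifs
  · refine transfer_of_not_odd _ ?_
    rwa [Str.map, orderOf_permCongr]
  · rfl

theorem hat_add (f g : ∀ n, RMinus Γ n) (U : Type) (x : Str Γ U) :
    hat (fun n => f n + g n) U x = hat f U x + hat g U x := by
  unfold hat transfer
  split_ifs <;> simp

theorem hat_smul (c : ℂ) (f : ∀ n, RMinus Γ n) (U : Type) (x : Str Γ U) :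
    hat (fun n => c • f n) U x = c * hat f U x := by
  unfold hat transfer
  split_ifs <;> simp

theorem hat_single (u : ∀ n, RMinus Γ n) (k : ℕ) {U : Type} [Finite U] (x : Str Γ U) :
    hat (fun n => (DirectSum.lof ℂ ℕ (fun j => RMinus Γ j) k (u k)) n) U x =
      (hat u).grade k U x := by
  rw [hat_eq _ (Finite.equivFin U), Fam.grade, hat_eq _ (Finite.equivFin U)]
  split_ifs with h
  · subst h
    rw [DirectSum.lof_apply]
  · have : (DirectSum.lof ℂ ℕ (fun j => RMinus Γ j) k (u k)) (Nat.card U) = 0 :=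
      DirectSum.of_eq_of_ne _ _ _ h
    rw [this]
    simp [transfer]

end OddLift
end SpinVertex

namespace SpinVertex

/-! ### Block products, and vanishing at permutations of even order. -/

section Blocks

variable {Γ : Type*} {U V : Type}

theorem Str.isInv_range_inl (x : Str Γ U) (y : Str Γ V) :
    (x.sum y).IsInv (Set.range Sum.inl) := fun i => by
  rcases i with i | i <;> simp [Str.sum]

theorem loc_range_inl {φ : Fam Γ} (hφ : IsNat φ) (x : Str Γ U) (y : Str Γ V) :
    loc φ (Set.range Sum.inl) (x.sum y) = φ U x := by
  rw [loc_of_isInv _ (x.isInv_range_inl y)]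
  rw [← hφ _ _ (Equiv.ofInjective _ Sum.inl_injective).symm]
  congr 1
  refine Prod.ext (funext fun i => rfl) (Equiv.ext fun i => ?_)
  simp only [Str.map, Equiv.permCongr_apply, Equiv.symm_symm]
  rw [Equiv.symm_apply_eq]
  rfl

theorem loc_range_inr {φ : Fam Γ} (hφ : IsNat φ) (x : Str Γ U) (y : Str Γ V) :
    loc φ (Set.range (Sum.inl : U → U ⊕ V))ᶜ (x.sum y) = φ V y := by
  rw [Set.compl_range_inl]
  have h : (x.sum y).IsInv (Set.range Sum.inr) := fun i => by
    rcases i with i | i <;> simp [Str.sum]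
  rw [loc_of_isInv _ h]
  rw [← hφ _ _ (Equiv.ofInjective _ Sum.inr_injective).symm]
  congr 1
  refine Prod.ext (funext fun i => rfl) (Equiv.ext fun i => ?_)
  simp only [Str.map, Equiv.permCongr_apply, Equiv.symm_symm]
  rw [Equiv.symm_apply_eq]
  rfl

theorem Str.exists_eq_sum [Finite U] [Finite V] {x : Str Γ (U ⊕ V)}
    (h : x.IsInv (Set.range Sum.inl)) : ∃ (y : Str Γ U) (y' : Str Γ V), x = y.sum y' := by
  have h' : x.2 ∈ (Equiv.Perm.sumCongrHom U V).range :=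
    Equiv.Perm.mem_sumCongrHom_range_of_perm_mapsTo_inl fun i hi => (h i).2 hi
  obtain ⟨⟨σ, τ⟩, hσ⟩ := h'
  refine ⟨(x.1 ∘ Sum.inl, σ), (x.1 ∘ Sum.inr, τ), Prod.ext ?_ hσ.symm⟩
  funext i
  rcases i with i | i <;> rfl

theorem odd_orderOf_sum_iff (x : Str Γ U) (y : Str Γ V) :
    Odd (orderOf (x.sum y).2) ↔ Odd (orderOf x.2) ∧ Odd (orderOf y.2) := by
  have e : (x.sum y).2 = Equiv.Perm.sumCongrHom U V (x.2, y.2) := rfl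
  rw [e, orderOf_injective _ Equiv.Perm.sumCongrHom_injective, Prod.orderOf]
  constructor
  · intro h
    exact ⟨Odd.of_dvd_nat h (Nat.dvd_lcm_left _ _), Odd.of_dvd_nat h (Nat.dvd_lcm_right _ _)⟩
  · rintro ⟨h1, h2⟩
    exact Odd.of_dvd_nat (h1.mul h2) (Nat.lcm_dvd_mul _ _)

theorem Str.restr_pow_apply {A : Set U} {x : Str Γ U} (h : x.IsInv A) (m : ℕ) (i : A) :
    (((x.restr A h).2 ^ m) i : U) = (x.2 ^ m) i := by
  induction m generalizing i with
  | zero => rfl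
  | succ m ih =>
    rw [pow_succ, pow_succ, Equiv.Perm.mul_apply, Equiv.Perm.mul_apply, ih]
    rfl

/-- An orbit of even size is a cycle of sign -1. If all orbits had odd size, the permutation would
have odd order. -/
theorem Str.exists_sign_eq_neg_one [Finite U] {x : Str Γ U} (hx : ¬ Odd (orderOf x.2)) :
    ∃ (A : Set U) (h : x.IsInv A), signFam Γ A (x.restr A h) = -1 := by
  by_contra! hcon
  apply hx
  have hodd : ∀ i, Odd (Nat.card ({j | x.2.SameCycle i j} : Set U)) := by
    intro i
    have hne : Nonempty ({j | x.2.SameCycle i j} : Set U) :=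
      ⟨⟨i, Equiv.Perm.SameCycle.refl _ _⟩⟩
    by_contra h
    refine hcon _ (x.isInv_orbit i) ?_
    rw [signFam_of_isTrans (x.isTrans_restr_orbit i), (Nat.not_odd_iff_even.1 h).neg_one_pow]
  have := Fintype.ofFinite U
  -- The product of the orbit sizes over all points is odd and a multiple of every cycle length.
  refine odd_orderOf_of_pow (m := ∏ i : U, Nat.card ({j | x.2.SameCycle i j} : Set U))
    (Finset.prod_induction _ Odd (fun _ _ => Odd.mul) odd_one fun i _ => hodd i) ?_
  ext1 i
  have hne : Nonempty ({j | x.2.SameCycle i j} : Set U) :=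
    ⟨⟨i, Equiv.Perm.SameCycle.refl _ _⟩⟩
  have h1 := orderOf_of_isTrans (x.isTrans_restr_orbit i)
  have h2 := pow_orderOf_eq_one (x.restr _ (x.isInv_orbit i)).2
  rw [h1] at h2
  obtain ⟨c, hc⟩ := Finset.dvd_prod_of_mem
    (fun i => Nat.card ({j | x.2.SameCycle i j} : Set U)) (Finset.mem_univ i)
  have h3 : (x.restr _ (x.isInv_orbit i)).2 ^
      (∏ i : U, Nat.card ({j | x.2.SameCycle i j} : Set U)) = 1 := by
    rw [hc, pow_mul, h2, one_pow]
  have h4 := congrArg Subtype.val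
    (DFunLike.congr_fun h3 ⟨i, Equiv.Perm.SameCycle.refl _ _⟩)
  rw [Str.restr_pow_apply] at h4
  exact h4

variable [Group Γ] {n k N : ℕ} (h : n + k = N)

/-- The bijection of positions that underlies the two block embeddings. -/
def blockEquiv : Fin n ⊕ Fin k ≃ Fin N := finSumFinEquiv.trans (finCongr h)

theorem blockEquiv_inl (i : Fin n) : blockEquiv h (Sum.inl i) = posEmb (o := 0) (by omega) i :=
  Fin.ext (by simp [blockEquiv, posEmb])

theorem blockEquiv_inr (i : Fin k) : blockEquiv h (Sum.inr i) = posEmb (o := n) (by omega) i :=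
  Fin.ext (by simp [blockEquiv, posEmb]; rfl)

namespace SpinWreath

theorem toStr_embL_mul_embR (a : SpinWreath Γ n) (b : SpinWreath Γ k) :
    (embL h a * embR h b).toStr = (a.toStr.sum b.toStr).map (blockEquiv h) := by
  have hL : 0 + n ≤ N := by omega
  have hR : n + k ≤ N := by omega
  have e1 : spinAction Γ N (embL h a).right (embR h b).left = (embR h b).left :=
    spinAction_shift_of_disjoint _ _ _ fun i hi =>
      Function.extend_apply' _ _ _ fun hi' => not_mem_both h hi hi'
  refine Prod.ext (funext fun i => ?_) (Equiv.ext fun i => ?_)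
  · obtain ⟨i, rfl⟩ := (blockEquiv h).surjective i
    change ((embL h a).left * spinAction Γ N (embL h a).right (embR h b).left) _ =
      (Sum.elim a.left b.left ∘ (blockEquiv h).symm) _
    rw [e1, Pi.mul_apply, Function.comp_apply, Equiv.symm_apply_apply]
    change Function.extend (posEmb hL) a.left 1 _ * Function.extend (posEmb hR) b.left 1 _ = _
    rcases i with i | i
    · rw [blockEquiv_inl, (posEmb hL).injective.extend_apply, Function.extend_apply' _ _ _
        fun hi => not_mem_both h ⟨i, rfl⟩ hi, Pi.one_apply, mul_one]
      rfl
    · rw [blockEquiv_inr, (posEmb hR).injective.extend_apply, Function.extend_apply' _ _ _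
        fun hi => not_mem_both h hi ⟨i, rfl⟩, Pi.one_apply, one_mul]
      rfl
  · obtain ⟨i, rfl⟩ := (blockEquiv h).surjective i
    change SpinSym.toPerm N (SpinSym.shift hL a.right * SpinSym.shift hR b.right) _ = blockEquiv h
      (Equiv.sumCongr (SpinSym.toPerm n a.right) (SpinSym.toPerm k b.right)
        ((blockEquiv h).symm (blockEquiv h i)))
    rw [map_mul, SpinSym.toPerm_shift, SpinSym.toPerm_shift, Equiv.Perm.mul_apply,
      Equiv.symm_apply_apply]
    rcases i with i | i
    · rw [blockEquiv_inl, Equiv.Perm.viaEmbedding_apply_of_notMem _ _ _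
        fun hi => not_mem_both h ⟨i, rfl⟩ hi, Equiv.Perm.viaEmbedding_apply]
      exact (blockEquiv_inl h _).symm
    · rw [blockEquiv_inr, Equiv.Perm.viaEmbedding_apply, Equiv.Perm.viaEmbedding_apply_of_notMem
        _ _ _ fun hi => not_mem_both h hi ⟨_, rfl⟩]
      exact (blockEquiv_inr h _).symm

theorem right_embL (a : SpinWreath Γ n) :
    (embL h a).right = SpinSym.shift (o := 0) (by omega) a.right := rfl

theorem right_embR (b : SpinWreath Γ k) :
    (embR h b).right = SpinSym.shift (o := n) (by omega) b.right := rfl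

/-- Elements of odd order are even, so the blocks commute without sign. Hence the product of two odd
lifts is again the odd lift. -/
theorem odd_embL_mul_embR {a : SpinWreath Γ n} {b : SpinWreath Γ k} (ha : Odd (orderOf a.right))
    (hb : Odd (orderOf b.right)) : Odd (orderOf (embL h a * embR h b).right) := by
  rw [SemidirectProduct.mul_right, right_embL, right_embR]
  refine Commute.odd_orderOf_mul ?_ (odd_orderOf_map _ ha) (odd_orderOf_map _ hb)
  have := SpinSym.shift_mul_shift h a.right b.right
  rw [parity_eq_one_of_odd (SpinSym.parity n) ha, SpinSym.zPow,
    if_neg (fun h => mult_zmod_two_ne h.1), one_mul] at this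
  exact this.symm

/-- The spin product contains `z`, so membership can be read off from the underlying permutation. -/
theorem mem_spinProd_iff (w : SpinWreath Γ N) :
    w ∈ spinProd Γ h ↔ w.toStr.IsInv (blockEquiv h '' Set.range Sum.inl) := by
  have hpre : blockEquiv h ⁻¹' (blockEquiv h '' Set.range Sum.inl) = Set.range Sum.inl :=
    Set.preimage_image_eq _ (blockEquiv h).injective
  constructor
  · rintro ⟨⟨a, b⟩, rfl⟩
    change (embL h a * embR h b).toStr.IsInv _
    rw [toStr_embL_mul_embR, Str.isInv_map, hpre]
    exact Str.isInv_range_inl _ _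
  · intro hw
    have e : w.toStr = (w.toStr.map (blockEquiv h).symm).map (blockEquiv h) := by
      rw [Str.map_map, Equiv.symm_trans_self, Str.map_refl]
    rw [e, Str.isInv_map, hpre] at hw
    obtain ⟨x, y, hxy⟩ := Str.exists_eq_sum hw
    obtain ⟨a, rfl⟩ := exists_toStr x
    obtain ⟨b, rfl⟩ := exists_toStr y
    rw [hxy, ← toStr_embL_mul_embR] at e
    rcases eq_or_eq_z_mul e with e | e
    · exact e ▸ mem_spinProd h a b
    · rw [e, ← embL_z h, ← mul_assoc, ← map_mul]
      exact mem_spinProd h _ b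

/-- An element that leaves a set of letters invariant is conjugate to a product of two blocks. -/
theorem exists_conj_block (w : SpinWreath Γ N) {A : Set (Fin N)} (hA : w.toStr.IsInv A)
    (eA : A ≃ Fin n) (eB : (Aᶜ : Set (Fin N)) ≃ Fin k) :
    ∃ (t : SpinSym N) (a : SpinWreath Γ n) (b : SpinWreath Γ k),
      w = SemidirectProduct.inr t * (embL h a * embR h b) * (SemidirectProduct.inr t)⁻¹ ∧
      a.toStr = (w.toStr.restr A hA).map eA ∧ b.toStr = (w.toStr.restr Aᶜ hA.compl).map eB := by
  classical
  obtain ⟨a, ha⟩ := exists_toStr ((w.toStr.restr A hA).map eA)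
  obtain ⟨b, hb⟩ := exists_toStr ((w.toStr.restr Aᶜ hA.compl).map eB)
  obtain ⟨t, ht⟩ := SpinSym.toPerm_surjective N ((blockEquiv h).symm.trans
    ((Equiv.sumCongr eA eB).symm.trans (Equiv.Set.sumCompl A)))
  have e : w.toStr = (SemidirectProduct.inr t * (embL h a * embR h b) *
      (SemidirectProduct.inr t)⁻¹ : SpinWreath Γ N).toStr := by
    rw [toStr_conj, toStr_embL_mul_embR, ht, ha, hb, Str.sum_map, Str.map_map, Str.map_map]
    conv_lhs => rw [← Str.sum_restr hA]
    congr 1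
    ext i; simp
  rcases eq_or_eq_z_mul e with e' | e'
  · exact ⟨t, a, b, e', ha, hb⟩
  -- A discrepancy by `z` is absorbed into the first block without changing its labelled
  -- permutation.
  · refine ⟨t, z Γ n * a, b, ?_, by rw [toStr_z_mul, ha], hb⟩
    rw [map_mul, embL_z, mul_assoc (z Γ N), ← mul_assoc (SemidirectProduct.inr t),
      ← z_comm, e']
    simp only [mul_assoc]

theorem sign_toPerm_eq (x : SpinSym n) :
    Equiv.Perm.sign (SpinSym.toPerm n x) = if SpinSym.parity n x = 1 then 1 else -1 := by
  let ε : Multiplicative (ZMod 2) →* ℤˣ :=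
    { toFun := fun a => if a = 1 then 1 else -1
      map_one' := by simp
      map_mul' := by decide }
  have : Equiv.Perm.sign.comp (SpinSym.toPerm n) = ε.comp (SpinSym.parity n) := by
    apply SpinSym.hom_ext
    · simp [SpinSym.toPerm_z, SpinSym.parity_z]
    · intro a
      simp only [MonoidHom.comp_apply, SpinSym.toPerm, SpinSym.lift_t, SpinSym.parity_t, adjSwap]
      rw [Equiv.Perm.sign_swap (by simp [Fin.ext_iff])]
      rfl
  exact DFunLike.congr_fun this x

end SpinWreath

/-- Spin super class functions vanish at permutations of even order. -/
theorem rminus_apply_eq_zero (f : RMinus Γ N) (w : SpinWreath Γ N)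
    (hw : ¬ Odd (orderOf (SpinSym.toPerm N w.right))) : f.1 w = 0 := by
  by_cases hpar : SpinWreath.parity Γ N w = 1
  swap
  · exact f.2.2.2 w hpar
  obtain ⟨A, hA, hs⟩ := Str.exists_sign_eq_neg_one (x := w.toStr) hw
  have hc := card_add_card_compl A
  rw [Nat.card_fin] at hc
  obtain ⟨t, a, b, e, ha, -⟩ := w.exists_conj_block hc hA (Finite.equivFin _) (Finite.equivFin _)
  -- The restriction to `A` has sign -1, so `a` is odd; since `w` is even, `b` is odd as well.
  have ha' : SpinWreath.parity Γ _ a ≠ 1 := by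
    intro h1
    rw [← (signFam_isMult Γ).isNat _ _ (Finite.equivFin A), ← ha, signFam_eq] at hs
    have : (SpinWreath.toStr a).2 = SpinSym.toPerm _ a.right := rfl
    rw [this, SpinWreath.sign_toPerm_eq,
      if_pos (show SpinSym.parity _ a.right = 1 from h1)] at hs
    norm_num at hs
  have hb' : SpinWreath.parity Γ _ b ≠ 1 := by
    intro h1
    rw [e, map_mul, map_mul, map_inv, mul_right_comm, mul_inv_cancel, one_mul,
      parity_embL_mul_embR, h1, mul_one] at hpar
    exact ha' hpar
  have h3 := SpinWreath.embR_mul_embL hc a b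
  rw [(mult_zmod_two _).resolve_left ha', (mult_zmod_two _).resolve_left hb', SpinSym.zPow,
    if_pos ⟨rfl, rfl⟩] at h3
  -- Conjugation by the odd block `a` moves it past the odd block `b` and produces `z`, so the value
  -- of `f` equals its own negative.
  have h4 : SpinWreath.embL hc a * (SpinWreath.embL hc a * SpinWreath.embR hc b) *
      (SpinWreath.embL hc a)⁻¹ =
      SpinWreath.z Γ N * (SpinWreath.embL hc a * SpinWreath.embR hc b) := by
    rw [mul_inv_eq_iff_eq_mul, mul_assoc (SpinWreath.z Γ N), mul_assoc (SpinWreath.embL hc a), h3]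
    change _ = SpinWreath.z Γ N * (_ * (SpinWreath.z Γ N * _))
    rw [← mul_assoc (SpinWreath.embL hc a) (SpinWreath.z Γ N), ← SpinWreath.z_comm,
      mul_assoc (SpinWreath.z Γ N), ← mul_assoc (SpinWreath.z Γ N), SpinWreath.z_mul_z, one_mul]
  have h5 := f.2.1 (SpinWreath.embL hc a) (SpinWreath.embL hc a * SpinWreath.embR hc b)
  rw [h4, f.2.2.1] at h5
  rw [e, f.2.1]
  exact self_eq_neg.1 h5.symm

/-- Over a permutation of odd order the lifts are the odd lift and its product with `z`; over any
other permutation both functions vanish. -/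
theorem transfer_injective {f g : RMinus Γ N} (hfg : ∀ x, transfer f x = transfer g x) : f = g := by
  refine Subtype.ext (funext fun w => ?_)
  by_cases hw : Odd (orderOf (SpinSym.toPerm N w.right))
  · obtain ⟨w', e, hw'⟩ := SpinWreath.exists_odd_toStr (x := w.toStr) hw
    have h1 := hfg w'.toStr
    rw [transfer_toStr f hw', transfer_toStr g hw'] at h1
    rcases SpinWreath.eq_or_eq_z_mul e.symm with e | e
    · rw [e, h1]
    · rw [e, f.2.2.1, g.2.2.1, h1]
  · rw [rminus_apply_eq_zero f w hw, rminus_apply_eq_zero g w hw]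

theorem hat_injective {f g : RGamma Γ}
    (hfg : ∀ (U : Type) [Finite U] (x : Str Γ U), hat (fun n => f n) U x = hat (fun n => g n) U x) :
    f = g := by
  refine DFinsupp.ext fun n => transfer_injective fun x => ?_
  have := hfg (Fin n) x
  rwa [hat_fin, hat_fin] at this

end Blocks
end SpinVertex

/-! ### Induction as the product of families. -/

namespace SpinVertex

/-- The permutations with a given image of `B` form a left coset of the stabilizer of `B`. This is
what counts the terms in the induction formula. -/
theorem image_eq_image_iff {α : Type*} (σ τ : Equiv.Perm α) (B : Set α) :
    σ '' B = τ '' B ↔ ∀ i, (τ⁻¹ * σ) i ∈ B ↔ i ∈ B := by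
  have : σ '' B = τ '' B ↔ (τ⁻¹ * σ) '' B = B := by
    rw [Equiv.Perm.coe_mul, Set.image_comp]
    constructor
    · intro h
      rw [h, ← Set.image_comp, ← Equiv.Perm.coe_mul, inv_mul_cancel, Equiv.Perm.coe_one,
        Set.image_id]
    · intro h
      conv_rhs => rw [← h]
      rw [← Set.image_comp, ← Equiv.Perm.coe_mul, mul_inv_cancel, Equiv.Perm.coe_one,
        Set.image_id]
  rw [this]
  constructor
  · intro h i
    conv_lhs => rw [← h]
    exact (Equiv.injective _).mem_set_image
  · intro h
    ext i
    obtain ⟨i, rfl⟩ := (τ⁻¹ * σ).surjective i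
    rw [h]
    exact (Equiv.injective _).mem_set_image

theorem mul_eq_zero_of_not_odd {Γ : Type*} {U : Type} [Finite U] {φ ψ : Fam Γ}
    (hφ0 : ∀ (V : Type) (x : Str Γ V), ¬ Odd (orderOf x.2) → φ V x = 0)
    (hψ0 : ∀ (V : Type) (x : Str Γ V), ¬ Odd (orderOf x.2) → ψ V x = 0)
    {x : Str Γ U} (hx : ¬ Odd (orderOf x.2)) : φ.mul ψ U x = 0 := by
  classical
  unfold Fam.mul
  refine (finsum_congr fun A => ?_).trans finsum_zero
  by_cases hA : x.IsInv A
  · rw [loc_of_isInv _ hA, loc_of_isInv _ hA.compl]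
    by_cases h1 : Odd (orderOf (x.restr A hA).2)
    · by_cases h2 : Odd (orderOf (x.restr Aᶜ hA.compl).2)
      · refine absurd ?_ hx
        rw [← Str.sum_restr hA, Str.map, orderOf_permCongr, odd_orderOf_sum_iff]
        exact ⟨h1, h2⟩
      · rw [hψ0 _ _ h2, mul_zero]
    · rw [hφ0 _ _ h1, zero_mul]
  · rw [loc_of_not_isInv _ hA, zero_mul]

section Induction

variable {Γ : Type*} [Group Γ] {n k N : ℕ} (h : n + k = N)

/-- The single family attached to a spin super class function. -/
noncomputable def hatOne (u : RMinus Γ n) : Fam Γ :=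
  hat fun m => (DirectSum.lof ℂ ℕ (fun j => RMinus Γ j) n u) m

theorem hatOne_isNat (u : RMinus Γ n) : IsNat (hatOne u) := hat_isNat _

theorem hatOne_eq (u : RMinus Γ n) {U : Type} (e : U ≃ Fin n) (x : Str Γ U) :
    hatOne u U x = transfer u (x.map e) := by
  rw [hatOne, hat_eq _ e, DirectSum.lof_apply]

theorem hatOne_fin (u : RMinus Γ n) (x : Str Γ (Fin n)) : hatOne u (Fin n) x = transfer u x :=
  hatOne_eq u (Equiv.refl _) x

theorem hatOne_eq_zero (u : RMinus Γ n) {U : Type} [Finite U] (hU : Nat.card U ≠ n)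
    (x : Str Γ U) : hatOne u U x = 0 := by
  have : (DirectSum.lof ℂ ℕ (fun j => RMinus Γ j) n u) (Nat.card U) = 0 :=
    DirectSum.of_eq_of_ne _ _ _ hU
  rw [hatOne, hat_eq _ (Finite.equivFin U), this]
  simp [transfer]

/-- Conjugating `w` by `s` lands in the spin product exactly when the image of the first block under
the permutation of `s` is invariant under `w`. The value of the outer product is then the product of
the values on this image and on its complement. -/
theorem ind_summand [Finite Γ] (u : RMinus Γ n) (v : RMinus Γ k) {w : SpinWreath Γ N}
    (hw : Odd (orderOf w.right)) (s : SpinWreath Γ N) [Decidable (s⁻¹ * w * s ∈ spinProd Γ h)] :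
    (if hs : s⁻¹ * w * s ∈ spinProd Γ h then (outer h u v).1 ⟨s⁻¹ * w * s, hs⟩ else 0) =
      loc (hatOne u) (SpinSym.toPerm N s.right '' (blockEquiv h '' Set.range Sum.inl)) w.toStr *
      loc (hatOne v) (SpinSym.toPerm N s.right '' (blockEquiv h '' Set.range Sum.inl))ᶜ
        w.toStr := by
  classical
  set B : Set (Fin N) := blockEquiv h '' Set.range Sum.inl with hB
  set t : SpinWreath Γ N := SemidirectProduct.inr s.right with ht
  -- The label part of `s`, moved to the right of its spin part. It lies in the spin product, so it
  -- affects neither membership nor the value of a class function.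
  set c : SpinWreath Γ N := SemidirectProduct.inl (spinAction Γ N s.right⁻¹ s.left) with hc
  have hstc : s = t * c := by
    refine SemidirectProduct.ext ?_ ?_
    · simp [ht, hc]
    · simp [ht, hc]
  have hcH : c ∈ spinProd Γ h := (SpinWreath.mem_spinProd_iff h c).2 fun i => by
    simp [SpinWreath.toStr, hc]
  have hconj : s⁻¹ * w * s = c⁻¹ * (t⁻¹ * w * t) * c := by rw [hstc]; group
  have htStr : (t⁻¹ * w * t).toStr = w.toStr.map (SpinSym.toPerm N s.right).symm := by
    have := SpinWreath.toStr_conj s.right⁻¹ w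
    rw [map_inv, map_inv, _root_.inv_inv] at this
    exact this
  have hodd : Odd (orderOf (t⁻¹ * w * t).right) := by
    have : (t⁻¹ * w * t).right = MulAut.conj s.right⁻¹ w.right := by simp [ht]
    rwa [this, MulEquiv.orderOf_eq]
  have hmem : s⁻¹ * w * s ∈ spinProd Γ h ↔
      w.toStr.IsInv (SpinSym.toPerm N s.right '' B) := by
    rw [hconj, Subgroup.mul_mem_cancel_right _ hcH,
      Subgroup.mul_mem_cancel_left _ (inv_mem hcH), SpinWreath.mem_spinProd_iff, htStr,
      Str.isInv_map, Equiv.image_eq_preimage_symm (SpinSym.toPerm N s.right)]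
  by_cases hs : s⁻¹ * w * s ∈ spinProd Γ h
  · rw [dif_pos hs]
    have hs' : t⁻¹ * w * t ∈ spinProd Γ h := by
      rwa [hconj, Subgroup.mul_mem_cancel_right _ hcH,
        Subgroup.mul_mem_cancel_left _ (inv_mem hcH)] at hs
    have e1 : (outer h u v).1 ⟨s⁻¹ * w * s, hs⟩ = (outer h u v).1 ⟨t⁻¹ * w * t, hs'⟩ := by
      rw [← (outer h u v).2.1 ⟨c⁻¹, inv_mem hcH⟩ ⟨t⁻¹ * w * t, hs'⟩]
      refine congrArg _ (Subtype.ext (hconj.trans ?_))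
      simp
    rw [e1]
    have hw1 : (t⁻¹ * w * t).toStr =
        ((t⁻¹ * w * t).toStr.map (blockEquiv h).symm).map (blockEquiv h) := by
      rw [Str.map_map, Equiv.symm_trans_self, Str.map_refl]
    have hinv : ((t⁻¹ * w * t).toStr.map (blockEquiv h).symm).IsInv (Set.range Sum.inl) := by
      rw [Str.isInv_map, ← Equiv.image_eq_preimage_symm]
      exact (SpinWreath.mem_spinProd_iff h _).1 hs'
    obtain ⟨x, y, hxy⟩ := Str.exists_eq_sum hinv
    have hodd2 : Odd (orderOf (x.sum y).2) := by
      rw [← hxy, Str.map, orderOf_permCongr]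
      exact odd_orderOf_map (SpinSym.toPerm N) hodd
    rw [odd_orderOf_sum_iff] at hodd2
    obtain ⟨a, rfl, ha⟩ := SpinWreath.exists_odd_toStr hodd2.1
    obtain ⟨b, rfl, hb⟩ := SpinWreath.exists_odd_toStr hodd2.2
    rw [hxy] at hw1
    -- Both sides are odd lifts of the same labelled permutation, hence equal and not merely equal
    -- up to `z`.
    have e2 : t⁻¹ * w * t = SpinWreath.embL h a * SpinWreath.embR h b :=
      SpinWreath.eq_of_odd hodd (SpinWreath.odd_embL_mul_embR h ha hb) (by
        rw [hw1, SpinWreath.toStr_embL_mul_embR])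
    have e3 : (outer h u v).1 ⟨t⁻¹ * w * t, hs'⟩ = u.1 a * v.1 b := by
      rw [← outer_apply h u v a b]
      exact congrArg _ (Subtype.ext e2)
    have e4 : w.toStr = (a.toStr.sum b.toStr).map
        ((blockEquiv h).trans (SpinSym.toPerm N s.right)) := by
      rw [← Str.map_map, ← hw1, htStr, Str.map_map, Equiv.symm_trans_self, Str.map_refl]
    have e5 : ((blockEquiv h).trans (SpinSym.toPerm N s.right)) ⁻¹'
        (SpinSym.toPerm N s.right '' B) = Set.range Sum.inl := by
      rw [Equiv.coe_trans, Set.preimage_comp, Set.preimage_image_eq _ (Equiv.injective _), hB,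
        Set.preimage_image_eq _ (Equiv.injective _)]
    rw [e3, e4, loc_map (hatOne_isNat u), loc_map (hatOne_isNat v), Set.preimage_compl, e5,
      loc_range_inl (hatOne_isNat u), loc_range_inr (hatOne_isNat v), hatOne_fin, hatOne_fin,
      transfer_toStr _ ha, transfer_toStr _ hb]
  · rw [dif_neg hs, loc_of_not_isInv _ (fun h' => hs (hmem.2 h')), zero_mul]

/-- The sum over `s` is grouped by the image of the first block. The fibre over an `n`-element
subset is a coset of the spin product, so the normalization leaves one term per subset; subsets of
other sizes contribute zero. -/
theorem transfer_indProd [Finite Γ] (u : RMinus Γ n) (v : RMinus Γ k) (x : Str Γ (Fin N))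
    (hx : Odd (orderOf x.2)) :
    transfer (indProd h (outer h u v)) x = (hatOne u).mul (hatOne v) (Fin N) x := by
  classical
  obtain ⟨w, rfl, hw⟩ := SpinWreath.exists_odd_toStr hx
  rw [transfer_toStr _ hw]
  set B : Set (Fin N) := blockEquiv h '' Set.range Sum.inl with hB
  have hBcard : Nat.card B = n := by
    rw [hB, Nat.card_image_of_injective (blockEquiv h).injective,
      Nat.card_range_of_injective Sum.inl_injective, Nat.card_fin]
  let T : Set (Fin N) → ℂ := fun A => loc (hatOne u) A w.toStr * loc (hatOne v) Aᶜ w.toStr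
  have : Fintype (Set (Fin N)) := Fintype.ofFinite _
  have h1 : (indProd h (outer h u v)).1 w = (Nat.card (spinProd Γ h) : ℂ)⁻¹ *
      ∑ s : SpinWreath Γ N, T (SpinSym.toPerm N s.right '' B) := by
    change (Nat.card (spinProd Γ h) : ℂ)⁻¹ * _ = _
    congr 1
    exact Finset.sum_congr rfl fun s _ => ind_summand h u v hw s
  have hcard : ∀ A : Set (Fin N), T A ≠ 0 →
      (Finset.univ.filter fun s : SpinWreath Γ N => SpinSym.toPerm N s.right '' B = A).card =
        Nat.card (spinProd Γ h) := by
    intro A hA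
    have hAn : Nat.card A = n := by
      by_contra hne
      apply hA
      have : loc (hatOne u) A w.toStr = 0 := by
        unfold loc
        split_ifs
        · exact hatOne_eq_zero u hne _
        · rfl
      simp only [T, this, zero_mul]
    obtain ⟨τ, hτ⟩ : ∃ τ : Equiv.Perm (Fin N), τ '' B = A := by
      have e1 : B ≃ A := ((Finite.equivFin B).trans (finCongr (hBcard.trans hAn.symm))).trans
        (Finite.equivFin A).symm
      refine ⟨e1.extendSubtype, ?_⟩
      ext i
      constructor
      · rintro ⟨j, hj, rfl⟩
        exact e1.extendSubtype_mem j hj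
      · intro hi
        obtain ⟨j, hj⟩ := e1.surjective ⟨i, hi⟩
        exact ⟨j, j.2, by rw [e1.extendSubtype_apply_of_mem j j.2]; exact congrArg Subtype.val hj⟩
    obtain ⟨t, rfl⟩ := SpinSym.toPerm_surjective N τ
    rw [← Fintype.card_subtype, ← Nat.card_eq_fintype_card]
    refine Nat.card_congr ((Equiv.mulLeft (SemidirectProduct.inr t : SpinWreath Γ N)⁻¹).subtypeEquiv
      fun s => ?_)
    rw [SpinWreath.mem_spinProd_iff, Equiv.coe_mulLeft, ← hτ]
    have e2 : (SpinWreath.toStr ((SemidirectProduct.inr t : SpinWreath Γ N)⁻¹ * s)).2 =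
        (SpinSym.toPerm N t)⁻¹ * SpinSym.toPerm N s.right := by
      simp [SpinWreath.toStr]
    rw [image_eq_image_iff, Str.IsInv, e2]
  rw [h1, ← Finset.sum_fiberwise Finset.univ
    (fun s : SpinWreath Γ N => SpinSym.toPerm N s.right '' B), Fam.mul, finsum_eq_sum_of_fintype,
    Finset.mul_sum]
  refine Finset.sum_congr rfl fun A _ => ?_
  rw [Finset.sum_congr rfl (g := fun _ => T A) (fun s hs => by rw [(Finset.mem_filter.1 hs).2]),
    Finset.sum_const, nsmul_eq_mul]
  by_cases hA : T A = 0
  · rw [hA, mul_zero, mul_zero]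
    exact hA.symm
  · rw [hcard A hA, ← mul_assoc, inv_mul_cancel₀, one_mul]
    exact_mod_cast Nat.card_pos.ne'

theorem hatOne_indProd [Finite Γ] (u : RMinus Γ n) (v : RMinus Γ k) {U : Type} [Finite U]
    (x : Str Γ U) : hatOne (indProd h (outer h u v)) U x = (hatOne u).mul (hatOne v) U x := by
  by_cases hU : Nat.card U = N
  · have e : U ≃ Fin N := (Finite.equivFin U).trans (finCongr hU)
    rw [hatOne_eq _ e, ← (hatOne_isNat u).mul (hatOne_isNat v) _ _ e]
    by_cases hx : Odd (orderOf (x.map e).2)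
    · exact transfer_indProd h u v _ hx
    · rw [transfer_of_not_odd _ hx, mul_eq_zero_of_not_odd (φ := hatOne u) (ψ := hatOne v)
        (fun _ _ => hat_of_not_odd _) (fun _ _ => hat_of_not_odd _) hx]
  · rw [hatOne_eq_zero _ hU]
    symm
    unfold Fam.mul
    refine (finsum_congr fun A => ?_).trans finsum_zero
    have hc := card_add_card_compl A
    by_cases hA : x.IsInv A
    · rw [loc_of_isInv _ hA, loc_of_isInv _ hA.compl]
      by_cases h1 : Nat.card A = n
      · rw [hatOne_eq_zero v (by omega), mul_zero]
      · rw [hatOne_eq_zero u h1, zero_mul]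
    · rw [loc_of_not_isInv _ hA, zero_mul]

/-- The family of an element of `RGamma Γ`. -/
noncomputable def hatG (f : RGamma Γ) : Fam Γ := hat fun m => f m

theorem hatG_isNat (f : RGamma Γ) : IsNat (hatG f) := hat_isNat _

theorem hatG_add (f g : RGamma Γ) (U : Type) (x : Str Γ U) :
    hatG (f + g) U x = hatG f U x + hatG g U x := by
  rw [hatG, hatG, hatG, ← hat_add]; rfl

theorem hatG_smul (c : ℂ) (f : RGamma Γ) (U : Type) (x : Str Γ U) :
    hatG (c • f) U x = c * hatG f U x := by
  rw [hatG, hatG, ← hat_smul]; rfl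

theorem hatG_zero (U : Type) (x : Str Γ U) : hatG (0 : RGamma Γ) U x = 0 := by
  have := hatG_smul 0 (0 : RGamma Γ) U x
  rwa [zero_smul, zero_mul] at this

/-- Evaluation of the family as a linear functional. -/
noncomputable def hatLin (U : Type) (x : Str Γ U) : RGamma Γ →ₗ[ℂ] ℂ where
  toFun f := hatG f U x
  map_add' f g := hatG_add f g U x
  map_smul' c f := hatG_smul c f U x

theorem hatG_creation [Finite Γ] (u : RMinus Γ n) (f : RGamma Γ) {U : Type} [Finite U]
    (x : Str Γ U) : hatG (creation u f) U x = (hatOne u).mul (hatG f) U x := by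
  induction f using DirectSum.induction_on with
  | zero =>
    rw [map_zero, hatG_zero]
    symm
    refine (finsum_congr fun A => ?_).trans finsum_zero
    have : loc (hatG (0 : RGamma Γ)) Aᶜ x = 0 := by
      unfold loc
      split_ifs
      · exact hatG_zero _ _
      · rfl
    rw [this, mul_zero]
  | of m v =>
    have : creation u (DirectSum.of (fun j => RMinus Γ j) m v) =
        DirectSum.lof ℂ ℕ (fun j => RMinus Γ j) (n + m) (indProd rfl (outer rfl u v)) := by
      rw [creation, ← DirectSum.lof_eq_of ℂ, DirectSum.toModule_lof]
      rfl
    rw [this]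
    exact hatOne_indProd rfl u v x
  | add f g hf hg =>
    rw [map_add, hatG_add, hf, hg, ← mul_add_fam]
    exact congrFun (mul_congr_fam (fun _ _ => rfl) fun V _ => funext fun y =>
      (hatG_add f g V y).symm) x

end Induction
end SpinVertex

namespace SpinVertex

open Module

/-! ### Characters of tensor powers. -/

section TensorCharacter

variable {Γ : Type*} [Group Γ] {V : Type*} [AddCommGroup V] [Module ℂ V]
  {κ : Type*} [Fintype κ] (b : Basis κ ℂ V) (ρ : Representation ℂ Γ V)

/-- Matrix coefficients of a representation. -/
noncomputable def matrixCoeff (g : Γ) (i j : κ) : ℂ := b.repr (ρ g (b j)) i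

theorem tensorPower_character (n : ℕ) (x : SpinWreath Γ n) :
    (tensorPower ρ n).character x = ∑ p : Fin n → κ, ∏ i,
      matrixCoeff b ρ (x.left i) (p i) (p ((SpinSym.toPerm n x.right)⁻¹ i)) := by
  classical
  rw [Representation.character,
    LinearMap.trace_eq_matrix_trace ℂ (Basis.piTensorProduct fun _ : Fin n => b), Matrix.trace]
  refine Finset.sum_congr rfl fun p _ => ?_
  rw [Matrix.diag_apply, LinearMap.toMatrix_apply, Basis.piTensorProduct_apply]
  have : tensorPower ρ n x (PiTensorProduct.tprod ℂ fun i => b (p i)) =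
      PiTensorProduct.tprod ℂ fun i => ρ (x.left i) (b (p ((SpinSym.toPerm n x.right)⁻¹ i))) := by
    change PiTensorProduct.map (fun i => ρ (x.left i))
      (PiTensorProduct.reindex ℂ (fun _ : Fin n => V) (SpinSym.toPerm n x.right)
        (PiTensorProduct.tprod ℂ fun i => b (p i))) = _
    rw [PiTensorProduct.reindex_tprod, PiTensorProduct.map_tprod]
    rfl
  rw [this, Basis.piTensorProduct_repr_tprod_apply]
  rfl

/-- The characters of all tensor powers. -/
noncomputable def tensorFam : Fam Γ := fun U x =>
  ∑ᶠ p : U → κ, ∏ᶠ i, matrixCoeff b ρ (x.1 i) (p i) (p (x.2⁻¹ i))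

theorem tensorFam_toStr {n : ℕ} (x : SpinWreath Γ n) :
    tensorFam b ρ (Fin n) x.toStr = (tensorPower ρ n).character x := by
  rw [tensorPower_character b, tensorFam, finsum_eq_sum_of_fintype]
  refine Finset.sum_congr rfl fun p _ => ?_
  rw [finprod_eq_prod_of_fintype]
  rfl

theorem tensorFam_isMult : IsMult (tensorFam b ρ) where
  isNat U V e x := by
    unfold tensorFam
    rw [← finsum_comp_equiv (Equiv.arrowCongr e (Equiv.refl κ))]
    refine finsum_congr fun p => ?_
    rw [← finprod_comp_equiv e]
    refine finprod_congr fun i => ?_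
    have h : (x.map e).2⁻¹ (e i) = e (x.2⁻¹ i) := by
      rw [Equiv.Perm.inv_eq_iff_eq]
      simp [Str.map]
    rw [h]
    simp [Str.map]
  sum U V _ _ x y := by
    have := Fintype.ofFinite U
    have := Fintype.ofFinite V
    have hU : Fintype (U → κ) := Fintype.ofFinite _
    have hV : Fintype (V → κ) := Fintype.ofFinite _
    have hUV : Fintype (U ⊕ V → κ) := Fintype.ofFinite _
    simp only [tensorFam, finsum_eq_sum_of_fintype, finprod_eq_prod_of_fintype]
    rw [Fintype.sum_mul_sum, ← Fintype.sum_prod_type']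
    refine Fintype.sum_equiv (Equiv.sumArrowEquivProdArrow U V κ) _ _ fun p => ?_
    rw [Fintype.prod_sum_type]
    rfl
  empty U _ x := by
    rw [tensorFam, finsum_eq_sum_of_fintype, Fintype.sum_unique]
    exact finprod_of_isEmpty _

/-- For the trivial weight the extra factor in `weightedForm` is 1. Spin super class functions
vanish at odd elements, so the form is then the standard one. -/
theorem trivial_tensorPower_character (n : ℕ) (x : SpinWreath Γ n) :
    (tensorPower (Representation.trivial ℂ Γ ℂ) n).character x = 1 := by
  rw [tensorPower_character (Basis.singleton Unit ℂ), Fintype.sum_unique]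
  simp [matrixCoeff]

end TensorCharacter

/-! ### Restriction and pairing as contraction. -/

section Annihilation

theorem SpinWreath.toStr_inv {Γ : Type*} [Group Γ] {n : ℕ} (c : SpinWreath Γ n) :
    c⁻¹.toStr = c.toStr.inv := by
  refine Prod.ext (funext fun i => ?_) ?_
  · simp [SpinWreath.toStr, Str.inv]
    rfl
  · simp [SpinWreath.toStr, Str.inv]

variable {Γ : Type*} [Group Γ] [Finite Γ] {n k N : ℕ} (h : n + k = N)

/-- Passing to labelled permutations is two-to-one, with fibres `{w, z w}`. -/
theorem sum_toStr (Φ : Str Γ (Fin n) → ℂ) [Fintype (Str Γ (Fin n))] :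
    ∑ w : SpinWreath Γ n, Φ w.toStr = 2 * ∑ x, Φ x := by
  classical
  rw [← Finset.sum_fiberwise Finset.univ (fun w : SpinWreath Γ n => w.toStr), Finset.mul_sum]
  refine Finset.sum_congr rfl fun x _ => ?_
  rw [Finset.sum_congr rfl (g := fun _ => Φ x) (fun s hs => by rw [(Finset.mem_filter.1 hs).2]),
    Finset.sum_const, nsmul_eq_mul]
  obtain ⟨w, rfl⟩ := SpinWreath.exists_toStr x
  have : (Finset.univ.filter fun w' : SpinWreath Γ n => w'.toStr = w.toStr) =
      {w, SpinWreath.z Γ n * w} := by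
    ext w'
    simp only [Finset.mem_filter, Finset.mem_univ, true_and, Finset.mem_insert,
      Finset.mem_singleton]
    constructor
    · exact SpinWreath.eq_or_eq_z_mul
    · rintro (rfl | rfl)
      · rfl
      · exact SpinWreath.toStr_z_mul _
  rw [this, Finset.card_pair]
  · norm_num
  · intro e
    have : SpinWreath.z Γ n = 1 := right_eq_mul.1 e
    exact SpinSym.z_ne_one n (congrArg SemidirectProduct.right this)

theorem card_spinWreath : (Nat.card (SpinWreath Γ n) : ℂ) =
    2 * ((n.factorial : ℂ) * (Nat.card Γ : ℂ) ^ n) := by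
  have : Fintype (Str Γ (Fin n)) := Fintype.ofFinite _
  have h1 := sum_toStr (Γ := Γ) (n := n) fun _ => 1
  rw [sum_eq_integral, integral_one, Nat.card_fin, mul_one, Finset.sum_const, Finset.card_univ,
    nsmul_eq_mul, mul_one, ← Nat.card_eq_fintype_card] at h1
  exact h1

/-- Replacing `x` by `z x` changes the sign of both factors of the summand, so the sum over the spin
wreath product is twice a sum over labelled permutations. The 2 cancels against the order of the
group. -/
theorem transfer_contract (u : RMinus Γ n) (v : RMinus Γ N) (y : Str Γ (Fin k)) :
    transfer (contract h (Representation.trivial ℂ Γ ℂ) u (resProd h v)) y =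
      integral (Fin n) fun x => transfer u x * transfer v ((x.inv.sum y).map (blockEquiv h)) := by
  classical
  have hfin : Fintype (Str Γ (Fin n)) := Fintype.ofFinite _
  by_cases hy : Odd (orderOf y.2)
  · obtain ⟨b, rfl, hb⟩ := SpinWreath.exists_odd_toStr hy
    rw [transfer_toStr _ hb, contract_apply, weightedForm, card_spinWreath, integral,
      finsum_eq_sum_of_fintype, Nat.card_fin, mul_inv, mul_comm (2 : ℂ)⁻¹, mul_assoc]
    congr 1
    rw [inv_mul_eq_iff_eq_mul₀ two_ne_zero, ← sum_toStr, Finset.sum_filter]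
    refine Finset.sum_congr rfl fun a _ => ?_
    rw [trivial_tensorPower_character, one_mul]
    by_cases ha : Odd (orderOf (SpinSym.toPerm n a.right))
    -- At the odd lift `c` the three elements involved are all odd lifts, so the transferred values
    -- are actual values; the other lift is treated afterwards through the sign change.
    · have main : ∀ c : SpinWreath Γ n, Odd (orderOf c.right) →
          (if SpinWreath.parity Γ n c = 1 then u.1 c * (resProd h v).1
            ⟨SpinWreath.embL h c⁻¹ * SpinWreath.embR h b, SpinWreath.mem_spinProd h c⁻¹ b⟩
          else 0) = transfer u c.toStr *
            transfer v ((c.toStr.inv.sum b.toStr).map (blockEquiv h)) := by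
        intro c hc
        have hc' : Odd (orderOf (c⁻¹ : SpinWreath Γ n).right) := by
          rw [SemidirectProduct.inv_right, orderOf_inv]; exact hc
        rw [if_pos (show SpinWreath.parity Γ n c = 1 from
          parity_eq_one_of_odd (SpinSym.parity n) hc),
          transfer_toStr u hc, ← SpinWreath.toStr_inv, ← SpinWreath.toStr_embL_mul_embR,
          transfer_toStr v (SpinWreath.odd_embL_mul_embR h hc' hb)]
        rfl
      obtain ⟨c, hc, hco⟩ := SpinWreath.exists_odd_toStr (x := a.toStr) ha
      rw [← hc, ← main c hco]
      rcases SpinWreath.eq_or_eq_z_mul hc.symm with rfl | rfl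
      · rfl
      · rw [map_mul, SpinWreath.parity_z, one_mul, u.2.2.1]
        have e : (resProd h v).1 ⟨SpinWreath.embL h (SpinWreath.z Γ n * c)⁻¹ *
            SpinWreath.embR h b, SpinWreath.mem_spinProd h _ b⟩ = -(resProd h v).1
            ⟨SpinWreath.embL h c⁻¹ * SpinWreath.embR h b, SpinWreath.mem_spinProd h c⁻¹ b⟩ := by
          rw [← (resProd h v).2.2.1]
          refine congrArg _ (Subtype.ext ?_)
          change SpinWreath.embL h (SpinWreath.z Γ n * c)⁻¹ * SpinWreath.embR h b =
            SpinWreath.z Γ N * (SpinWreath.embL h c⁻¹ * SpinWreath.embR h b)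
          have hz : (SpinWreath.z Γ n * c)⁻¹ = SpinWreath.z Γ n * c⁻¹ := by
            rw [mul_inv_rev, SpinWreath.z_comm,
              inv_eq_of_mul_eq_one_left (SpinWreath.z_mul_z (Γ := Γ) n)]
          rw [hz, map_mul, SpinWreath.embL_z, mul_assoc]
        rw [e, neg_mul_neg]
    · rw [rminus_apply_eq_zero u a ha, transfer_of_not_odd u ha, zero_mul, zero_mul, ite_self]
  · rw [transfer_of_not_odd _ hy, integral, finsum_eq_sum_of_fintype, Finset.sum_eq_zero, mul_zero]
    intro x _
    rw [transfer_of_not_odd v, mul_zero]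
    rw [Str.map, orderOf_permCongr, odd_orderOf_sum_iff]
    exact fun h' => hy h'.2

theorem hatG_annihilation (u : RMinus Γ n) (f : RGamma Γ) {U : Type} [Finite U] (y : Str Γ U) :
    hatG (annihilation (Representation.trivial ℂ Γ ℂ) u f) U y =
      contr (hatOne u) n (hatG f) U y := by
  induction f using DirectSum.induction_on with
  | zero =>
    simp only [map_zero, hatG_zero, contr, mul_zero]
    simp [integral]
  | of m v =>
    have hof : (DirectSum.of (fun j => RMinus Γ j) m v : RGamma Γ) =
      DirectSum.lof ℂ ℕ (fun j => RMinus Γ j) m v := rfl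
    have hR : hatG (DirectSum.of (fun j => RMinus Γ j) m v : RGamma Γ) = hatOne v := rfl
    rw [hR, hof, annihilation, DirectSum.toModule_lof]
    have hzero : Nat.card U + n ≠ m → contr (hatOne u) n (hatOne v) U y = 0 := by
      intro hne
      have : ∀ x : Str Γ (Fin n), hatOne v (Fin n ⊕ U) (x.inv.sum y) = 0 := fun x =>
        hatOne_eq_zero v (by rw [Nat.card_sum, Nat.card_fin]; omega) _
      simp [contr, this, integral]
    split_ifs with hnm
    · rw [LinearMap.comp_apply, LinearMap.comp_apply]
      change hatOne _ U y = _
      by_cases hU : Nat.card U = m - n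
      · have e : U ≃ Fin (m - n) := (Finite.equivFin U).trans (finCongr hU)
        rw [hatOne_eq _ e, transfer_contract, ← (hatOne_isNat v).contr _ _ _ _ e, contr]
        congr 1
        funext x
        rw [hatOne_fin, hatOne_eq v (blockEquiv (Nat.add_sub_of_le hnm))]
      · rw [hatOne_eq_zero _ hU, hzero (by omega)]
    · rw [LinearMap.zero_apply, hatG_zero, hzero (by omega)]
  | add f g hf hg =>
    rw [map_add, hatG_add, hf, hg]
    have : Fintype (Str Γ (Fin n)) := Fintype.ofFinite _
    simp only [contr, hatG_add, mul_add, integral, finsum_eq_sum_of_fintype,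
      Finset.sum_add_distrib]

end Annihilation
end SpinVertex

namespace SpinVertex

open Module

/-! ### Schur orthogonality and label sums of tensor power characters. -/

section Schur

variable {Γ : Type*} [Group Γ] [Fintype Γ] {V W : Type*} [AddCommGroup V] [Module ℂ V]
  [AddCommGroup W] [Module ℂ W] {κ μ : Type*} [Fintype κ] [Fintype μ]
  (b : Basis κ ℂ V) (c : Basis μ ℂ W) (ρ : Representation ℂ Γ V) (σ : Representation ℂ Γ W)

/-- The average of a linear map over the group, without the factor `|Γ|⁻¹`. -/
noncomputable def averageMap (E : W →ₗ[ℂ] V) : σ.IntertwiningMap ρ where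
  toLinearMap := ∑ g : Γ, ρ g ∘ₗ E ∘ₗ σ g⁻¹
  isIntertwining' h := by
    ext w
    simp only [LinearMap.comp_apply, LinearMap.sum_apply, map_sum]
    refine Fintype.sum_equiv (Equiv.mulLeft h⁻¹) _ _ fun g => ?_
    have h1 : ρ h (ρ (h⁻¹ * g) (E (σ (h⁻¹ * g)⁻¹ w))) =
        (ρ h * ρ (h⁻¹ * g)) (E (σ (h⁻¹ * g)⁻¹ w)) := rfl
    have h2 : σ g⁻¹ (σ h w) = (σ g⁻¹ * σ h) w := rfl
    rw [Equiv.coe_mulLeft, h1, h2, ← map_mul, ← map_mul, mul_inv_cancel_left, mul_inv_rev,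
      _root_.inv_inv]

/-- Averaging a rank-one map turns statements about intertwiners into statements about sums of
products of matrix coefficients. -/
theorem repr_averageMap (i j : κ) (k l : μ) :
    b.repr ((averageMap ρ σ ((c.coord k).smulRight (b j))).toLinearMap (c l)) i =
      ∑ g : Γ, matrixCoeff b ρ g i j * matrixCoeff c σ g⁻¹ k l := by
  simp [averageMap, matrixCoeff, LinearMap.sum_apply, mul_comm]

theorem sum_matrixCoeff_of_isEmpty (hρ : ρ.IsIrreducible) (hσ : σ.IsIrreducible)
    (h : IsEmpty (σ.Equiv ρ)) (i j : κ) (k l : μ) :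
    ∑ g : Γ, matrixCoeff b ρ g i j * matrixCoeff c σ g⁻¹ k l = 0 := by
  have : averageMap ρ σ ((c.coord k).smulRight (b j)) = 0 := Subsingleton.elim _ _
  rw [← repr_averageMap, this]
  simp

/-- By Schur's lemma the averaged rank-one map is a scalar, and comparing traces determines the
scalar. -/
theorem sum_matrixCoeff_self [DecidableEq κ] (hρ : ρ.IsIrreducible) (i j k l : κ) :
    ∑ g : Γ, matrixCoeff b ρ g i j * matrixCoeff b ρ g⁻¹ k l =
      if i = l ∧ j = k then (Nat.card Γ : ℂ) / Fintype.card κ else 0 := by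
  have : FiniteDimensional ℂ V := b.finiteDimensional_of_finite
  obtain ⟨a, ha⟩ := (Representation.IsIrreducible.algebraMap_intertwiningMap_bijective_of_isAlgClosed
    (ρ := ρ)).2 (averageMap ρ ρ ((b.coord k).smulRight (b j)))
  have hlin : (averageMap ρ ρ ((b.coord k).smulRight (b j))).toLinearMap = a • LinearMap.id := by
    rw [← ha]
    rfl
  rw [← repr_averageMap, hlin]
  have htr := congrArg (LinearMap.trace ℂ V) hlin
  have h1 : LinearMap.trace ℂ V (averageMap ρ ρ ((b.coord k).smulRight (b j))).toLinearMap =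
      Nat.card Γ * if j = k then 1 else 0 := by
    change LinearMap.trace ℂ V (∑ g : Γ, ρ g ∘ₗ ((b.coord k).smulRight (b j)) ∘ₗ ρ g⁻¹) = _
    rw [map_sum, Nat.card_eq_fintype_card, ← nsmul_eq_mul, ← Finset.card_univ, ← Finset.sum_const]
    refine Finset.sum_congr rfl fun g _ => ?_
    rw [LinearMap.trace_comp_comm', LinearMap.comp_assoc]
    have : ρ g⁻¹ ∘ₗ ρ g = LinearMap.id := by
      rw [← Module.End.mul_eq_comp, ← map_mul, inv_mul_cancel, map_one]; rfl
    rw [this, LinearMap.comp_id, LinearMap.trace_smulRight]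
    simp [Finsupp.single_apply]
  rw [h1, map_smul, LinearMap.trace_id, Module.finrank_eq_card_basis b, smul_eq_mul] at htr
  have hκ : (Fintype.card κ : ℂ) ≠ 0 := by
    have : Nonempty κ := ⟨i⟩
    exact_mod_cast Fintype.card_ne_zero
  have ha' : a = (Nat.card Γ : ℂ) / Fintype.card κ * if j = k then 1 else 0 := by
    field_simp
    exact htr.symm
  rw [LinearMap.smul_apply, LinearMap.id_apply, map_smul, Finsupp.smul_apply, ha',
    Basis.repr_self, Finsupp.single_apply, smul_eq_mul, mul_assoc]
  by_cases h1 : i = l <;> by_cases h2 : j = k <;> simp [h1, h2, eq_comm]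

/-- The sum over all labels of the product of the tensor power characters at inverse elements. -/
theorem sum_tensorFam_mul_inv {U : Type} [Fintype U] [DecidableEq U] (s : Equiv.Perm U) :
    ∑ g : U → Γ, tensorFam b ρ U (g, s) * tensorFam c σ U (Str.inv (g, s)) =
      ∑ p : U → κ, ∑ p' : U → μ, ∏ i, ∑ g : Γ,
        matrixCoeff b ρ g (p i) (p (s⁻¹ i)) * matrixCoeff c σ g⁻¹ (p' (s⁻¹ i)) (p' i) := by
  have e : ∀ g : U → Γ, tensorFam b ρ U (g, s) * tensorFam c σ U (Str.inv (g, s)) =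
      ∑ p : U → κ, ∑ p' : U → μ, ∏ i, (matrixCoeff b ρ (g i) (p i) (p (s⁻¹ i)) *
        matrixCoeff c σ (g i)⁻¹ (p' (s⁻¹ i)) (p' i)) := by
    intro g
    simp only [tensorFam, finsum_eq_sum_of_fintype, finprod_eq_prod_of_fintype]
    rw [Fintype.sum_mul_sum]
    refine Finset.sum_congr rfl fun p _ => Finset.sum_congr rfl fun p' _ => ?_
    rw [Finset.prod_mul_distrib]
    congr 1
    -- Inversion carries the label at `s i` to position `i`; reindexing by `s` brings both factors
    -- to the same label.
    exact Fintype.prod_equiv s _ _ fun i => by simp [Str.inv]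
  simp only [e]
  rw [Finset.sum_comm]
  refine Finset.sum_congr rfl fun p _ => ?_
  rw [Finset.sum_comm]
  refine Finset.sum_congr rfl fun p' _ => ?_
  rw [Fintype.prod_sum]

theorem sum_tensorFam_of_isEmpty {U : Type} [Fintype U] [DecidableEq U] [Nonempty U]
    (s : Equiv.Perm U) (hρ : ρ.IsIrreducible) (hσ : σ.IsIrreducible)
    (h : IsEmpty (σ.Equiv ρ)) :
    ∑ g : U → Γ, tensorFam b ρ U (g, s) * tensorFam c σ U (Str.inv (g, s)) = 0 := by
  rw [sum_tensorFam_mul_inv]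
  refine Finset.sum_eq_zero fun p _ => Finset.sum_eq_zero fun p' _ => ?_
  simp only [sum_matrixCoeff_of_isEmpty b c ρ σ hρ hσ h]
  simp

/-- Only equal index functions `p = p'` survive. With `d` the size of the basis, each contributes
the `|U|`-th power of `|Γ| / d`, and there are `d ^ |U|` of them. The result does not depend on `s`.
-/
theorem sum_tensorFam_self {U : Type} [Fintype U] [DecidableEq U]
    (s : Equiv.Perm U) (hρ : ρ.IsIrreducible) :
    ∑ g : U → Γ, tensorFam b ρ U (g, s) * tensorFam b ρ U (Str.inv (g, s)) =
      (Nat.card Γ : ℂ) ^ Fintype.card U := by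
  classical
  -- An irreducible representation is nonzero, so the division by `d` below is legitimate.
  have hκ : Nonempty κ := by
    by_contra hne
    rw [not_nonempty_iff] at hne
    have : Subsingleton V := b.repr.toEquiv.subsingleton
    exact bot_ne_top (α := Subrepresentation ρ) (by
      ext v
      simp [Subsingleton.elim v 0])
  have hκ' : (Fintype.card κ : ℂ) ≠ 0 := by exact_mod_cast Fintype.card_ne_zero
  rw [sum_tensorFam_mul_inv]
  have : ∀ p p' : U → κ, (∏ i, ∑ g : Γ,
      matrixCoeff b ρ g (p i) (p (s⁻¹ i)) * matrixCoeff b ρ g⁻¹ (p' (s⁻¹ i)) (p' i)) =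
      if p = p' then ((Nat.card Γ : ℂ) / Fintype.card κ) ^ Fintype.card U else 0 := by
    intro p p'
    simp only [sum_matrixCoeff_self b ρ hρ]
    split_ifs with h
    · subst h
      simp only [and_self, if_true, Finset.prod_const, Finset.card_univ]
    · obtain ⟨i, hi⟩ := Function.ne_iff.1 h
      exact Finset.prod_eq_zero (Finset.mem_univ i) (if_neg fun h' => hi h'.1)
  simp only [this]
  rw [Finset.sum_congr rfl fun p _ => Finset.sum_ite_eq _ _ _]
  simp only [Finset.mem_univ, if_true, Finset.sum_const, Finset.card_univ, Fintype.card_fun,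
    nsmul_eq_mul, Nat.cast_pow, div_pow]
  exact mul_div_cancel₀ _ (pow_ne_zero _ hκ')

end Schur
end SpinVertex

namespace SpinVertex

/-! ### Traces of words in the spin generators. -/

section Words

/-- A trace-like function on words that is compatible with anticommutation relations and vanishes
on the empty word vanishes on all words of even length. -/
theorem eq_zero_of_even_word {I : Type*} (D : List I → ℂ) (β : I → I → ℂ)
    (hrel : ∀ p a b q, D (p ++ a :: b :: q) + D (p ++ b :: a :: q) = β a b * D (p ++ q))
    (hcyc : ∀ a l, D (a :: l) = D (l ++ [a])) (h0 : D [] = 0) :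
    ∀ m (l : List I), l.length = 2 * m → D l = 0 := by
  intro m
  induction m with
  | zero => intro l hl; rwa [List.length_eq_zero_iff.1 hl]
  | succ m ih =>
    have hswap : ∀ p a b q, (p ++ q).length = 2 * m →
        D (p ++ a :: b :: q) = -D (p ++ b :: a :: q) := fun p a b q h =>
      eq_neg_of_add_eq_zero_left (by rw [hrel, ih _ h, mul_zero])
    have hmove : ∀ l p a, (p ++ l).length = 2 * m + 1 →
        D (p ++ a :: l) = (-1) ^ l.length * D (p ++ l ++ [a]) := by
      intro l
      induction l with
      | nil => intro p a _; simp
      | cons b l ihl =>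
        intro p a h
        rw [hswap p a b l (by simp at h ⊢; omega)]
        have := ihl (p ++ [b]) a (by simpa using h)
        rw [List.append_assoc, List.singleton_append] at this
        rw [this, List.length_cons, pow_succ, List.append_assoc p [b], List.singleton_append]
        ring
    intro l hl
    cases l with
    | nil => simp at hl
    | cons a l =>
      have hlen : l.length = 2 * m + 1 := by simp at hl; omega
      -- Modulo shorter words the letters anticommute, so moving the first letter past an odd number
      -- of others gives -1, while cyclicity gives +1.
      have h1 := hmove l [] a (by simpa using hlen)
      rw [List.nil_append, List.nil_append, ← hcyc, hlen, pow_succ, pow_mul] at h1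
      norm_num at h1
      exact self_eq_neg.1 h1

/-- The scalars in the anticommutation relations of the generators of the spin group. -/
def spinForm (a b : ℕ) : ℂ := if a = b then -2 else if a + 1 = b ∨ b + 1 = a then 1 else 0

/-- The generators act by linear combinations of Clifford generators, so their anticommutators are
scalars. These scalars depend only on the difference of the indices, so a shifted block satisfies
the same relations. -/
theorem basicSpin_t_anticomm (n : ℕ) (a b : Fin (n - 1)) :
    (basicSpin n (SpinSym.t a)).1 * (basicSpin n (SpinSym.t b)).1 +
      (basicSpin n (SpinSym.t b)).1 * (basicSpin n (SpinSym.t a)).1 = spinForm a b • 1 := by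
  have e : ∀ a : Fin (n - 1), (basicSpin n (SpinSym.t a)).1 = basicSpinGen (n / 2) a := fun a => by
    rw [basicSpin, SpinSym.lift_t]; rfl
  rw [e, e]
  obtain ⟨a, ha⟩ := a
  obtain ⟨b, hb⟩ := b
  dsimp only [spinForm]
  split_ifs with h1 h2
  · subst h1
    rw [basicSpinGen_sq _ _ (by omega), ← neg_add, neg_smul, two_smul]
  · rcases h2 with rfl | rfl
    · rw [basicSpinGen_near _ _ (by omega), one_smul]
    · rw [add_comm, basicSpinGen_near _ _ (by omega), one_smul]
  · rw [zero_smul]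
    rcases Nat.lt_or_gt_of_ne h1 with h | h
    · rw [basicSpinGen_anticomm_far _ b a (by omega) (by omega), add_neg_cancel]
    · rw [basicSpinGen_anticomm_far _ a b (by omega) (by omega), neg_add_cancel]

theorem SpinSym.exists_word {n : ℕ} (x : SpinSym n) :
    ∃ l : List (Fin (n - 1)), x = (l.map t).prod ∨ x = z n * (l.map t).prod := by
  let M : Submonoid (SpinSym n) :=
    { carrier := {x | ∃ l : List (Fin (n - 1)), x = (l.map t).prod ∨ x = z n * (l.map t).prod}
      one_mem' := ⟨[], Or.inl rfl⟩
      mul_mem' := by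
        rintro x y ⟨l, hl⟩ ⟨l', hl'⟩
        refine ⟨l ++ l', ?_⟩
        rw [List.map_append, List.prod_append]
        rcases hl with rfl | rfl <;> rcases hl' with rfl | rfl
        · exact Or.inl rfl
        · exact Or.inr (by rw [← mul_assoc, ← z_comm, mul_assoc])
        · exact Or.inr (mul_assoc _ _ _)
        · refine Or.inl ?_
          rw [← mul_assoc, mul_assoc (z n), ← z_comm, ← mul_assoc, z_mul_z, one_mul] }
  let H : Subgroup (SpinSym n) :=
    { M with
      inv_mem' := fun {x} hx => by
        -- The group is finite, so inverses are powers and no inverse letters are needed.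
        have : x⁻¹ = x ^ (orderOf x - 1) := by
          rw [inv_eq_iff_mul_eq_one, ← pow_succ', Nat.sub_add_cancel (orderOf_pos x),
            pow_orderOf_eq_one]
        rw [this]
        exact M.pow_mem hx _ }
  exact SpinSym.generated H ⟨[], Or.inr (by simp)⟩ (fun a => ⟨[a], Or.inl (by simp)⟩) x

theorem SpinSym.parity_word {n : ℕ} (l : List (Fin (n - 1))) :
    parity n (l.map t).prod = Multiplicative.ofAdd (1 : ZMod 2) ^ l.length := by
  induction l with
  | nil => simp
  | cons a l ih => rw [List.map_cons, List.prod_cons, map_mul, ih, parity_t, List.length_cons,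
      pow_succ']

theorem SpinSym.exists_even_word {n : ℕ} {x : SpinSym n} (hx : parity n x = 1) :
    ∃ l : List (Fin (n - 1)), Even l.length ∧ (x = (l.map t).prod ∨ x = z n * (l.map t).prod) := by
  obtain ⟨l, hl⟩ := exists_word x
  refine ⟨l, ?_, hl⟩
  have h1 : parity n (l.map t).prod = 1 := by
    rcases hl with rfl | rfl
    · exact hx
    · rwa [map_mul, parity_z, one_mul] at hx
  rw [parity_word] at h1
  by_contra hne
  obtain ⟨k, hk⟩ := Nat.not_even_iff_odd.1 hne
  rw [hk, pow_succ, pow_mul, sq, mult_zmod_two_sq, one_pow, one_mul] at h1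
  exact mult_zmod_two_ne h1.symm

/-- The trace of the basic spin representation. -/
noncomputable def spinTrace (n : ℕ) (x : SpinSym n) : ℂ := (basicSpin n x).1.trace

theorem basicSpinRep_character (n : ℕ) (x : SpinSym n) :
    (basicSpinRep n).character x = spinTrace n x := by
  rw [Representation.character, basicSpinRep_apply, Matrix.trace_toLin'_eq, spinTrace]

theorem spinTrace_mul_comm {n : ℕ} (x y : SpinSym n) : spinTrace n (x * y) = spinTrace n (y * x) := by
  rw [spinTrace, spinTrace, map_mul, map_mul, Units.val_mul, Units.val_mul, Matrix.trace_mul_comm]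

theorem spinTrace_z_mul {n : ℕ} (x : SpinSym n) : spinTrace n (SpinSym.z n * x) = -spinTrace n x := by
  rw [spinTrace, spinTrace, map_mul, Units.val_mul, basicSpin, SpinSym.lift_z, Units.val_neg,
    Units.val_one, neg_one_mul, Matrix.trace_neg]

theorem spinTrace_one (n : ℕ) : spinTrace n 1 = 2 ^ (n / 2) := by
  rw [spinTrace, map_one, Units.val_one, Matrix.trace_one]
  simp

theorem spinTrace_rel {n : ℕ} (x y : SpinSym n) (a b : Fin (n - 1)) :
    spinTrace n (x * (SpinSym.t a * (SpinSym.t b * y))) +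
      spinTrace n (x * (SpinSym.t b * (SpinSym.t a * y))) = spinForm a b * spinTrace n (x * y) := by
  simp only [spinTrace, map_mul, Units.val_mul]
  rw [← Matrix.trace_add, ← mul_add, ← mul_assoc, ← mul_assoc, ← add_mul, basicSpin_t_anticomm,
    smul_one_mul, mul_smul_comm, Matrix.trace_smul, smul_eq_mul]

theorem SpinSym.shift_t {n N o : ℕ} (h : o + n ≤ N) (a : Fin (n - 1)) :
    shift h (t a) = t ⟨o + a.1, by omega⟩ := SpinSym.lift_t _ _

theorem SpinSym.shift_z {n N o : ℕ} (h : o + n ≤ N) : shift h (z n) = z N := SpinSym.lift_z _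

/-- On even elements of a block the trace is determined by the defining relations, up to a
factor. -/
theorem spinTrace_shift_mul {n N o : ℕ} (h : o + n ≤ N) (y : SpinSym N)
    (hy : ∀ a : Fin (n - 1), Commute (SpinSym.shift h (SpinSym.t a)) y) {x : SpinSym n}
    (hx : SpinSym.parity n x = 1) :
    spinTrace N (SpinSym.shift h x * y) * 2 ^ (n / 2) = spinTrace n x * spinTrace N y := by
  obtain ⟨l, ⟨m, hl⟩, hxl⟩ := SpinSym.exists_even_word hx
  let w : List (Fin (n - 1)) → SpinSym n := fun l => (l.map SpinSym.t).prod
  have hw : ∀ p a b q, w (p ++ a :: b :: q) = w p * (SpinSym.t a * (SpinSym.t b * w q)) :=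
    fun p a b q => by simp [w]
  -- The difference of the two sides satisfies the same relations as a trace and vanishes at the
  -- empty word, by the dimension `2 ^ (n / 2)` of the module.
  have key := eq_zero_of_even_word
    (fun l => spinTrace N (SpinSym.shift h (w l) * y) * 2 ^ (n / 2) -
      spinTrace n (w l) * spinTrace N y) (fun a b => spinForm a b) ?_ ?_ ?_ m l (by omega)
  · have key' := sub_eq_zero.1 key
    rcases hxl with rfl | rfl
    · exact key'
    · rw [map_mul, SpinSym.shift_z, mul_assoc, spinTrace_z_mul, spinTrace_z_mul, neg_mul, neg_mul]
      exact congrArg _ key'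
  · intro p a b q
    have e1 := spinTrace_rel (SpinSym.shift h (w p)) (SpinSym.shift h (w q) * y)
      ⟨o + a.1, by omega⟩ ⟨o + b.1, by omega⟩
    have e2 := spinTrace_rel (w p) (w q) a b
    have e3 : spinForm (o + a.1) (o + b.1) = spinForm a b := by
      simp [spinForm, add_assoc]
    rw [e3, ← SpinSym.shift_t h, ← SpinSym.shift_t h] at e1
    have e4 : w (p ++ q) = w p * w q := by simp [w]
    simp only [hw, e4, map_mul, mul_assoc] at e1 e2 ⊢
    linear_combination (2 ^ (n / 2) : ℂ) * e1 - spinTrace N y * e2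
  · intro a l
    have e1 : w (a :: l) = SpinSym.t a * w l := by simp [w]
    have e2 : w (l ++ [a]) = w l * SpinSym.t a := by simp [w]
    beta_reduce
    rw [e1, e2, spinTrace_mul_comm (SpinSym.t a), map_mul, map_mul, mul_assoc, spinTrace_mul_comm,
      mul_assoc, ← (hy a).eq, ← mul_assoc]
  · simp [w, spinTrace_one, mul_comm]

end Words
end SpinVertex

namespace SpinVertex

/-! ### The normalized basic spin characters form a multiplicative family. -/

section SpinFamily

/-- The reason for the scaling factor: the scaled dimension of the basic spin module is
multiplicative in `n`. -/
theorem parityFactor_mul (n : ℕ) : parityFactor n * 2 ^ (n / 2) = (Real.sqrt 2 : ℂ) ^ n := by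
  have h2 : ((Real.sqrt 2 : ℝ) : ℂ) ^ 2 = 2 := by
    rw [← Complex.ofReal_pow, Real.sq_sqrt (by norm_num)]; norm_num
  rw [parityFactor, Complex.ofReal_pow]
  rw [← h2]
  rw [← pow_mul, ← pow_add, Nat.mod_add_div]

/-- `spinTrace_shift_mul` is applied to each block in turn, and the dimensions recombine by
`parityFactor_mul`. -/
theorem spinTrace_block {n k N : ℕ} (h : n + k = N) {x : SpinSym n} {y : SpinSym k}
    (hx : SpinSym.parity n x = 1) (hy : SpinSym.parity k y = 1) :
    parityFactor N * spinTrace N (SpinSym.shift (o := 0) (by omega) x *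
      SpinSym.shift (o := n) (by omega) y) =
    (parityFactor n * spinTrace n x) * (parityFactor k * spinTrace k y) := by
  have hR : n + k ≤ N := by omega
  have h1 := spinTrace_shift_mul (o := 0) (N := N) (by omega) (SpinSym.shift (o := n) hR y)
    (fun a => by
      have := SpinSym.shift_mul_shift h (SpinSym.t a) y
      rw [hy, SpinSym.zPow, if_neg (fun h => mult_zmod_two_ne h.2), one_mul] at this
      exact this.symm) hx
  have h2 := spinTrace_shift_mul (o := n) (N := N) hR 1 (fun a => Commute.one_right _) hy
  rw [mul_one, spinTrace_one] at h2
  have hne : (2 : ℂ) ^ (n / 2) * 2 ^ (k / 2) ≠ 0 :=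
    mul_ne_zero (pow_ne_zero _ two_ne_zero) (pow_ne_zero _ two_ne_zero)
  apply mul_right_cancel₀ hne
  have e1 := parityFactor_mul n
  have e2 := parityFactor_mul k
  have e3 := parityFactor_mul N
  rw [← h, pow_add, h, ← e1, ← e2] at e3
  linear_combination parityFactor N * 2 ^ (k / 2) * h1 + parityFactor N * spinTrace n x * h2 +
    spinTrace n x * spinTrace k y * e3

variable {Γ : Type*} [Group Γ]

theorem basicChar_apply {V : Type*} [AddCommGroup V] [Module ℂ V] [FiniteDimensional ℂ V]
    (ρ : Representation ℂ Γ V) (n : ℕ) (w : SpinWreath Γ n) :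
    (basicChar ρ n).1 w = (tensorPower ρ n).character w * spinTrace n w.right := by
  rw [← basicSpinRep_character, ← spinModule_character]; rfl

variable (Γ) in
/-- The normalized characters of the basic spin representations. -/
noncomputable def spinFam : Fam Γ :=
  hat fun l => parityFactor l • basicChar (Representation.trivial ℂ Γ ℂ) l

theorem spinFam_toStr {n : ℕ} {w : SpinWreath Γ n} (hw : Odd (orderOf w.right)) :
    spinFam Γ (Fin n) w.toStr = parityFactor n * spinTrace n w.right := by
  rw [spinFam, hat_fin, transfer_toStr _ hw, Submodule.coe_smul, Pi.smul_apply, basicChar_apply,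
    trivial_tensorPower_character, one_mul, smul_eq_mul]

/-- The family of the basic spin characters attached to a representation. -/
noncomputable def charFam {V : Type*} [AddCommGroup V] [Module ℂ V] [FiniteDimensional ℂ V]
    (ρ : Representation ℂ Γ V) : Fam Γ := hat fun l => parityFactor l • basicChar ρ l

theorem charFam_eq {V : Type*} [AddCommGroup V] [Module ℂ V] [FiniteDimensional ℂ V]
    {κ : Type*} [Fintype κ] (b : Module.Basis κ ℂ V)
    (ρ : Representation ℂ Γ V) {U : Type} [Finite U] (x : Str Γ U) :
    charFam ρ U x = spinFam Γ U x * tensorFam b ρ U x := by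
  have e := Finite.equivFin U
  rw [charFam, ← hat_isNat _ _ _ e, spinFam, ← hat_isNat _ _ _ e,
    ← (tensorFam_isMult b ρ).isNat _ _ e]
  by_cases hx : Odd (orderOf (x.map e).2)
  · obtain ⟨w, hw, ho⟩ := SpinWreath.exists_odd_toStr hx
    rw [← hw]
    have := spinFam_toStr ho
    rw [spinFam] at this
    rw [this, hat_fin, transfer_toStr _ ho, Submodule.coe_smul, Pi.smul_apply, basicChar_apply,
      tensorFam_toStr, smul_eq_mul]
    ring
  · rw [hat_of_not_odd _ hx, hat_of_not_odd _ hx, zero_mul]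

variable (Γ) in
-- If both permutations have odd order, the product of their odd lifts is the odd lift and
-- `spinTrace_block` applies; otherwise both sides vanish.
theorem spinFam_isMult : IsMult (spinFam Γ) where
  isNat := hat_isNat _
  sum U V _ _ x y := by
    have hnat : IsNat (spinFam Γ) := hat_isNat _
    have e := Finite.equivFin U
    have e' := Finite.equivFin V
    rw [← hnat _ _ e, ← hnat _ _ e', ← hnat _ _ (e.sumCongr e'), ← Str.sum_map,
      ← hnat _ _ (blockEquiv rfl)]
    generalize x.map e = x
    generalize y.map e' = y
    by_cases hxy : Odd (orderOf x.2) ∧ Odd (orderOf y.2)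
    · obtain ⟨a, rfl, ha⟩ := SpinWreath.exists_odd_toStr hxy.1
      obtain ⟨b, rfl, hb⟩ := SpinWreath.exists_odd_toStr hxy.2
      rw [← SpinWreath.toStr_embL_mul_embR, spinFam_toStr ha, spinFam_toStr hb,
        spinFam_toStr (SpinWreath.odd_embL_mul_embR rfl ha hb), SemidirectProduct.mul_right,
        SpinWreath.right_embL, SpinWreath.right_embR]
      exact spinTrace_block rfl (parity_eq_one_of_odd _ ha) (parity_eq_one_of_odd _ hb)
    · have h1 : ¬ Odd (orderOf ((x.sum y).map (blockEquiv rfl)).2) := by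
        rwa [Str.map, orderOf_permCongr, odd_orderOf_sum_iff]
      rw [spinFam, hat_of_not_odd _ h1]
      rcases not_and_or.1 hxy with h | h
      · rw [hat_of_not_odd _ h, zero_mul]
      · rw [hat_of_not_odd _ h, mul_zero]
  empty U _ x := by
    have hnat : IsNat (spinFam Γ) := hat_isNat _
    have e : U ≃ Fin 0 := Equiv.equivOfIsEmpty _ _
    rw [← hnat _ _ e]
    have : x.map e = (1 : SpinWreath Γ 0).toStr := Subsingleton.elim _ _
    rw [this, spinFam_toStr (by simp), SemidirectProduct.one_right, spinTrace_one]
    simp [parityFactor]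

theorem charFam_isMult {V : Type*} [AddCommGroup V] [Module ℂ V] [FiniteDimensional ℂ V]
    (ρ : Representation ℂ Γ V) : IsMult (charFam ρ) where
  isNat := hat_isNat _
  sum U V' _ _ x y := by
    have b := Module.finBasis ℂ V
    rw [charFam_eq b, charFam_eq b, charFam_eq b, (spinFam_isMult Γ).sum,
      (tensorFam_isMult b ρ).sum, mul_mul_mul_comm]
  empty U _ x := by
    rw [charFam_eq (Module.finBasis ℂ V), (spinFam_isMult Γ).empty, (tensorFam_isMult _ ρ).empty,
      one_mul]

end SpinFamily

end SpinVertex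

namespace SpinVertex

/-! ### Values of the basic spin characters at cycles. -/

section Cycle


/-- Since `A` commutes with `Q`, the traces of `A B Q` and `B A Q` agree, and they add up to the
trace of `Q`. -/
theorem trace_of_commute {κ : Type*} [Fintype κ] [DecidableEq κ] {A B Q : Matrix κ κ ℂ}
    (hAB : A * B + B * A = 1) (hQ : A * Q = Q * A) :
    2 * (A * (B * Q)).trace = Q.trace ∧ 2 * (Q * (B * A)).trace = Q.trace := by
  have h1 : (A * (B * Q)).trace + (B * A * Q).trace = Q.trace := by
    rw [← mul_assoc, ← Matrix.trace_add, ← add_mul, hAB, one_mul]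
  have h2 : (B * A * Q).trace = (A * (B * Q)).trace := by
    rw [mul_assoc, hQ, ← mul_assoc, Matrix.trace_mul_comm]
  have h3 : (Q * (B * A)).trace = (B * A * Q).trace := Matrix.trace_mul_comm _ _
  constructor
  · rw [← h1, h2]; ring
  · rw [h3, ← h1, h2]; ring

theorem mul_prod_of_anticomm {R : Type*} [Ring R] {A : R} {l : List R}
    (h : ∀ B ∈ l, B * A = -(A * B)) : A * l.prod = (-1) ^ l.length * (l.prod * A) := by
  induction l with
  | nil => simp
  | cons B l ih =>
    have hB := neg_eq_iff_eq_neg.1 (h B (by simp)).symm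
    rw [List.prod_cons, ← mul_assoc, hB, neg_mul, mul_assoc,
      ih fun C hC => h C (List.mem_cons_of_mem _ hC), List.length_cons, pow_succ, mul_neg_one,
      neg_mul, ← mul_assoc B, ((Commute.neg_one_right B).pow_right _).eq]
    simp only [mul_assoc]

theorem prod_mul_prod_reverse {R : Type*} [Ring R] {l : List R} (h : ∀ B ∈ l, B * B = -1) :
    l.prod * l.reverse.prod = (-1) ^ l.length := by
  induction l with
  | nil => simp
  | cons B l ih =>
    rw [List.prod_cons, List.reverse_cons, List.prod_append, List.prod_singleton, mul_assoc,
      ← mul_assoc l.prod, ih fun C hC => h C (List.mem_cons_of_mem _ hC), List.length_cons,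
      pow_succ, ← ((Commute.neg_one_right B).pow_right _).eq, ← mul_assoc, h B (by simp),
      neg_one_mul, mul_neg_one]

/-- Two generators are removed at a time. The first anticommutes with all later ones except its
neighbour, hence commutes with the even word that remains, so each pair contributes a factor 1/2.
The reversed word is needed for the inverse. -/
theorem trace_prod_gen (k : ℕ) (j : ℕ) : ∀ o, o + 2 * j ≤ 2 * k →
    2 ^ j * (((List.range' o (2 * j)).map (basicSpinGen k)).prod).trace = 2 ^ k ∧
    2 ^ j * (((List.range' o (2 * j)).map (basicSpinGen k)).reverse.prod).trace = 2 ^ k := by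
  induction j with
  | zero => intro o _; simp [Matrix.trace_one]
  | succ j ih =>
    intro o h
    have e : List.range' o (2 * (j + 1)) = o :: (o + 1) :: List.range' (o + 2) (2 * j) := by
      rw [mul_add, mul_one, List.range'_succ, List.range'_succ]
    have h1 := basicSpinGen_near k o (by omega)
    have hlist : ∀ B ∈ (List.range' (o + 2) (2 * j)).map (basicSpinGen k),
        B * basicSpinGen k o = -(basicSpinGen k o * B) := by
      intro B hB
      obtain ⟨b, hb, rfl⟩ := List.mem_map.1 hB
      rw [List.mem_range'_1] at hb
      exact basicSpinGen_anticomm_far k b o (by omega) (by omega)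
    have h2 := mul_prod_of_anticomm hlist
    have h3 := mul_prod_of_anticomm (A := basicSpinGen k o)
      (l := ((List.range' (o + 2) (2 * j)).map (basicSpinGen k)).reverse)
      (fun B hB => hlist B (List.mem_reverse.1 hB))
    simp only [List.length_reverse, List.length_map, List.length_range', pow_mul, neg_one_sq,
      one_pow, one_mul] at h2 h3
    obtain ⟨i1, i2⟩ := ih (o + 2) (by omega)
    rw [e, List.map_cons, List.map_cons, List.prod_cons, List.prod_cons, List.reverse_cons,
      List.reverse_cons, List.prod_append, List.prod_append, List.prod_singleton,
      List.prod_singleton, mul_assoc _ (basicSpinGen k (o + 1)) (basicSpinGen k o)]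
    constructor
    · rw [pow_succ, mul_assoc, (trace_of_commute h1 h2).1, i1]
    · rw [pow_succ, mul_assoc, (trace_of_commute h1 h3).2, i2]

/-- The product of all generators of the spin group. -/
def SpinSym.coxeter (n : ℕ) : SpinSym n := (List.ofFn (SpinSym.t (n := n))).prod

theorem basicSpin_coxeter (n : ℕ) : (basicSpin n (SpinSym.coxeter n)).1 =
    ((List.range' 0 (n - 1)).map (basicSpinGen (n / 2))).prod := by
  have e : (basicSpin n (SpinSym.coxeter n)).1 =
    ((Units.coeHom _).comp (basicSpin n)) (SpinSym.coxeter n) := rfl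
  rw [e, SpinSym.coxeter, map_list_prod, List.map_ofFn]
  congr 1
  refine List.ext_getElem (by simp) fun i h1 h2 => ?_
  simp [basicSpin, basicSpinUnit]

/-- For odd `n` the word has even length, so the reversed word is exactly its inverse, without sign.
-/
theorem spinTrace_coxeter {n : ℕ} (hn : Odd n) : spinTrace n (SpinSym.coxeter n) = 1 ∧
    spinTrace n (SpinSym.coxeter n)⁻¹ = 1 := by
  obtain ⟨j, rfl⟩ := hn
  have hdiv : (2 * j + 1) / 2 = j := by omega
  obtain ⟨h1, h2⟩ := trace_prod_gen ((2 * j + 1) / 2) j 0 (by omega)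
  have e : (basicSpin (2 * j + 1) (SpinSym.coxeter (2 * j + 1))).1 =
    ((List.range' 0 (2 * j)).map (basicSpinGen ((2 * j + 1) / 2))).prod := basicSpin_coxeter _
  have h3 := prod_mul_prod_reverse
    (l := (List.range' 0 (2 * j)).map (basicSpinGen ((2 * j + 1) / 2))) (fun B hB => by
      obtain ⟨b, hb, rfl⟩ := List.mem_map.1 hB
      rw [List.mem_range'_1] at hb
      exact basicSpinGen_sq _ _ (by omega))
  rw [← e, List.length_map, List.length_range', pow_mul, neg_one_sq, one_pow] at h3
  have e' := Units.inv_eq_of_mul_eq_one_right h3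
  have hp : (2 : ℂ) ^ ((2 * j + 1) / 2) = 2 ^ j := by rw [hdiv]
  rw [hp] at h1 h2
  constructor
  · rw [spinTrace, e]
    exact mul_left_cancel₀ (pow_ne_zero j two_ne_zero) (h1.trans (mul_one _).symm)
  · rw [spinTrace, map_inv, e']
    exact mul_left_cancel₀ (pow_ne_zero j two_ne_zero) (h2.trans (mul_one _).symm)

theorem toPerm_coxeter (n : ℕ) :
    SpinSym.toPerm n (SpinSym.coxeter n) = (List.finRange n).formPerm := by
  rw [SpinSym.coxeter, map_list_prod, List.map_ofFn, List.formPerm]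
  congr 1
  refine List.ext_getElem (by simp) fun i h1 h2 => ?_
  simp [SpinSym.toPerm, adjSwap]

variable {Γ : Type*} [Group Γ]

theorem isConj_coxeter {n : ℕ} {x : Str Γ (Fin n)} (hx : x.IsTrans) :
    IsConj x.2 (SpinSym.toPerm n (SpinSym.coxeter n)) := by
  rw [toPerm_coxeter]
  rcases Nat.lt_or_ge 1 n with hn | hn
  · obtain ⟨h1, h2⟩ := hx.isCycle (by simpa using hn)
    have hlen : 2 ≤ (List.finRange n).length := by rw [List.length_finRange]; exact hn
    refine h1.isConj (List.isCycle_formPerm (List.nodup_finRange n) hlen) ?_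
    rw [h2, List.support_formPerm_of_nodup _ (List.nodup_finRange n) (fun y hy => by
      rw [hy] at hlen; simp at hlen)]
    congr 1
    ext i
    simp
  · have : Subsingleton (Fin n) := ⟨fun a b => Fin.ext (by omega)⟩
    rw [Subsingleton.elim x.2 (List.finRange n).formPerm]

/-- At an odd cycle a lift is conjugate to the product of all generators up to `z`, and the
ambiguity cancels between the element and its inverse. The two traces multiply to 1 and the squared
scaling factor is 2. At an even cycle both sides vanish. -/
theorem spinFam_mul_inv {U : Type} [Finite U] [Nonempty U] {x : Str Γ U} (hx : x.IsTrans) :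
    spinFam Γ U x * spinFam Γ U x.inv = 1 - (-1) ^ Nat.card U := by
  by_cases hodd : Odd (Nat.card U)
  · have hnat := (spinFam_isMult Γ).isNat
    have ho : Odd (orderOf x.2) := by rwa [orderOf_of_isTrans hx]
    have e := Finite.equivFin U
    rw [← hnat _ _ e, ← hnat _ _ e, ← Str.inv_map]
    have hx' : (x.map e).IsTrans := by
      intro i j
      have := hx (e.symm i) (e.symm j)
      obtain ⟨m, hm⟩ := this
      refine ⟨m, ?_⟩
      have : (x.map e).2 = e.permCongrHom x.2 := rfl
      rw [this, ← map_zpow]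
      simp [hm]
    obtain ⟨w, hw, hwo⟩ := SpinWreath.exists_odd_toStr (x := x.map e)
      (by rwa [Str.map, orderOf_permCongr])
    rw [← hw] at hx' ⊢
    generalize Nat.card U = n at *
    obtain ⟨τ, hτ⟩ := isConj_iff.1 (isConj_coxeter hx')
    obtain ⟨t, rfl⟩ := SpinSym.toPerm_surjective n τ
    have hτ' : SpinSym.toPerm n (t * w.right * t⁻¹) = SpinSym.toPerm n (SpinSym.coxeter n) := by
      rw [map_mul, map_mul, map_inv]; exact hτ
    have hc1 : ∀ y : SpinSym n, spinTrace n (t * y * t⁻¹) = spinTrace n y := fun y => by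
      rw [spinTrace_mul_comm, inv_mul_cancel_left]
    obtain ⟨c1, c2⟩ := spinTrace_coxeter hodd
    have hinv : (t * w.right * t⁻¹)⁻¹ = t * w.right⁻¹ * t⁻¹ := by group
    have htr : spinTrace n w.right * spinTrace n w.right⁻¹ = 1 := by
      rw [← hc1, ← hc1 w.right⁻¹, ← hinv]
      -- If the conjugate is `z` times the product of the generators, both traces change sign.
      rcases SpinSym.eq_or_eq_z_mul hτ' with h | h
      · rw [h, c1, c2, one_mul]
      · rw [h, mul_inv_rev, ← inv_eq_of_mul_eq_one_left (SpinSym.z_mul_z n), _root_.inv_inv,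
          spinTrace_mul_comm (SpinSym.coxeter n)⁻¹]
        rw [inv_eq_of_mul_eq_one_left (SpinSym.z_mul_z n)]
        rw [spinTrace_z_mul, spinTrace_z_mul, c1, c2]
        norm_num
    have hpf : parityFactor n * parityFactor n = 2 := by
      rw [parityFactor, Nat.odd_iff.1 hodd, pow_one, ← Complex.ofReal_mul,
        Real.mul_self_sqrt (by norm_num)]
      norm_num
    have hw' : Odd (orderOf (w⁻¹).right) := by
      rwa [SemidirectProduct.inv_right, orderOf_inv]
    rw [← SpinWreath.toStr_inv, spinFam_toStr hwo, spinFam_toStr hw', SemidirectProduct.inv_right,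
      mul_mul_mul_comm, hpf, htr, hodd.neg_one_pow]
    norm_num
  · have ho : ¬ Odd (orderOf x.2) := by rwa [orderOf_of_isTrans hx]
    rw [spinFam, hat_of_not_odd _ ho, zero_mul, (Nat.not_odd_iff_even.1 hodd).neg_one_pow, sub_self]

end Cycle
end SpinVertex

namespace SpinVertex

/-! ### The structure constants: pairings and the alternating family. -/

section Constants

variable {Γ : Type*} [Group Γ]

/-- The labels act trivially here, so label sums can be carried out first in the pairing. -/
theorem spinFam_congr {n : ℕ} (g g' : Fin n → Γ) (s : Equiv.Perm (Fin n)) :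
    spinFam Γ (Fin n) (g, s) = spinFam Γ (Fin n) (g', s) := by
  rw [spinFam, hat_fin, hat_fin, transfer, transfer]
  simp only [Submodule.coe_smul, Pi.smul_apply, basicChar_apply, trivial_tensorPower_character]

variable (Γ) in
theorem spinFam_mul_inv_isMult : IsMult fun U (x : Str Γ U) => spinFam Γ U x * spinFam Γ U x.inv where
  isNat U V e x := by
    beta_reduce
    rw [Str.inv_map, (spinFam_isMult Γ).isNat, (spinFam_isMult Γ).isNat]
  sum U V _ _ x y := by
    beta_reduce
    rw [Str.inv_sum, (spinFam_isMult Γ).sum, (spinFam_isMult Γ).sum, mul_mul_mul_comm]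
  empty U _ x := by
    beta_reduce
    rw [(spinFam_isMult Γ).empty, (spinFam_isMult Γ).empty, one_mul]

/-- Both sides are multiplicative, and at a cycle of length m both equal 1 - (-1)^m. -/
theorem spinFam_mul_inv_eq {U : Type} [Finite U] (x : Str Γ U) :
    spinFam Γ U x * spinFam Γ U x.inv = (signFam Γ).mul (fun _ _ => 1) U x :=
  (spinFam_mul_inv_isMult Γ).ext ((signFam_isMult Γ).mul (one_isMult Γ)) (fun V _ _ x hx => by
    rw [spinFam_mul_inv hx, (signFam_isMult Γ).mul_of_isTrans (one_isMult Γ) hx,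
      signFam_of_isTrans hx]
    ring) x

variable [Finite Γ] {V W : Type*} [AddCommGroup V] [Module ℂ V] [FiniteDimensional ℂ V]
  [AddCommGroup W] [Module ℂ W] [FiniteDimensional ℂ W]
  (ρ : Representation ℂ Γ V) (σ : Representation ℂ Γ W)

/-- Averaging over the labels first. -/
theorem integral_of_label_sum [Fintype Γ] {n : ℕ} (w t : Str Γ (Fin n) → ℂ) (c : ℂ)
    (hw : ∀ g g' s, w (g, s) = w (g', s))
    (ht : ∀ s, ∑ g : Fin n → Γ, t (g, s) = c * (Nat.card Γ : ℂ) ^ n) :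
    integral (Fin n) (fun x => w x * t x) = c * integral (Fin n) w := by
  let : Fintype (Str Γ (Fin n)) := instFintypeProd _ _
  have e : ∑ x, w x * t x = c * ∑ x, w x := by
    have h1 : ∀ f : Str Γ (Fin n) → ℂ, ∑ x, f x = ∑ s : Equiv.Perm (Fin n), ∑ g : Fin n → Γ, f (g, s) :=
      fun f => Fintype.sum_prod_type_right _
    rw [h1, h1, Finset.mul_sum]
    refine Finset.sum_congr rfl fun s _ => ?_
    rw [Finset.sum_congr rfl fun g _ => by rw [hw g 1 s], ← Finset.mul_sum, ht,
      Finset.sum_congr rfl (fun g _ => hw g 1 s), Finset.sum_const, Finset.card_univ,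
      Fintype.card_fun, Fintype.card_fin, nsmul_eq_mul, Nat.card_eq_fintype_card]
    push_cast
    ring
  rw [integral, integral, finsum_eq_sum_of_fintype, finsum_eq_sum_of_fintype, e]
  ring

theorem pairing_eq_integral {κ μ : Type*} [Fintype κ] [Fintype μ] (b : Module.Basis κ ℂ V)
    (c : Module.Basis μ ℂ W) (l : ℕ) : pairing (charFam ρ) (charFam σ) l =
      integral (Fin l) fun x => (spinFam Γ _ x * spinFam Γ _ x.inv) *
        (tensorFam b ρ _ x * tensorFam c σ _ x.inv) := by
  unfold pairing
  congr 1
  funext x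
  rw [charFam_eq b, charFam_eq c, mul_mul_mul_comm]

theorem pairing_charFam_zero : pairing (charFam ρ) (charFam σ) 0 = 1 := by
  rw [pairing, ← integral_one (Γ := Γ) 0]
  congr 1
  funext x
  rw [(charFam_isMult ρ).empty, (charFam_isMult σ).empty, one_mul]

/-- For every permutation the tensor power part has label average 1; what remains is evaluated by
`integral_sign_mul_one`. -/
theorem pairing_charFam_self (hρ : ρ.IsIrreducible) (l : ℕ) :
    pairing (charFam ρ) (charFam ρ) l = if l = 0 then 1 else 2 := by
  have := Fintype.ofFinite Γ
  have b := Module.finBasis ℂ V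
  rw [pairing_eq_integral ρ ρ b b, integral_of_label_sum _ _ 1]
  · rw [one_mul, ← integral_sign_mul_one (Γ := Γ)]
    congr 1
    funext x
    exact spinFam_mul_inv_eq x
  · intro g g' s
    rw [spinFam_congr g g']
    congr 1
  · intro s
    rw [sum_tensorFam_self b ρ s hρ, Fintype.card_fin, one_mul]

/-- In positive degree the label sum vanishes for each permutation separately. -/
theorem pairing_charFam_of_isEmpty (hρ : ρ.IsIrreducible) (hσ : σ.IsIrreducible)
    (h : IsEmpty (σ.Equiv ρ)) (l : ℕ) :
    pairing (charFam ρ) (charFam σ) l = if l = 0 then 1 else 0 := by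
  split_ifs with hl
  · rw [hl, pairing_charFam_zero]
  · have := Fintype.ofFinite Γ
    have : Nonempty (Fin l) := ⟨⟨0, Nat.pos_of_ne_zero hl⟩⟩
    have b := Module.finBasis ℂ V
    have c := Module.finBasis ℂ W
    rw [pairing_eq_integral ρ σ b c, integral_of_label_sum _ _ 0, zero_mul]
    · intro g g' s
      rw [spinFam_congr g g']
      congr 1
    · intro s
      rw [sum_tensorFam_of_isEmpty b c ρ σ s hρ hσ h, zero_mul]

/-- The family of the basic spin characters with alternating signs. -/
noncomputable def altCharFam : Fam Γ := fun U x => (-1) ^ Nat.card U * charFam ρ U x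

theorem altCharFam_isMult : IsMult (altCharFam ρ) where
  isNat U V e x := by
    rw [altCharFam, altCharFam, (charFam_isMult ρ).isNat, Nat.card_congr e]
  sum U V _ _ x y := by
    rw [altCharFam, altCharFam, altCharFam, (charFam_isMult ρ).sum, Nat.card_sum, pow_add,
      mul_mul_mul_comm]
  empty U _ x := by
    rw [altCharFam, (charFam_isMult ρ).empty, Nat.card_of_isEmpty, pow_zero, one_mul]

/-- At a cycle the product of the families is their sum. The two terms cancel at odd length, and
both vanish at even length. -/
theorem altCharFam_mul_eq_zero {U : Type} [Finite U] [Nonempty U] (x : Str Γ U) :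
    (altCharFam ρ).mul (charFam ρ) U x = 0 := by
  refine ((altCharFam_isMult ρ).mul (charFam_isMult ρ)).eq_zero (fun V _ _ x hx => ?_) x
  rw [(altCharFam_isMult ρ).mul_of_isTrans (charFam_isMult ρ) hx, altCharFam]
  by_cases hodd : Odd (Nat.card V)
  · rw [hodd.neg_one_pow, neg_one_mul, neg_add_cancel]
  · rw [charFam, hat_of_not_odd _ (by rwa [orderOf_of_isTrans hx]), mul_zero, add_zero]

end Constants

/-! ### Relations among creation and annihilation operators. -/

section Relations

open Finset.HasAntidiagonal (antidiagonal)

variable {Γ : Type*} [Group Γ] [Finite Γ] {V W : Type*} [AddCommGroup V] [Module ℂ V]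
  [FiniteDimensional ℂ V] [AddCommGroup W] [Module ℂ W] [FiniteDimensional ℂ W]
  (ρ : Representation ℂ Γ V) (σ : Representation ℂ Γ W)

/-- The normalized basic spin characters. -/
noncomputable def normChar (k : ℕ) : RMinus Γ k := parityFactor k • basicChar ρ k

/-- The creation operators of the basic spin characters. -/
noncomputable def createOp (k : ℕ) : Module.End ℂ (RGamma Γ) := creation (normChar ρ k)

/-- The annihilation operators of the basic spin characters. -/
noncomputable def annihOp (k : ℕ) : Module.End ℂ (RGamma Γ) :=
  annihilation (Representation.trivial ℂ Γ ℂ) (normChar ρ k)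

theorem hatOne_normChar (k : ℕ) {U : Type} [Finite U] (x : Str Γ U) :
    hatOne (normChar ρ k) U x = (charFam ρ).grade k U x :=
  hat_single (normChar ρ) k x

theorem hatG_createOp (k : ℕ) (f : RGamma Γ) {U : Type} [Finite U] :
    hatG (createOp ρ k f) U = ((charFam ρ).grade k).mul (hatG f) U := by
  funext x
  rw [createOp, hatG_creation]
  exact congrFun (mul_congr_fam (fun V _ => funext fun y => hatOne_normChar ρ k y)
    fun _ _ => rfl) x

theorem hatG_annihOp (k : ℕ) (f : RGamma Γ) {U : Type} [Finite U] :
    hatG (annihOp ρ k f) U = contr (charFam ρ) k (hatG f) U := by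
  funext x
  rw [annihOp, hatG_annihilation]
  unfold contr
  congr 1
  funext y
  rw [hatOne_normChar, Fam.grade, if_pos (Nat.card_fin k)]

theorem hatG_ext {A B : Module.End ℂ (RGamma Γ)}
    (h : ∀ (f : RGamma Γ) (U : Type) [Finite U] (x : Str Γ U), hatG (A f) U x = hatG (B f) U x) :
    A = B :=
  LinearMap.ext fun f => hat_injective fun U _ x => h f U x

theorem createOp_comm (a b : ℕ) : createOp ρ a * createOp σ b = createOp σ b * createOp ρ a := by
  refine hatG_ext fun f U _ x => ?_
  simp only [Module.End.mul_apply, hatG_createOp]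
  rw [mul_congr_fam (fun _ _ => rfl) (fun V _ => hatG_createOp σ b f),
    mul_congr_fam (fun _ _ => rfl) (fun V _ => hatG_createOp ρ a f)]
  exact mul_left_comm_fam ((charFam_isMult ρ).isNat.grade a) ((charFam_isMult σ).isNat.grade b)
    (hatG_isNat f) x

theorem annihOp_comm (a b : ℕ) : annihOp ρ a * annihOp σ b = annihOp σ b * annihOp ρ a := by
  refine hatG_ext fun f U _ x => ?_
  simp only [Module.End.mul_apply, hatG_annihOp]
  rw [contr_congr (fun V _ => hatG_annihOp σ b f), contr_congr (fun V _ => hatG_annihOp ρ a f)]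
  exact contr_contr_comm _ _ (hatG_isNat f) a b x

theorem hatG_sum {ι : Type*} (s : Finset ι) (f : ι → RGamma Γ) (U : Type) (x : Str Γ U) :
    hatG (∑ i ∈ s, f i) U x = ∑ i ∈ s, hatG (f i) U x :=
  map_sum (hatLin U x) f s

theorem annihOp_mul_createOp (l k : ℕ) : annihOp ρ l * createOp σ k =
    ∑ p ∈ antidiagonal l, if p.1 ≤ k then
      pairing (charFam ρ) (charFam σ) p.1 • (createOp σ (k - p.1) * annihOp ρ p.2) else 0 := by
  refine hatG_ext fun f U _ x => ?_
  rw [Module.End.mul_apply, hatG_annihOp, contr_congr (fun V _ => hatG_createOp σ k f),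
    contr_grade_mul (charFam_isMult ρ) (charFam_isMult σ) (hatG_isNat f), LinearMap.sum_apply,
    hatG_sum]
  refine Finset.sum_congr rfl fun p _ => ?_
  split_ifs
  · rw [LinearMap.smul_apply, hatG_smul, Module.End.mul_apply, hatG_createOp,
      mul_congr_fam (fun _ _ => rfl) (fun V _ => hatG_annihOp ρ p.2 f)]
  · rw [LinearMap.zero_apply, hatG_zero]

theorem altCharFam_mul_empty {U : Type} [IsEmpty U] (x : Str Γ U) :
    (altCharFam ρ).mul (charFam ρ) U x = 1 :=
  ((altCharFam_isMult ρ).mul (charFam_isMult ρ)).empty U x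

/-- With Q(z) the generating series of the operators this says Q(-z) Q(z) = 1: the signs turn the
first family into the alternating one, and its product with the second is the unit family. -/
theorem sum_createOp_mul_createOp (n : ℕ) : ∑ p ∈ antidiagonal n,
    (-1 : ℂ) ^ p.1 • (createOp ρ p.1 * createOp ρ p.2) = if n = 0 then 1 else 0 := by
  refine hatG_ext fun f U _ x => ?_
  have h1 := sum_grade_mul_mul (altCharFam_isMult ρ).isNat (charFam_isMult ρ).isNat
    (hatG_isNat f) n x
  rw [grade_mul_of_vanish (hatG_isNat f) (fun V _ _ => altCharFam_mul_eq_zero ρ)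
    (fun V _ => altCharFam_mul_empty ρ)] at h1
  have h2 : hatG ((if n = 0 then 1 else 0 : Module.End ℂ (RGamma Γ)) f) U x =
      if n = 0 then hatG f U x else 0 := by
    split_ifs
    · rfl
    · rw [LinearMap.zero_apply, hatG_zero]
  rw [h2, ← h1, LinearMap.sum_apply, hatG_sum]
  refine Finset.sum_congr rfl fun p _ => ?_
  rw [LinearMap.smul_apply, hatG_smul, Module.End.mul_apply, hatG_createOp,
    mul_congr_fam (fun _ _ => rfl) (fun V _ => hatG_createOp ρ p.2 f), ← smul_mul_fam]
  refine congrFun (mul_congr_fam (fun V _ => funext fun y => ?_) fun _ _ => rfl) x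
  unfold Fam.grade altCharFam
  split_ifs with h
  · rw [h]
  · rw [mul_zero]

/-- The same identity of families, read through `sum_contr_contr`. -/
theorem sum_annihOp_mul_annihOp (n : ℕ) : ∑ p ∈ antidiagonal n,
    (-1 : ℂ) ^ p.1 • (annihOp ρ p.1 * annihOp ρ p.2) = if n = 0 then 1 else 0 := by
  refine hatG_ext fun f U _ x => ?_
  have h1 := sum_contr_contr (altCharFam_isMult ρ).isNat (charFam_isMult ρ).isNat
    (hatG_isNat f) n x
  rw [contr_of_vanish (hatG_isNat f) (fun V _ _ => altCharFam_mul_eq_zero ρ)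
    (fun V _ => altCharFam_mul_empty ρ)] at h1
  have h2 : hatG ((if n = 0 then 1 else 0 : Module.End ℂ (RGamma Γ)) f) U x =
      if n = 0 then hatG f U x else 0 := by
    split_ifs
    · rfl
    · rw [LinearMap.zero_apply, hatG_zero]
  rw [h2, ← h1, LinearMap.sum_apply, hatG_sum]
  refine Finset.sum_congr rfl fun p _ => ?_
  rw [LinearMap.smul_apply, hatG_smul, Module.End.mul_apply, hatG_annihOp,
    contr_congr (fun V _ => hatG_annihOp ρ p.2 f), contr, contr, ← integral_const_mul]
  congr 1
  funext y
  rw [altCharFam, Nat.card_fin, mul_assoc]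

theorem annihOp_lof_of_lt {l m : ℕ} (h : m < l) (v : RMinus Γ m) :
    annihOp ρ l (DirectSum.lof ℂ ℕ (fun j => RMinus Γ j) m v) = 0 := by
  rw [annihOp, annihilation, DirectSum.toModule_lof, dif_neg (by omega), LinearMap.zero_apply]

end Relations
end SpinVertex

namespace SpinVertex

open Finset.HasAntidiagonal (antidiagonal)
open Filter

/-! ### Formal derivation of the Clifford relations. -/

section Clifford

variable {M : Type*} [AddCommGroup M] [Module ℂ M]

/-- Extension of a sequence of operators to the integers by zero. -/
def extZ (Q : ℕ → Module.End ℂ M) (k : ℤ) : Module.End ℂ M := if 0 ≤ k then Q k.toNat else 0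

theorem extZ_natCast (Q : ℕ → Module.End ℂ M) (k : ℕ) : extZ Q k = Q k := by simp [extZ]

theorem extZ_of_neg (Q : ℕ → Module.End ℂ M) {k : ℤ} (h : k < 0) : extZ Q k = 0 :=
  if_neg (by omega)

theorem extZ_comm {Q Q' : ℕ → Module.End ℂ M} (h : ∀ a b, Q a * Q' b = Q' b * Q a) (a b : ℤ) :
    extZ Q a * extZ Q' b = extZ Q' b * extZ Q a := by
  unfold extZ
  split_ifs <;> simp [h]

/-- The operator `X n` is the sum of `(-1) ^ l Q (l - n) D l`, with finitely many contributions on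
every vector. -/
structure IsVertexSum (Q D : ℕ → Module.End ℂ M) (X : ℤ → Module.End ℂ M) : Prop where
  expand : ∀ n w, ∀ᶠ L in atTop,
    X n w = ∑ l ∈ Finset.range L, (-1 : ℂ) ^ l • extZ Q (l - n) (D l w)
  vanish : ∀ w, ∀ᶠ l in atTop, D l w = 0

/-- Cutting off by total degree or by a rectangle is the same once the support lies in the
rectangle. -/
theorem sum_range_antidiagonal {N : Type*} [AddCommMonoid N] (f : ℕ × ℕ → N) {J A L : ℕ}
    (hL : J + A ≤ L) (hf : ∀ p, f p ≠ 0 → p.1 < J ∧ p.2 < A) :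
    ∑ l ∈ Finset.range L, ∑ p ∈ antidiagonal l, f p =
      ∑ a ∈ Finset.range A, ∑ j ∈ Finset.range J, f (j, a) := by
  rw [Finset.sum_comm, ← Finset.sum_product' (Finset.range J) (Finset.range A) fun j a => f (j, a),
    ← Finset.sum_fiberwise_of_maps_to (t := Finset.range L) (g := fun p : ℕ × ℕ => p.1 + p.2)]
  · refine Finset.sum_congr rfl fun l _ => (Finset.sum_subset ?_ ?_).symm
    · intro p hp
      rw [Finset.mem_filter] at hp
      exact Finset.HasAntidiagonal.mem_antidiagonal.2 hp.2
    · intro p hp hp'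
      by_contra hne
      refine hp' (Finset.mem_filter.2 ⟨?_, Finset.HasAntidiagonal.mem_antidiagonal.1 hp⟩)
      have := hf p hne
      simpa using this
  · intro p hp
    simp only [Finset.mem_product, Finset.mem_range] at hp ⊢
    omega

variable {Q D Q' D' : ℕ → Module.End ℂ M} {X X' : ℤ → Module.End ℂ M} {c : ℕ → ℂ}

/-- After extension by zero to negative indices the condition `p.1 ≤ k` is automatic. -/
theorem annih_extZ (hDQ : ∀ l k, D l * Q' k = ∑ p ∈ antidiagonal l,
      if p.1 ≤ k then c p.1 • (Q' (k - p.1) * D p.2) else 0) (l : ℕ) (k : ℤ) :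
    D l * extZ Q' k = ∑ p ∈ antidiagonal l, c p.1 • (extZ Q' (k - p.1) * D p.2) := by
  rcases lt_or_ge k 0 with hk | hk
  · rw [extZ_of_neg _ hk, mul_zero]
    symm
    refine Finset.sum_eq_zero fun p _ => ?_
    rw [extZ_of_neg _ (by omega), zero_mul, smul_zero]
  · lift k to ℕ using hk
    rw [extZ_natCast, hDQ]
    refine Finset.sum_congr rfl fun p _ => ?_
    split_ifs with h
    · rw [← Nat.cast_sub h, extZ_natCast]
    · rw [extZ_of_neg _ (by omega), zero_mul, smul_zero]

/-- Normal ordering. Moving `D l` past the second creation operator contracts `j` units and leaves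
`D a` with `l = j + a`. The two cutoffs are stated eventually so that different products can be
given common ones. -/
theorem IsVertexSum.mul_apply (hX : IsVertexSum Q D X) (hX' : IsVertexSum Q' D' X')
    (hD : ∀ a b, D a * D' b = D' b * D a)
    (hDQ : ∀ l k, D l * Q' k = ∑ p ∈ antidiagonal l,
      if p.1 ≤ k then c p.1 • (Q' (k - p.1) * D p.2) else 0) (n n' : ℤ) (v : M) :
    ∀ᶠ A in atTop, ∀ᶠ J in atTop, (X n * X' n') v =
      ∑ a ∈ Finset.range A, ∑ b ∈ Finset.range A, (-1 : ℂ) ^ (a + b) •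
        (∑ j ∈ Finset.range J, ((-1) ^ j * c j) • (extZ Q (a - n + j) * extZ Q' (b - n' - j)))
          (D a (D' b v)) := by
  filter_upwards [hX'.expand n' v, eventually_forall_ge_atTop.2 (hX.vanish v)] with A hA hA'
  -- Beyond this bound the index `b - n' - j` is negative, so larger `j` contribute nothing.
  filter_upwards [eventually_ge_atTop (A + n'.natAbs + 1)] with J hJ
  rw [Module.End.mul_apply, hA, map_sum, Finset.sum_comm]
  refine Finset.sum_congr rfl fun b hb => ?_
  rw [Finset.mem_range] at hb
  obtain ⟨L, hL1, hL2⟩ := ((hX.expand n (extZ Q' (b - n') (D' b v))).and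
    (eventually_ge_atTop (J + A))).exists
  have e : ∀ l, D l (extZ Q' (b - n') (D' b v)) =
      ∑ p ∈ antidiagonal l, c p.1 • extZ Q' (b - n' - p.1) (D p.2 (D' b v)) := fun l => by
    rw [← Module.End.mul_apply, annih_extZ hDQ, LinearMap.sum_apply]
    rfl
  rw [map_smul, hL1]
  have e2 : ∀ l ∈ Finset.range L, (-1 : ℂ) ^ l • extZ Q (l - n) (D l (extZ Q' (b - n') (D' b v))) =
      ∑ p ∈ antidiagonal l, ((-1 : ℂ) ^ (p.1 + p.2) * c p.1) •
        extZ Q (p.2 - n + p.1) (extZ Q' (b - n' - p.1) (D p.2 (D' b v))) := fun l _ => by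
    rw [e, map_sum, Finset.smul_sum]
    refine Finset.sum_congr rfl fun p hp => ?_
    rw [Finset.HasAntidiagonal.mem_antidiagonal] at hp
    subst hp
    rw [map_smul, smul_smul]
    congr 3
    push_cast
    ring
  rw [Finset.sum_congr rfl e2, sum_range_antidiagonal _ hL2, Finset.smul_sum]
  · refine Finset.sum_congr rfl fun a _ => ?_
    rw [LinearMap.sum_apply, Finset.smul_sum, Finset.smul_sum]
    refine Finset.sum_congr rfl fun j _ => ?_
    rw [LinearMap.smul_apply, smul_smul, smul_smul, Module.End.mul_apply]
    congr 1
    ring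
  · intro p hp
    constructor
    · by_contra hlt
      rw [extZ_of_neg Q' (k := b - n' - p.1) (by omega), LinearMap.zero_apply, map_zero,
        smul_zero] at hp
      exact hp rfl
    · by_contra hlt
      -- The annihilation operators commute, and those of index at least `A` kill `v`.
      have : D p.2 (D' b v) = D' b (D p.2 v) := LinearMap.congr_fun (hD _ _) v
      rw [this, hA' _ (by omega), map_zero, map_zero, map_zero, smul_zero] at hp
      exact hp rfl

/-- Only `j = 0` survives in the normally ordered product, which is then symmetric in the two
operators. -/
theorem IsVertexSum.commute (hX : IsVertexSum Q D X) (hX' : IsVertexSum Q' D' X')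
    (hQ : ∀ a b, Q a * Q' b = Q' b * Q a) (hD : ∀ a b, D a * D' b = D' b * D a)
    (hDQ : ∀ l k, D l * Q' k = ∑ p ∈ antidiagonal l,
      if p.1 ≤ k then (if p.1 = 0 then (1 : ℂ) else 0) • (Q' (k - p.1) * D p.2) else 0)
    (hDQ' : ∀ l k, D' l * Q k = ∑ p ∈ antidiagonal l,
      if p.1 ≤ k then (if p.1 = 0 then (1 : ℂ) else 0) • (Q (k - p.1) * D' p.2) else 0)
    (n n' : ℤ) : X n * X' n' = X' n' * X n := by
  refine LinearMap.ext fun v => ?_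
  obtain ⟨A, h1, h2⟩ := ((hX.mul_apply (c := fun j => if j = 0 then (1 : ℂ) else 0) hX' hD hDQ n n' v).and
    (hX'.mul_apply (c := fun j => if j = 0 then (1 : ℂ) else 0) hX (fun a b => (hD b a).symm) hDQ' n' n v)).exists
  obtain ⟨J, ⟨h1, h2⟩, hJ⟩ := ((h1.and h2).and (eventually_gt_atTop 0)).exists
  have hS : ∀ (R R' : ℕ → Module.End ℂ M) (x y : ℤ), (∑ j ∈ Finset.range J,
      ((-1) ^ j * (if j = 0 then (1 : ℂ) else 0)) • (extZ R (x + j) * extZ R' (y - j))) =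
      extZ R x * extZ R' y := fun R R' x y => by
    rw [Finset.sum_eq_single 0]
    · simp
    · intro j _ hj
      rw [if_neg hj, mul_zero, zero_smul]
    · intro h
      exact absurd (Finset.mem_range.2 hJ) h
  simp only [hS] at h1 h2
  rw [h1, h2, Finset.sum_comm]
  refine Finset.sum_congr rfl fun a _ => Finset.sum_congr rfl fun b _ => ?_
  rw [add_comm, extZ_comm hQ]
  congr 2
  exact LinearMap.congr_fun (hD _ _) v

/-- Adding the expansion of (1 + t)/(1 - t) to that in the inverse variable gives twice the formal
delta series: the term `j = 0` has weight 1 but occurs twice. -/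
theorem sum_symmetric_range {N : Type*} [AddCommGroup N] [Module ℂ N] (G : ℤ → N) (J : ℕ) :
    ∑ j ∈ Finset.range J, (if j = 0 then (1 : ℂ) else 2) • (G j + G (-j)) =
      (2 : ℂ) • ∑ j ∈ Finset.Ioo (-J : ℤ) J, G j := by
  induction J with
  | zero => simp
  | succ J ih =>
    rw [Finset.sum_range_succ, ih]
    by_cases hJ : J = 0
    · subst hJ
      have : Finset.Ioo (-((0 + 1 : ℕ) : ℤ)) ((0 + 1 : ℕ) : ℤ) = {0} := by
        ext i
        simp only [Finset.mem_Ioo, Finset.mem_singleton]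
        omega
      rw [this]
      simp [two_smul]
    · have : Finset.Ioo (-((J + 1 : ℕ) : ℤ)) ((J + 1 : ℕ) : ℤ) =
          insert (J : ℤ) (insert (-J : ℤ) (Finset.Ioo (-J : ℤ) J)) := by
        ext i
        simp only [Finset.mem_Ioo, Finset.mem_insert]
        omega
      rw [this, Finset.sum_insert (by simp; omega), Finset.sum_insert (by simp), if_neg hJ,
        ← smul_add]
      congr 1
      abel

/-- The substitution `p.1 = x + j` turns this into the relation `hQQ` in degree `x + y`, up to the
sign (-1)^x. The bounds on `J` ensure that the whole antidiagonal is covered. -/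
theorem sum_extZ (hQQ : ∀ n, ∑ p ∈ antidiagonal n, (-1 : ℂ) ^ p.1 • (Q p.1 * Q p.2) =
      if n = 0 then 1 else 0) (x y : ℤ) {J : ℕ} (hx : x.natAbs < J) (hy : y.natAbs < J) :
    ∑ j ∈ Finset.Ioo (-J : ℤ) J, (-1 : ℂ) ^ j • (extZ Q (x + j) * extZ Q (y - j)) =
      if x + y = 0 then (-1 : ℂ) ^ x • 1 else 0 := by
  rcases lt_or_ge (x + y) 0 with h | h
  · rw [if_neg h.ne]
    refine Finset.sum_eq_zero fun j _ => ?_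
    rcases lt_or_ge (x + j) 0 with h1 | h1
    · rw [extZ_of_neg _ h1, zero_mul, smul_zero]
    · rw [extZ_of_neg Q (k := y - j) (by omega), mul_zero, smul_zero]
  · obtain ⟨N, hN⟩ := Int.eq_ofNat_of_zero_le h
    have h1 := hQQ N
    have h2 : ∑ p ∈ antidiagonal N, (-1 : ℂ) ^ x • ((-1 : ℂ) ^ p.1 • (Q p.1 * Q p.2)) =
        ∑ j ∈ Finset.Ioo (-J : ℤ) J, (-1 : ℂ) ^ j • (extZ Q (x + j) * extZ Q (y - j)) := by
      refine Finset.sum_of_injOn (fun p => (p.1 : ℤ) - x) ?_ ?_ ?_ ?_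
      · intro p hp q hq hpq
        simp only [Finset.mem_coe,
          Finset.HasAntidiagonal.mem_antidiagonal] at hp hq hpq
        exact Prod.ext (by omega) (by omega)
      · intro p hp
        simp only [Finset.mem_coe, Finset.HasAntidiagonal.mem_antidiagonal, Finset.mem_Ioo] at hp ⊢
        omega
      · intro j _ hj'
        rcases lt_or_ge (x + j) 0 with h1 | h1
        · rw [extZ_of_neg _ h1, zero_mul, smul_zero]
        · rcases lt_or_ge (y - j) 0 with h2 | h2
          · rw [extZ_of_neg Q h2, mul_zero, smul_zero]
          · refine absurd ⟨((x + j).toNat, (y - j).toNat), ?_, ?_⟩ hj'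
            · simp only [Finset.mem_coe, Finset.HasAntidiagonal.mem_antidiagonal]
              omega
            · simp only
              omega
      · intro p hp
        rw [Finset.HasAntidiagonal.mem_antidiagonal] at hp
        have e1 : x + ((p.1 : ℤ) - x) = (p.1 : ℕ) := by ring
        have e2 : y - ((p.1 : ℤ) - x) = (p.2 : ℕ) := by omega
        have e3 : (-1 : ℂ) ^ ((p.1 : ℤ) - x) = (-1) ^ x * (-1) ^ p.1 := by
          rw [sub_eq_add_neg, zpow_add₀ (by norm_num), zpow_natCast, zpow_neg, mul_comm, ← inv_zpow]
          norm_num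
        rw [e1, e2, e3, extZ_natCast, extZ_natCast, smul_smul]
    rw [← h2, ← Finset.smul_sum, h1]
    by_cases hN0 : N = 0
    · rw [if_pos hN0, if_pos (by omega)]
    · rw [if_neg hN0, if_neg (by omega), smul_zero]

/-- The two normally ordered products combine into a sum over all integers `j`. The relation `hQQ`
reduces it to the pairs with `a + b = n + n'`, and the relation `hDD` then kills everything unless
`n + n' = 0`. -/
theorem IsVertexSum.anticommute (hX : IsVertexSum Q D X)
    (hQ : ∀ a b, Q a * Q b = Q b * Q a) (hD : ∀ a b, D a * D b = D b * D a)
    (hDQ : ∀ l k, D l * Q k = ∑ p ∈ antidiagonal l,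
      if p.1 ≤ k then (if p.1 = 0 then (1 : ℂ) else 2) • (Q (k - p.1) * D p.2) else 0)
    (hQQ : ∀ n, ∑ p ∈ antidiagonal n, (-1 : ℂ) ^ p.1 • (Q p.1 * Q p.2) =
      if n = 0 then 1 else 0)
    (hDD : ∀ n, ∑ p ∈ antidiagonal n, (-1 : ℂ) ^ p.1 • (D p.1 * D p.2) =
      if n = 0 then 1 else 0) (n n' : ℤ) :
    X n * X n' + X n' * X n = (if n = -n' then 2 * (-1 : ℂ) ^ n else 0) • 1 := by
  refine LinearMap.ext fun v => ?_
  obtain ⟨A, ⟨h1, h2⟩, hA⟩ := (((hX.mul_apply (c := fun j => if j = 0 then (1 : ℂ) else 2) hX hD hDQ n n' v).and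
    (hX.mul_apply (c := fun j => if j = 0 then (1 : ℂ) else 2) hX hD hDQ n' n v)).and (eventually_gt_atTop (n + n').natAbs)).exists
  obtain ⟨J, ⟨h1, h2⟩, hJ⟩ := ((h1.and h2).and
    (eventually_gt_atTop (A + n.natAbs + n'.natAbs))).exists
  have hS : ∀ x y : ℤ, x.natAbs < J → y.natAbs < J →
      (∑ j ∈ Finset.range J, ((-1) ^ j * (if j = 0 then (1 : ℂ) else 2)) •
        (extZ Q (x + j) * extZ Q (y - j))) +
      (∑ j ∈ Finset.range J, ((-1) ^ j * (if j = 0 then (1 : ℂ) else 2)) •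
        (extZ Q (y + j) * extZ Q (x - j))) =
      (2 : ℂ) • (if x + y = 0 then (-1 : ℂ) ^ x • 1 else 0) := by
    intro x y hx hy
    rw [← sum_extZ hQQ x y hx hy, ← sum_symmetric_range, ← Finset.sum_add_distrib]
    refine Finset.sum_congr rfl fun j _ => ?_
    have e : (-1 : ℂ) ^ (-(j : ℤ)) = (-1) ^ j := by
      rw [zpow_neg, zpow_natCast, ← inv_pow]; norm_num
    rw [e, zpow_natCast, ← smul_add, ← smul_add, smul_smul, mul_comm ((-1 : ℂ) ^ j),
      extZ_comm hQ (y + j), sub_neg_eq_add, sub_eq_add_neg x]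
  rw [LinearMap.add_apply, h1, h2]
  -- In the reversed product the two annihilation indices exchange roles, so that both products run
  -- over the same pairs `a`, `b`.
  nth_rewrite 2 [Finset.sum_comm]
  rw [← Finset.sum_add_distrib]
  have hterm : ∀ a ∈ Finset.range A, ∀ b ∈ Finset.range A, (-1 : ℂ) ^ (a + b) •
        (∑ j ∈ Finset.range J, ((-1) ^ j * (if j = 0 then (1 : ℂ) else 2)) •
          (extZ Q (a - n + j) * extZ Q (b - n' - j))) (D a (D b v)) +
      (-1 : ℂ) ^ (b + a) •
        (∑ j ∈ Finset.range J, ((-1) ^ j * (if j = 0 then (1 : ℂ) else 2)) •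
          (extZ Q (b - n' + j) * extZ Q (a - n - j))) (D b (D a v)) =
      if (a : ℤ) + b = n + n' then (2 * (-1 : ℂ) ^ n) • (-1 : ℂ) ^ b • D b (D a v) else 0 := by
    intro a ha b hb
    rw [Finset.mem_range] at ha hb
    have hab : D a (D b v) = D b (D a v) := LinearMap.congr_fun (hD a b) v
    rw [hab, add_comm b a, ← smul_add, ← LinearMap.add_apply,
      hS (a - n) (b - n') (by omega) (by omega)]
    have hiff : (a : ℤ) - n + (b - n') = 0 ↔ (a : ℤ) + b = n + n' := by omega
    simp only [hiff]
    split_ifs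
    · rw [LinearMap.smul_apply, LinearMap.smul_apply, Module.End.one_apply, smul_smul, smul_smul,
        smul_smul]
      congr 1
      rw [sub_eq_add_neg, zpow_add₀ (by norm_num), zpow_natCast, zpow_neg, ← inv_zpow, pow_add]
      have : ((-1 : ℂ) ^ a) * (-1) ^ a = 1 := by rw [← mul_pow]; norm_num
      have h3 : ((-1 : ℂ))⁻¹ = -1 := by norm_num
      rw [h3]
      linear_combination (2 * (-1) ^ b * (-1 : ℂ) ^ n) * this
    · simp
  rw [Finset.sum_congr rfl fun a ha => (Finset.sum_add_distrib (s := Finset.range A)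
    (f := fun b => _) (g := fun b => _)).symm.trans (Finset.sum_congr rfl (hterm a ha))]
  rcases lt_or_ge (n + n') 0 with h | h
  · rw [if_neg (by omega), zero_smul, LinearMap.zero_apply]
    refine Finset.sum_eq_zero fun a _ => Finset.sum_eq_zero fun b _ => if_neg (by omega)
  · obtain ⟨N, hN⟩ := Int.eq_ofNat_of_zero_le h
    have h3 := LinearMap.congr_fun (hDD N) v
    rw [LinearMap.sum_apply] at h3
    -- The cutoff `A` exceeds `|n + n'|`, so the square contains the whole antidiagonal; swapping
    -- coordinates matches the sign (-1)^b with that in `hDD`.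
    have h4 : ∑ p ∈ antidiagonal N, (2 * (-1 : ℂ) ^ n) • ((-1 : ℂ) ^ p.1 • (D p.1 * D p.2)) v =
        ∑ a ∈ Finset.range A, ∑ b ∈ Finset.range A, if (a : ℤ) + b = n + n' then
          (2 * (-1 : ℂ) ^ n) • (-1 : ℂ) ^ b • D b (D a v) else 0 := by
      rw [← Finset.sum_product' (Finset.range A) (Finset.range A) fun a b : ℕ =>
        if (a : ℤ) + b = n + n' then (2 * (-1 : ℂ) ^ n) • (-1 : ℂ) ^ b • D b (D a v) else 0,
        ← Finset.sum_filter]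
      refine Finset.sum_bij' (fun p _ => p.swap) (fun p _ => p.swap) ?_ ?_ ?_ ?_ ?_
      · intro p hp
        rw [Finset.HasAntidiagonal.mem_antidiagonal] at hp
        simp only [Finset.mem_filter, Finset.mem_product, Finset.mem_range, Prod.fst_swap,
          Prod.snd_swap]
        omega
      · intro p hp
        simp only [Finset.mem_filter, Finset.mem_product, Finset.mem_range] at hp
        rw [Finset.HasAntidiagonal.mem_antidiagonal, Prod.fst_swap, Prod.snd_swap]
        omega
      · simp
      · simp
      · intro p _
        rfl
    rw [← h4, ← Finset.smul_sum, h3]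
    by_cases hN0 : N = 0
    · rw [if_pos hN0, if_pos (by omega), LinearMap.smul_apply]
    · rw [if_neg hN0, if_neg (by omega), zero_smul, LinearMap.zero_apply, smul_zero]

end Clifford
end SpinVertex

namespace SpinVertex

open Finset.HasAntidiagonal (antidiagonal)
open Filter

/-! ### The vertex operators and their relations. -/

section Vertex

variable {Γ : Type*} [Group Γ] [Finite Γ] {V : Type*} [AddCommGroup V] [Module ℂ V]
  [FiniteDimensional ℂ V] (ρ : Representation ℂ Γ V)

/-- For given `l` at most one creation index is possible, namely `l - n`, and it lies in the finite
range used in `vertexCoeff`. The terms with `l > m` vanish, so any larger cutoff gives the same sum.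
-/
theorem vertexPlus_lof (n : ℤ) {m L : ℕ} (hL : m < L) (v : RMinus Γ m) :
    vertexPlus (Representation.trivial ℂ Γ ℂ) ρ n (DirectSum.lof ℂ ℕ (fun j => RMinus Γ j) m v) =
      ∑ l ∈ Finset.range L, (-1 : ℂ) ^ l • extZ (M := RGamma Γ) (createOp ρ) (l - n)
        (annihOp ρ l (DirectSum.lof ℂ ℕ (fun j => RMinus Γ j) m v)) := by
  rw [vertexPlus, vertexCoeff, DirectSum.toModule_lof, LinearMap.comp_apply, Finset.sum_filter,
    Finset.sum_product, LinearMap.sum_apply]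
  refine Finset.sum_subset_zero_on_sdiff (Finset.range_subset_range.2 hL) (fun l hl => ?_)
    fun l hl => ?_
  · have : m < l := by
      simp only [Finset.mem_sdiff, Finset.mem_range] at hl
      omega
    rw [annihOp_lof_of_lt ρ this, map_zero, smul_zero]
  · rw [Finset.mem_range] at hl
    dsimp only
    rcases lt_or_ge ((l : ℤ) - n) 0 with h | h
    · rw [extZ_of_neg _ h, LinearMap.zero_apply, smul_zero, Finset.sum_eq_zero,
        LinearMap.zero_apply]
      intro k _
      exact if_neg (by omega)
    · obtain ⟨k, hk⟩ := Int.eq_ofNat_of_zero_le h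
      rw [hk, extZ_natCast, Finset.sum_eq_single k, if_pos (by omega)]
      · rfl
      · intro k' _ hk'
        exact if_neg (by omega)
      · intro hk'
        refine absurd (Finset.mem_range.2 ?_) hk'
        omega

theorem vertexPlus_isVertexSum : IsVertexSum (M := RGamma Γ) (createOp ρ) (annihOp ρ)
    (vertexPlus (Representation.trivial ℂ Γ ℂ) ρ) where
  expand n w := by
    induction w using DirectSum.induction_on with
    | zero => simp
    | of m v =>
      filter_upwards [eventually_gt_atTop m] with L hL
      exact vertexPlus_lof ρ n hL v
    | add f g hf hg =>
      filter_upwards [hf, hg] with L h1 h2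
      rw [map_add, h1, h2, ← Finset.sum_add_distrib]
      refine Finset.sum_congr rfl fun l _ => ?_
      rw [map_add, map_add, smul_add]
  vanish w := by
    induction w using DirectSum.induction_on with
    | zero => simp
    | of m v =>
      filter_upwards [eventually_gt_atTop m] with l hl
      exact annihOp_lof_of_lt ρ hl v
    | add f g hf hg =>
      filter_upwards [hf, hg] with l h1 h2
      rw [map_add, h1, h2, add_zero]

theorem vertexPlus_anticommute (hρ : ρ.IsIrreducible) (n n' : ℤ) :
    vertexPlus (Representation.trivial ℂ Γ ℂ) ρ n * vertexPlus (Representation.trivial ℂ Γ ℂ) ρ n' +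
      vertexPlus (Representation.trivial ℂ Γ ℂ) ρ n' *
        vertexPlus (Representation.trivial ℂ Γ ℂ) ρ n =
      (if n = -n' then 2 * (-1 : ℂ) ^ n else 0) • 1 := by
  refine (vertexPlus_isVertexSum ρ).anticommute (createOp_comm ρ ρ) (annihOp_comm ρ ρ)
    (fun l k => ?_) (sum_createOp_mul_createOp ρ) (sum_annihOp_mul_annihOp ρ) n n'
  rw [annihOp_mul_createOp]
  simp only [pairing_charFam_self ρ hρ]

theorem vertexPlus_commute {W : Type*} [AddCommGroup W] [Module ℂ W] [FiniteDimensional ℂ W]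
    (σ : Representation ℂ Γ W) (hρ : ρ.IsIrreducible) (hσ : σ.IsIrreducible)
    (h : IsEmpty (ρ.Equiv σ)) (h' : IsEmpty (σ.Equiv ρ)) (n n' : ℤ) :
    vertexPlus (Representation.trivial ℂ Γ ℂ) ρ n * vertexPlus (Representation.trivial ℂ Γ ℂ) σ n' =
      vertexPlus (Representation.trivial ℂ Γ ℂ) σ n' *
        vertexPlus (Representation.trivial ℂ Γ ℂ) ρ n := by
  refine (vertexPlus_isVertexSum ρ).commute (vertexPlus_isVertexSum σ) (createOp_comm ρ σ)
    (annihOp_comm ρ σ) (fun l k => ?_) (fun l k => ?_) n n'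
  · rw [annihOp_mul_createOp]
    simp only [pairing_charFam_of_isEmpty ρ σ hρ hσ h']
  · rw [annihOp_mul_createOp]
    simp only [pairing_charFam_of_isEmpty σ ρ hσ hρ h]

/-! ### The operators of the virtual representation `-ρ` -/

/-- A tensor power of the zero space is zero, except that the empty one is one-dimensional. -/
theorem transfer_basicChar_zero {n : ℕ} (x : Str Γ (Fin n)) :
    transfer (basicChar (1 : Representation ℂ Γ PUnit) n) x = if n = 0 then 1 else 0 := by
  by_cases hx : Odd (orderOf x.2)
  · obtain ⟨w, rfl, hw⟩ := SpinWreath.exists_odd_toStr hx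
    rw [transfer_toStr _ hw, basicChar_apply,
      tensorPower_character (Module.Basis.empty PUnit : Module.Basis Empty ℂ PUnit)]
    split_ifs with h
    · subst h
      obtain rfl : w = 1 := SpinWreath.eq_of_odd hw (by simp) (Subsingleton.elim _ _)
      rw [SemidirectProduct.one_right, spinTrace_one]
      simp
    · have : Nonempty (Fin n) := ⟨⟨0, Nat.pos_of_ne_zero h⟩⟩
      rw [Finset.univ_eq_empty, Finset.sum_empty, zero_mul]
  · rw [transfer_of_not_odd _ hx, if_neg]
    rintro rfl
    exact hx (by rw [Subsingleton.elim x.2 1, orderOf_one]; exact odd_one)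

variable (Γ) in
/-- The unit of the product of families. -/
noncomputable def unitFam : Fam Γ := fun U _ => if Nat.card U = 0 then 1 else 0

theorem hatOne_basicChar_zero (k : ℕ) {U : Type} [Finite U] (x : Str Γ U) :
    hatOne (basicChar (1 : Representation ℂ Γ PUnit) k) U x = (unitFam Γ).grade k U x := by
  rw [Fam.grade, unitFam]
  by_cases hU : Nat.card U = k
  · have e : U ≃ Fin k := (Finite.equivFin U).trans (finCongr hU)
    rw [hatOne_eq _ e, transfer_basicChar_zero, if_pos hU, hU]
  · rw [hatOne_eq_zero _ hU, if_neg hU]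

theorem transfer_sum_smul {n : ℕ} {ι : Type*} (s : Finset ι) (c : ι → ℂ) (u : ι → RMinus Γ n)
    (x : Str Γ (Fin n)) :
    transfer (∑ i ∈ s, c i • u i) x = ∑ i ∈ s, c i * transfer (u i) x := by
  unfold transfer
  split_ifs <;> simp

/-- The characters built from the zero module form the unit family, so only the summand `m = n`
survives. -/
theorem basicCharNeg_eq (n : ℕ) : basicCharNeg ρ n = (-1 : ℂ) ^ n • basicChar ρ n := by
  refine transfer_injective fun x => ?_
  have hmul : ∀ (m : Fin (n + 1)) (h : n - m.1 + m.1 = n),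
      transfer (indProd h (outer h (basicChar (1 : Representation ℂ Γ PUnit) (n - m.1))
        (basicChar ρ m.1))) x = if n - m.1 = 0 then hatOne (basicChar ρ m.1) (Fin n) x else 0 := by
    intro m h
    rw [← hatOne_fin, hatOne_indProd, mul_congr_fam
      (fun V _ => funext fun y => hatOne_basicChar_zero (n - m.1) y) (fun _ _ => rfl)]
    refine grade_mul_of_vanish (hatOne_isNat _) (fun V _ _ y => ?_) (fun V _ y => ?_) _ _
    · exact if_neg Nat.card_pos.ne'
    · exact if_pos Nat.card_of_isEmpty
  rw [basicCharNeg, transfer_sum_smul]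
  simp only [hmul]
  rw [Finset.sum_eq_single (Fin.last n)]
  · rw [Fin.val_last, if_pos (Nat.sub_self n), hatOne_fin]
    have := transfer_sum_smul {()} (fun _ => (-1 : ℂ) ^ n) (fun _ => basicChar ρ n) x
    rw [Finset.sum_singleton, Finset.sum_singleton] at this
    exact this.symm
  · intro m _ hm
    have : m.1 ≠ n := fun h => hm (Fin.ext h)
    rw [if_neg (by omega), mul_zero]
  · intro h
    exact absurd (Finset.mem_univ _) h

theorem hatOne_smul {n : ℕ} (c : ℂ) (u : RMinus Γ n) (U : Type) (x : Str Γ U) :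
    hatOne (c • u) U x = c * hatOne u U x := by
  rw [hatOne, hatOne, ← hat_smul, map_smul]
  rfl

theorem creation_smul {n : ℕ} (c : ℂ) (u : RMinus Γ n) : creation (c • u) = c • creation u := by
  refine hatG_ext fun f U _ x => ?_
  rw [LinearMap.smul_apply, hatG_smul, hatG_creation, hatG_creation, ← smul_mul_fam]
  exact congrFun (mul_congr_fam (fun V _ => funext fun y => hatOne_smul c u V y)
    fun _ _ => rfl) x

theorem annihilation_smul {n : ℕ} (c : ℂ) (u : RMinus Γ n) :
    annihilation (Representation.trivial ℂ Γ ℂ) (c • u) =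
      c • annihilation (Representation.trivial ℂ Γ ℂ) u := by
  refine hatG_ext fun f U _ x => ?_
  rw [LinearMap.smul_apply, hatG_smul, hatG_annihilation, hatG_annihilation, contr, contr,
    ← integral_const_mul]
  congr 1
  funext y
  rw [hatOne_smul, mul_assoc]

/-- The signs (-1)^k and (-1)^l of the creation and annihilation parts multiply to (-1)^(l - k), and
l - k = n in every term. -/
theorem vertexMinus_eq (n : ℤ) : vertexMinus (Representation.trivial ℂ Γ ℂ) ρ n =
    (-1 : ℂ) ^ n • vertexPlus (Representation.trivial ℂ Γ ℂ) ρ n := by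
  refine DirectSum.linearMap_ext ℂ fun m => LinearMap.ext fun v => ?_
  rw [LinearMap.comp_apply, LinearMap.comp_apply, LinearMap.smul_apply, vertexMinus, vertexPlus,
    vertexCoeff, vertexCoeff, DirectSum.toModule_lof, DirectSum.toModule_lof,
    LinearMap.comp_apply, LinearMap.comp_apply, LinearMap.sum_apply, LinearMap.sum_apply,
    Finset.smul_sum]
  refine Finset.sum_congr rfl fun p hp => ?_
  have hp := (Finset.mem_filter.1 hp).2
  rw [basicCharNeg_eq, basicCharNeg_eq, smul_comm (parityFactor p.1),
    smul_comm (parityFactor p.2), creation_smul, annihilation_smul, smul_mul_smul_comm,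
    smul_smul, LinearMap.smul_apply, LinearMap.smul_apply, smul_smul]
  congr 1
  rw [← hp, sub_eq_add_neg, zpow_add₀ (by norm_num), zpow_natCast, zpow_neg, zpow_natCast,
    ← inv_pow]
  norm_num
  ring

end Vertex
end SpinVertex

theorem mainTheorem11 {Γ : Type*} [Group Γ] [Finite Γ] {ι : Type*} (V : ι → Type*)
    [∀ i, AddCommGroup (V i)] [∀ i, Module ℂ (V i)] [∀ i, FiniteDimensional ℂ (V i)]
    (γ : ∀ i, Representation ℂ Γ (V i)) (hirr : ∀ i, (γ i).IsIrreducible)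
    (hdist : ∀ i j, i ≠ j → IsEmpty ((γ i).Equiv (γ j))) :
    let ξ : Representation ℂ Γ ℂ := Representation.trivial ℂ Γ ℂ
    let Xp : ι → ℤ → Module.End ℂ (SpinVertex.RGamma Γ) := fun i n =>
      SpinVertex.vertexPlus ξ (γ i) n
    let Xm : ι → ℤ → Module.End ℂ (SpinVertex.RGamma Γ) := fun i n =>
      SpinVertex.vertexMinus ξ (γ i) n
    (∀ i j, i ≠ j → ∀ n n' : ℤ,
      Xp i n * Xp j n' = Xp j n' * Xp i n ∧
      Xm i n * Xm j n' = Xm j n' * Xm i n ∧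
      Xp i n * Xm j n' = Xm j n' * Xp i n) ∧
    (∀ i, ∀ n n' : ℤ,
      Xp i n * Xp i n' + Xp i n' * Xp i n = (if n = -n' then 2 * (-1 : ℂ) ^ n else 0) • 1 ∧
      Xm i n * Xm i n' + Xm i n' * Xm i n = (if n = -n' then 2 * (-1 : ℂ) ^ n else 0) • 1 ∧
      Xp i n * Xm i n' + Xm i n' * Xp i n = (if n = -n' then 2 else 0 : ℂ) • 1) := by
  intro ξ Xp Xm
  have hm : ∀ i n, Xm i n = (-1 : ℂ) ^ n • Xp i n := fun i n => SpinVertex.vertexMinus_eq (γ i) n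
  have hc : ∀ i j, i ≠ j → ∀ n n' : ℤ, Xp i n * Xp j n' = Xp j n' * Xp i n := fun i j h n n' =>
    SpinVertex.vertexPlus_commute (γ i) (γ j) (hirr i) (hirr j) (hdist i j h) (hdist j i h.symm) n n'
  have ha : ∀ i, ∀ n n' : ℤ, Xp i n * Xp i n' + Xp i n' * Xp i n =
      (if n = -n' then 2 * (-1 : ℂ) ^ n else 0) • 1 := fun i =>
    SpinVertex.vertexPlus_anticommute (γ i) (hirr i)
  have hsq : ∀ n : ℤ, (-1 : ℂ) ^ (-n) * (-1) ^ n = 1 := fun n => by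
    rw [← zpow_add₀ (by norm_num), neg_add_cancel, zpow_zero]
  have hneg : ∀ n : ℤ, (-1 : ℂ) ^ (-n) = (-1) ^ n := fun n => by
    rw [zpow_neg, ← inv_zpow]; norm_num
  refine ⟨fun i j h n n' => ⟨hc i j h n n', ?_, ?_⟩, fun i n n' => ⟨ha i n n', ?_, ?_⟩⟩
  · rw [hm, hm, smul_mul_smul_comm, smul_mul_smul_comm, hc i j h, mul_comm]
  · rw [hm, mul_smul_comm, smul_mul_assoc, hc i j h]
  · rw [hm, hm, smul_mul_smul_comm, smul_mul_smul_comm, mul_comm ((-1 : ℂ) ^ n'), ← smul_add, ha,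
      smul_smul]
    split_ifs with h
    · rw [h, hsq, one_mul]
    · rw [mul_zero]
  -- The extra sign (-1)^{n'} cancels the (-1)^n of the anticommutator when `n = -n'`.
  · rw [hm, mul_smul_comm, smul_mul_assoc, ← smul_add, ha, smul_smul]
    split_ifs with h
    · subst h
      rw [mul_left_comm, hneg, show (-1 : ℂ) ^ n' * (-1) ^ n' = 1 from hneg n' ▸ hsq n', mul_one]
    · rw [mul_zero]
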